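/- **Definitions.** A *disk pattern* is a collection of closed disks (of positive radius) in which no disk has its boundary contained in the union of two other disks and no disk is the Hausdorff limit of a sequence of distinct disks of the collection. Its *contact graph* has one vertex $v$ for each disk $P(v)$, and an edge $[u,v]$ whenever the distinct disks $P(u),P(v)$ intersect. The *dihedral angle* of two intersecting disks $D_1,D_2$ is the angle in $[0,\pi)$ between the clockwise tangent of $\partial D_1$ and the counterclockwise tangent of $\partial D_2$ at a point of $\partial D_1\cap\partial D_2$. A *disk triangulation graph* is the one-skeleton of a (simplicial) triangulation of the open topological disk. Given a graph $G=(V,E)$ and $\Theta:E\to[0,\pi/2]$, let $\tilde G$ be obtained from $G$ as follows: whenever $v_0,v_1,v_2,v_3$ is a simple loop of $G$ whose four edges all have $\Theta=\pi/2$, and $[v_0,v_2]\in E$ with $\Theta([v_0,v_2])=0$, add the edge $[v_1,v_3]$ if it is not already in $G$. Put $\tilde\Theta=\Theta$ on $E$ and $\tilde\Theta=0$ on the added edges. A disk pattern $P=\{P(v)\}_{v\in V}$ *realizes* $(G,\Theta)$ if its contact graph is $\tilde G$ (with $v$ corresponding to $P(v)$) and its dihedral angle function is $\tilde\Theta$.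 The pattern is *locally finite* in a domain $\Omega$ if all its disks are contained in $\Omega$ and every compact subset of $\Omega$ meets only finitely many of them. Let $U=\{z\in\mathbb C:|z|<1\}$ with its hyperbolic metric. **Theorem.** Let $G=(V,E)$ be a disk triangulation graph and let $\Theta:E\to[0,\pi/2]$ be a function satisfying (C1) if a loop of $G$ formed by three edges $e_1,e_2,e_3$ separates the vertices of $G$ (that is, some two vertices not on the loop cannot be joined by a path in $G$ avoiding the loop), then $\Theta(e_1)+\Theta(e_2)+\Theta(e_3)<\pi$. Let $P$ and $P^*$ be disk patterns in $U$ which realize $(G,\Theta)$, and assume that both $P$ and $P^*$ are locally finite in $U$. Then there is a hyperbolic isometry $f:U\to U$ such that $P^*=f(P)$; more precisely, $P^*(v)=f(P(v))$ for every $v\in V$. -/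

import Mathlib

namespace DiskPatterns

/-! ### Triangulations of the open disk -/

/-- The geometric realization of an abstract simplicial complex `K` with vertex set `V`, in
barycentric coordinates: the functions `x : V → ℝ`, `x ≥ 0`, that vanish outside some simplex and
have total mass `1`. It is topologized as a subspace of the product `V → ℝ`; when every vertex lies
in only finitely many simplices this is the usual (weak, equivalently metric) topology. -/
def realization {V : Type*} (K : AbstractSimplicialComplex V) : Set (V → ℝ) :=
  {x | (∀ v, 0 ≤ x v) ∧ ∃ s ∈ K.faces, (∀ v, v ∉ s → x v = 0) ∧ ∑ v ∈ s, x v = 1}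

/-- `K` is a triangulation of the open topological disk: a locally finite simplicial complex whose
realization is homeomorphic to the open unit disk. -/
def IsDiskTriangulation {V : Type*} (K : AbstractSimplicialComplex V) : Prop :=
  (∀ v : V, {s | s ∈ K.faces ∧ v ∈ s}.Finite) ∧
    Nonempty (realization K ≃ₜ Metric.ball (0 : ℂ) 1)

/-- `G` is the one-skeleton of a triangulation of the open topological disk. -/
def IsDiskTriangulationGraph {V : Type*} (G : SimpleGraph V) : Prop :=
  ∃ K : AbstractSimplicialComplex V, IsDiskTriangulation K ∧
    ∀ u v : V, G.Adj u v ↔ u ≠ v ∧ ∃ s ∈ K.faces, (s : Set V) = {u, v}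

/-! ### Disk patterns -/

/-- A closed disk in the plane, of positive radius. -/
@[ext]
structure ClosedDisk where
  center : ℂ
  radius : ℝ
  radius_pos : 0 < radius

/-- The closed disk as a set of points. -/
def ClosedDisk.carrier (D : ClosedDisk) : Set ℂ := Metric.closedBall D.center D.radius

/-- The boundary circle of a closed disk. -/
def ClosedDisk.boundary (D : ClosedDisk) : Set ℂ := Metric.sphere D.center D.radius

/-- The counterclockwise tangent vector to the boundary circle of `D` at its point `z`. -/
noncomputable def ClosedDisk.ccwTangent (D : ClosedDisk) (z : ℂ) : ℂ := Complex.I * (z - D.center)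

/-- `θ` is the dihedral angle of `D₁` and `D₂`: the boundary circles meet, and `θ` is the angle
between the clockwise tangent of `∂D₁` and the counterclockwise tangent of `∂D₂` at a common point.
(Two circles meet at the same angle at all their common points.) -/
def HasDihedralAngle (D₁ D₂ : ClosedDisk) (θ : ℝ) : Prop :=
  ∃ z ∈ D₁.boundary ∩ D₂.boundary,
    InnerProductGeometry.angle (-(D₁.ccwTangent z)) (D₂.ccwTangent z) = θ

/-- A collection of distinct closed disks, indexed by `V`, is a disk pattern if no disk has its
boundary contained in the union of two other disks, and no disk is the Hausdorff limit of a
sequence of distinct disks of the collection. -/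
structure IsDiskPattern {V : Type*} (P : V → ClosedDisk) : Prop where
  injective : Function.Injective P
  not_covered : ∀ u v w : V, u ≠ v → u ≠ w → v ≠ w →
    ¬ (P u).boundary ⊆ (P v).carrier ∪ (P w).carrier
  not_limit : ∀ (u : V) (s : ℕ → V), Function.Injective s →
    ¬ Filter.Tendsto (fun n => Metric.hausdorffDist (P (s n)).carrier (P u).carrier)
      Filter.atTop (nhds 0)

/-- The contact graph: vertices are the disks, edges join the distinct disks that intersect. -/
def contactGraph {V : Type*} (P : V → ClosedDisk) : SimpleGraph V where
  Adj u v := u ≠ v ∧ ((P u).carrier ∩ (P v).carrier).Nonempty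
  symm := ⟨fun u v h => ⟨h.1.symm, by rw [Set.inter_comm]; exact h.2⟩⟩
  loopless := ⟨fun _ h => h.1 rfl⟩

/-- The pattern is locally finite in `Ω`: all its disks lie in `Ω`, and every compact subset of `Ω`
meets only finitely many of them. -/
def IsLocallyFiniteIn {V : Type*} (P : V → ClosedDisk) (Ω : Set ℂ) : Prop :=
  (∀ v, (P v).carrier ⊆ Ω) ∧
    ∀ K : Set ℂ, K ⊆ Ω → IsCompact K → {v | ((P v).carrier ∩ K).Nonempty}.Finite

/-! ### Realizing the data `(G, Θ)` -/

/-- The vertices `a, c, b, d` form a simple loop of `G`, all four edges have angle `π / 2`, and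
the diagonal `[c, d]` is an edge of `G` with angle `0`: then `[a, b]` is the other reducible
edge. -/
def IsOtherReducible {V : Type*} (G : SimpleGraph V) (Θ : Sym2 V → ℝ) (a b : V) : Prop :=
  a ≠ b ∧ ∃ c d : V,
    (G.Adj a c ∧ Θ s(a, c) = Real.pi / 2) ∧ (G.Adj c b ∧ Θ s(c, b) = Real.pi / 2) ∧
    (G.Adj b d ∧ Θ s(b, d) = Real.pi / 2) ∧ (G.Adj d a ∧ Θ s(d, a) = Real.pi / 2) ∧
    (G.Adj c d ∧ Θ s(c, d) = 0)

/-- The graph `G̃`, obtained from `G` by adding the missing reducible edges. -/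
def completedGraph {V : Type*} (G : SimpleGraph V) (Θ : Sym2 V → ℝ) : SimpleGraph V where
  Adj a b := G.Adj a b ∨ IsOtherReducible G Θ a b
  symm := ⟨by
    rintro a b (h | ⟨hab, c, d, h1, h2, h3, h4, h5⟩)
    · exact Or.inl h.symm
    · refine Or.inr ⟨hab.symm, c, d, ?_, ?_, ?_, ?_, h5⟩
      · exact ⟨h2.1.symm, by rw [Sym2.eq_swap]; exact h2.2⟩
      · exact ⟨h1.1.symm, by rw [Sym2.eq_swap]; exact h1.2⟩
      · exact ⟨h4.1.symm, by rw [Sym2.eq_swap]; exact h4.2⟩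
      · exact ⟨h3.1.symm, by rw [Sym2.eq_swap]; exact h3.2⟩⟩
  loopless := ⟨by
    rintro a (h | h)
    · exact G.loopless.irrefl a h
    · exact h.1 rfl⟩

open Classical in
/-- The function `Θ̃` on the edges of `G̃`: it is `Θ` on the edges of `G` and `0` on the added
edges. -/
noncomputable def completedAngle {V : Type*} (G : SimpleGraph V) (Θ : Sym2 V → ℝ) (e : Sym2 V) :
    ℝ :=
  if e ∈ G.edgeSet then Θ e else 0

/-- `P` is a disk pattern that realizes `(G, Θ)`, with `P v` the disk of the vertex `v`: the
contact graph is `G̃` and the dihedral angle function is `Θ̃`. Only the values of `Θ` on the edges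
of `G` matter. -/
structure Realizes {V : Type*} (P : V → ClosedDisk) (G : SimpleGraph V) (Θ : Sym2 V → ℝ) :
    Prop where
  isDiskPattern : IsDiskPattern P
  contactGraph_eq : contactGraph P = completedGraph G Θ
  dihedralAngle : ∀ u v : V, (contactGraph P).Adj u v →
    HasDihedralAngle (P u) (P v) (completedAngle G Θ s(u, v))

/-- A set `S` of vertices separates the vertices of `G`: there are two vertices outside `S` such
that any path joining them meets `S`. -/
def SeparatesVertices {V : Type*} (G : SimpleGraph V) (S : Set V) : Prop :=
  ∃ x y : V, x ∉ S ∧ y ∉ S ∧ ∀ p : G.Walk x y, ∃ u ∈ p.support, u ∈ S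

/-- If a loop formed by three edges of `G` separates the vertices of `G`, then the sum of the three
angles is less than `π`. -/
def SeparatingTriangleCondition {V : Type*} (G : SimpleGraph V) (Θ : Sym2 V → ℝ) : Prop :=
  ∀ a b c : V, G.Adj a b → G.Adj b c → G.Adj c a → SeparatesVertices G {a, b, c} →
    Θ s(a, b) + Θ s(b, c) + Θ s(c, a) < Real.pi

/-! ### The hyperbolic plane -/

/-- The hyperbolic distance of the Poincaré disk `{|z| < 1}` (curvature `-1`). -/
noncomputable def hypDist (z w : ℂ) : ℝ :=
  2 * Real.arsinh (‖z - w‖ / Real.sqrt ((1 - ‖z‖ ^ 2) * (1 - ‖w‖ ^ 2)))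

/-- `f` restricts to a hyperbolic isometry of the unit disk onto itself. -/
def IsHyperbolicIsometry (f : ℂ → ℂ) : Prop :=
  Set.BijOn f (Metric.ball 0 1) (Metric.ball 0 1) ∧
    ∀ z ∈ Metric.ball (0 : ℂ) 1, ∀ w ∈ Metric.ball (0 : ℂ) 1,
      hypDist (f z) (f w) = hypDist z w

end DiskPatterns

/-!
A disk in `U` is represented by a vector of Minkowski space `ℝ^{2,1}`, of square `κ ^ 2 - 1` where
`κ` is the hyperbolic curvature of its boundary circle; the product of two such vectors is
determined by the curvatures and the dihedral angle. If two realizations have equal curvatures, the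
Gram matrices agree, so the Lorentz transformation that matches a disk and two of its neighbors
matches the next neighbor as well, and by connectedness all disks.

Equality of the curvatures is a maximum principle. The segments between the centers draw `G` without
crossings: the four pairs of endpoints of two crossing edges would be orthogonal, by (C1) the four
triangles they form would not separate `G`, hence be faces, and together they would make up a
sphere. So in both patterns the hyperbolic angles of the triangles of centers add up to `2 * π`
around each vertex. These angles decrease with the distances to the neighbors, which rules out a
maximum greater than `1` of the ratio of the values of `κ ^ 2 - 1`. To have a maximum at all,
enlarge one pattern by a homothety of factor `r > 1`: by local finiteness only finitely many of its
disks remain in `U`. Then let `r` tend to `1`.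
-/

namespace DiskPatterns

open Set Metric Filter Topology

/-! ### Plane topology -/

/-- `f` has a continuous logarithm on `s`. Obstructions to its existence replace winding numbers in
the separation theorems below. -/
def HasLogOn {X : Type*} [TopologicalSpace X] (f : X → ℂ) (s : Set X) : Prop :=
  ∃ L : X → ℂ, ContinuousOn L s ∧ ∀ x ∈ s, Complex.exp (L x) = f x

namespace HasLogOn

variable {X : Type*} [TopologicalSpace X] {f g : X → ℂ} {s t : Set X}

theorem mono (h : HasLogOn f t) (hst : s ⊆ t) : HasLogOn f s :=
  let ⟨L, hL, hexp⟩ := h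
  ⟨L, hL.mono hst, fun x hx => hexp x (hst hx)⟩

theorem ne_zero (h : HasLogOn f s) {x : X} (hx : x ∈ s) : f x ≠ 0 :=
  let ⟨_, _, hexp⟩ := h
  hexp x hx ▸ Complex.exp_ne_zero _

theorem congr (h : HasLogOn f s) (hfg : EqOn f g s) : HasLogOn g s :=
  let ⟨L, hL, hexp⟩ := h
  ⟨L, hL, fun x hx => (hexp x hx).trans (hfg hx)⟩

theorem mul (hf : HasLogOn f s) (hg : HasLogOn g s) : HasLogOn (fun x => f x * g x) s :=
  let ⟨L, hL, hexpL⟩ := hf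
  let ⟨M, hM, hexpM⟩ := hg
  ⟨fun x => L x + M x, hL.add hM, fun x hx => by rw [Complex.exp_add, hexpL x hx, hexpM x hx]⟩

theorem div (hf : HasLogOn f s) (hg : HasLogOn g s) : HasLogOn (fun x => f x / g x) s :=
  let ⟨L, hL, hexpL⟩ := hf
  let ⟨M, hM, hexpM⟩ := hg
  ⟨fun x => L x - M x, hL.sub hM, fun x hx => by rw [Complex.exp_sub, hexpL x hx, hexpM x hx]⟩

theorem one_add (hf : ContinuousOn f s) (h : ∀ x ∈ s, ‖f x‖ < 1) :
    HasLogOn (fun x => 1 + f x) s :=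
  have hslit : ∀ x ∈ s, 1 + f x ∈ Complex.slitPlane := fun x hx =>
    Complex.mem_slitPlane_of_norm_lt_one (h x hx)
  ⟨fun x => Complex.log (1 + f x), (continuousOn_const.add hf).clog hslit,
    fun x hx => Complex.exp_log (Complex.slitPlane_ne_zero (hslit x hx))⟩

theorem of_homotopy (F : C(unitInterval × s, ℂ)) (hF : ∀ x, F x ≠ 0) {c : ℂ}
    (h0 : ∀ x, F (0, x) = c) (h1 : ∀ x, F (1, x) = f x) : HasLogOn f s := by
  classical
  let H : C(unitInterval × s, {z : ℂ // z ≠ 0}) := ⟨fun x => ⟨F x, hF x⟩, by fun_prop⟩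
  have H0 : ∀ x, H (0, x) = (fun z : ℂ => (⟨_, z.exp_ne_zero⟩ : {z : ℂ // z ≠ 0}))
      (ContinuousMap.const s (Complex.log c) x) := fun x =>
    Subtype.ext <| by simp [H, h0, Complex.exp_log (h0 x ▸ hF (0, x))]
  let G := Complex.isCoveringMap_exp.liftHomotopy H _ H0
  have hG : ∀ x : s, Complex.exp (G (1, x)) = f x := fun x =>
    (congrArg Subtype.val
      (congrFun (Complex.isCoveringMap_exp.liftHomotopy_lifts H _ H0) (1, x))).trans (h1 x)
  refine ⟨fun x => if hx : x ∈ s then G (1, ⟨x, hx⟩) else 0, ?_, fun x hx => ?_⟩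
  · rw [continuousOn_iff_continuous_domRestrict]
    have hcont : Continuous fun x : s => G (1, x) := by fun_prop
    exact hcont.congr fun x => by simp only [domRestrict_apply, x.2, ↓reduceDIte]
  · simpa only [hx, ↓reduceDIte] using hG ⟨x, hx⟩

theorem of_contractible [ContractibleSpace s] (hf : ContinuousOn f s) (h0 : ∀ x ∈ s, f x ≠ 0) :
    HasLogOn f s := by
  obtain ⟨x₀, ⟨H⟩⟩ := id_nullhomotopic s
  let F : C(unitInterval × s, ℂ) :=
    ⟨fun x => f (H (unitInterval.symm x.1, x.2)), hf.comp_continuous (by fun_prop) fun x => (H _).2⟩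
  exact .of_homotopy F (fun x => h0 _ (H _).2) (c := f x₀) (fun x => by simp [F])
    fun x => by simp [F]

theorem union (hf : HasLogOn f s) (hf' : HasLogOn f t) (hs : IsOpen s) (ht : IsOpen t)
    (hst : IsPreconnected (s ∩ t)) : HasLogOn f (s ∪ t) := by
  classical
  obtain ⟨L, hL, hexpL⟩ := hf
  obtain ⟨M, hM, hexpM⟩ := hf'
  have hexp : ∀ x ∈ s ∩ t, Complex.exp (L x - M x) = 1 := fun x hx => by
    rw [Complex.exp_sub, hexpL x hx.1, ← hexpM x hx.2, div_self (Complex.exp_ne_zero _)]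
  obtain ⟨k, hk, hLM⟩ : ∃ k : ℂ, Complex.exp k = 1 ∧ ∀ x ∈ s ∩ t, L x = M x + k := by
    rcases (s ∩ t).eq_empty_or_nonempty with h | ⟨y, hy⟩
    · exact ⟨0, Complex.exp_zero, by simp [h]⟩
    · refine ⟨L y - M y, hexp y hy, fun x hx => eq_add_of_sub_eq' ?_⟩
      exact Complex.isCoveringMap_exp.constOn_of_comp hst
        ((hL.mono inter_subset_left).sub (hM.mono inter_subset_right))
        (fun x hx y hy => Subtype.ext ((hexp x hx).trans (hexp y hy).symm)) hx hy
  refine ⟨fun x => if x ∈ s then L x else M x + k, ?_, fun x hx => ?_⟩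
  · refine ContinuousOn.union_of_isOpen (hL.congr fun x hx => if_pos hx)
      ((hM.add (continuousOn_const (c := k))).congr fun x hx => ?_) hs ht
    split_ifs with hxs
    · exact hLM x ⟨hxs, hx⟩
    · rfl
  · beta_reduce
    split_ifs with hxs
    · exact hexpL x hxs
    · rw [Complex.exp_add, hk, mul_one, hexpM x (hx.resolve_left hxs)]

end HasLogOn

theorem not_hasLogOn_sub_center_sphere (p : ℂ) {r : ℝ} (hr : 0 < r) :
    ¬ HasLogOn (fun z => z - p) (sphere p r) := by
  rintro ⟨L, hL, hexp⟩
  have hmem : ∀ θ : ℝ, circleMap p r θ ∈ sphere p r := circleMap_mem_sphere p hr.le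
  have hcont : Continuous fun θ : ℝ => L (circleMap p r θ) - θ * Complex.I :=
    (hL.comp_continuous (continuous_circleMap p r) hmem).sub (by fun_prop)
  have hconst : ∀ θ : ℝ, Complex.exp (L (circleMap p r θ) - θ * Complex.I) = r := fun θ => by
    rw [Complex.exp_sub, hexp _ (hmem θ)]
    beta_reduce
    rw [circleMap_sub_center, circleMap_zero,
      mul_div_cancel_right₀ _ (Complex.exp_ne_zero _)]
  have := Complex.isCoveringMap_exp.const_of_comp hcont
    (fun θ φ => Subtype.ext ((hconst θ).trans (hconst φ).symm)) 0 (2 * Real.pi)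
  rw [show circleMap p r (2 * Real.pi) = circleMap p r 0 by simp [circleMap]] at this
  push_cast at this
  exact Complex.two_pi_I_ne_zero (by linear_combination this)

theorem not_hasLogOn_sub_sphere {p w : ℂ} {r : ℝ} (hw : w ∈ ball p r) :
    ¬ HasLogOn (fun z => z - w) (sphere p r) := by
  have hr : 0 < r := pos_of_mem_ball hw
  have hne : ∀ z ∈ sphere p r, z - p ≠ 0 := fun z hz =>
    sub_ne_zero.2 (ne_of_mem_sphere hz hr.ne')
  have hlog : HasLogOn (fun z => 1 + (p - w) / (z - p)) (sphere p r) := by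
    refine .one_add (continuousOn_const.div (by fun_prop) hne) fun z hz => ?_
    rw [norm_div, mem_sphere_iff_norm.1 hz, div_lt_one hr, norm_sub_rev]
    exact mem_ball_iff_norm.1 hw
  refine fun h => not_hasLogOn_sub_center_sphere p hr ((h.div hlog).congr fun z hz => ?_)
  have hz0 := hne z hz
  rw [div_eq_iff (hlog.ne_zero hz), mul_add, mul_one, mul_div_cancel₀ _ hz0, sub_add_sub_cancel]

theorem hasLogOn_sub_closedBall {p q : ℂ} {r : ℝ} (hr : 0 ≤ r) (hq : r < dist p q) :
    HasLogOn (fun z => z - q) (closedBall p r) :=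
  have := (convex_closedBall p r).contractibleSpace (nonempty_closedBall.2 hr)
  .of_contractible (by fun_prop) fun _ hz =>
    sub_ne_zero.2 fun h => hq.not_ge (mem_closedBall'.1 (h ▸ hz))

/-- Extending a logarithm of `z - w` from `X` into the part of the complement that contains `w`
would give `z - w` a nowhere vanishing extension from the circle to the disk. -/
theorem not_sphere_subset_of_hasLogOn {X u v : Set ℂ} (hX : IsClosed X) {w : ℂ}
    (hlog : HasLogOn (fun z => z - w) X) (hu : IsOpen u) (hv : IsOpen v) (hcov : Xᶜ ⊆ u ∪ v)
    (hdisj : Xᶜ ∩ (u ∩ v) = ∅) {p : ℂ} {R : ℝ} (hw : w ∈ ball p R) (hwX : w ∉ X) (hwv : w ∈ v) :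
    ¬ sphere p R ⊆ Xᶜ ∩ u := by
  classical
  intro hsphere
  obtain ⟨L, hL, hexp⟩ := hlog
  obtain ⟨M, hM⟩ := ContinuousMap.exists_restrict_eq hX ⟨X.domRestrict L, hL.domRestrict⟩
  have hML : ∀ z ∈ X, Complex.exp (M z) = z - w := fun z hz =>
    (congrArg Complex.exp (DFunLike.congr_fun hM ⟨z, hz⟩)).trans (hexp z hz)
  have hfrontier : ∀ z ∈ frontier (Xᶜ ∩ v), Complex.exp (M z) = z - w := by
    intro z hz
    rw [(hX.isOpen_compl.inter hv).frontier_eq] at hz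
    refine hML z (of_not_not fun hzX => ?_)
    rcases hcov hzX with hzu | hzv
    · obtain ⟨y, ⟨-, hyu⟩, hyX, hyv⟩ :=
        mem_closure_iff.1 hz.1 (Xᶜ ∩ u) (hX.isOpen_compl.inter hu) ⟨hzX, hzu⟩
      exact (hdisj ▸ ⟨hyX, hyu, hyv⟩ : y ∈ (∅ : Set ℂ))
    · exact hz.2 ⟨hzX, hzv⟩
  have : ContractibleSpace (closedBall p R) :=
    (convex_closedBall p R).contractibleSpace ⟨w, ball_subset_closedBall hw⟩
  have hlog' : HasLogOn ((Xᶜ ∩ v).piecewise (fun z => Complex.exp (M z)) fun z => z - w)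
      (closedBall p R) := by
    refine .of_contractible
      (Continuous.piecewise hfrontier (by fun_prop) (by fun_prop)).continuousOn fun z _ => ?_
    by_cases hz : z ∈ Xᶜ ∩ v
    · rw [piecewise_eq_of_mem _ _ _ hz]
      exact Complex.exp_ne_zero _
    · rw [piecewise_eq_of_notMem _ _ _ hz, sub_ne_zero]
      rintro rfl
      exact hz ⟨hwX, hwv⟩
  exact not_hasLogOn_sub_sphere hw <| (hlog'.mono sphere_subset_closedBall).congr fun z hz =>
    piecewise_eq_of_notMem _ _ _ fun hzv =>
      (hdisj ▸ ⟨hzv.1, (hsphere hz).2, hzv.2⟩ : z ∈ (∅ : Set ℂ))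

theorem isPreconnected_compl_of_contractible {X : Set ℂ} (hX : IsCompact X) [ContractibleSpace X] :
    IsPreconnected Xᶜ := by
  have hlog : ∀ w ∉ X, HasLogOn (fun z => z - w) X := fun w hw =>
    .of_contractible (by fun_prop) fun z hz => sub_ne_zero.2 (ne_of_mem_of_not_mem hz hw)
  rw [isPreconnected_iff_subset_of_disjoint]
  intro u v hu hv hcov hdisj
  by_contra! h
  obtain ⟨⟨w₁, hw₁X, hw₁u⟩, w₂, hw₂X, hw₂v⟩ := And.imp not_subset.1 not_subset.1 h
  obtain ⟨R, hR⟩ := (hX.isBounded.union (toFinite {w₁, w₂}).isBounded).subset_ball (0 : ℂ)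
  have hsphere : sphere 0 R ⊆ Xᶜ := fun z hz hzX =>
    (mem_ball.1 (hR (Or.inl hzX))).ne (mem_sphere.1 hz)
  have hrank : 1 < Module.rank ℝ ℂ := Complex.rank_real_complex ▸ Cardinal.one_lt_two
  rcases isPreconnected_iff_subset_of_disjoint.1 (isPreconnected_sphere hrank 0 R) u v hu hv
    (hsphere.trans hcov) (subset_empty_iff.1 (hdisj ▸ inter_subset_inter_left _ hsphere))
    with h | h
  · exact not_sphere_subset_of_hasLogOn hX.isClosed (hlog w₁ hw₁X) hu hv hcov hdisj
      (hR (by simp)) hw₁X ((hcov hw₁X).resolve_left hw₁u) (subset_inter hsphere h)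
  · rw [union_comm] at hcov
    rw [inter_comm u] at hdisj
    exact not_sphere_subset_of_hasLogOn hX.isClosed (hlog w₂ hw₂X) hv hu hcov hdisj
      (hR (by simp)) hw₂X ((hcov hw₂X).resolve_left hw₂v) (subset_inter hsphere h)

theorem hasLogOn_compl_range_path {p q : ℂ} (A : Path p q) :
    HasLogOn (fun z => (z - p) / (z - q)) (range A)ᶜ := by
  have hne : ∀ (t : unitInterval) (z : ((range A)ᶜ : Set ℂ)), (z : ℂ) - A t ≠ 0 :=
    fun t z h => z.2 ⟨t, (sub_eq_zero.1 h).symm⟩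
  let F : C(unitInterval × ((range A)ᶜ : Set ℂ), ℂ) :=
    ⟨fun x => ((x.2 : ℂ) - A 0) / ((x.2 : ℂ) - A x.1),
      Continuous.div (by fun_prop) (by fun_prop) fun x => hne x.1 x.2⟩
  exact .of_homotopy F (fun x => div_ne_zero (hne 0 x.2) (hne x.1 x.2))
    (fun x => div_self (hne 0 x)) fun x => by simp [F]

/-- The logarithms of `(z - p) / (z - q)` off each path would fit together to one on a small circle
around `p`. -/
theorem not_isPreconnected_compl_union_range {p q : ℂ} (A B : Path p q) (hpq : p ≠ q)
    (hAB : range A ∩ range B ⊆ {p, q}) : ¬ IsPreconnected (range A ∪ range B)ᶜ := by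
  intro hcon
  have hopen : ∀ C : Path p q, IsOpen (range C)ᶜ := fun C =>
    (isCompact_range C.continuous).isClosed.isOpen_compl
  have hlog := (hasLogOn_compl_range_path A).union (hasLogOn_compl_range_path B) (hopen A)
    (hopen B) (compl_union _ _ ▸ hcon)
  have hpos : 0 < dist p q := dist_pos.2 hpq
  have hdist : dist p q / 2 < dist p q := half_lt_self hpos
  have hlogq := (hasLogOn_sub_closedBall (half_pos hpos).le hdist).mono
    (sphere_subset_closedBall (x := p))
  have hsub : sphere p (dist p q / 2) ⊆ (range A)ᶜ ∪ (range B)ᶜ := by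
    rw [← compl_inter]
    intro z hz hzAB
    rcases hAB hzAB with rfl | rfl
    · rw [mem_sphere, dist_self] at hz
      linarith
    · rw [mem_sphere'] at hz
      linarith
  refine not_hasLogOn_sub_center_sphere p (half_pos hpos)
    (((hlog.mono hsub).mul hlogq).congr fun z hz => ?_)
  refine div_mul_cancel₀ _ (sub_ne_zero.2 fun h => hdist.ne ?_)
  rw [← mem_sphere'.1 hz, h]

section Homeomorph

variable {X : Type*} [TopologicalSpace X]

theorem isPreconnected_compl_of_homeomorph_plane (Ψ : X ≃ₜ ℂ) {T : Set X} (hT : IsCompact T)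
    [ContractibleSpace T] : IsPreconnected Tᶜ := by
  have := (Ψ.image T).symm.contractibleSpace
  rw [← Ψ.isPreconnected_image, image_compl_eq Ψ.bijective]
  exact isPreconnected_compl_of_contractible (hT.image Ψ.continuous)

theorem isPreconnected_compl_of_finite_of_homeomorph_plane (Ψ : X ≃ₜ ℂ) {T : Set X}
    (hT : T.Finite) : IsPreconnected Tᶜ := by
  rw [← Ψ.isPreconnected_image, image_compl_eq Ψ.bijective]
  exact ((hT.image Ψ).countable.isConnected_compl_of_one_lt_rank
    (Complex.rank_real_complex ▸ Cardinal.one_lt_two)).isPreconnected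

theorem not_isPreconnected_compl_union_range_of_homeomorph_plane (Ψ : X ≃ₜ ℂ) {p q : X}
    (A B : Path p q) (hpq : p ≠ q) (hAB : range A ∩ range B ⊆ {p, q}) :
    ¬ IsPreconnected (range A ∪ range B)ᶜ := by
  rw [← Ψ.isPreconnected_image, image_compl_eq Ψ.bijective, image_union, ← range_comp, ← range_comp]
  refine not_isPreconnected_compl_union_range (A.map Ψ.continuous) (B.map Ψ.continuous)
    (Ψ.injective.ne hpq) ?_
  rw [Path.map_coe, Path.map_coe, range_comp, range_comp, ← image_inter Ψ.injective, ← image_pair]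
  exact image_mono hAB

end Homeomorph

/-! ### The realization of a simplicial complex -/

/-- The closed simplex spanned by the vertices `s`, in barycentric coordinates. -/
def simplex {V : Type*} (s : Finset V) : Set (V → ℝ) :=
  {x | (∀ v, 0 ≤ x v) ∧ (∀ v, v ∉ s → x v = 0) ∧ ∑ v ∈ s, x v = 1}

/-- The open star of the vertex `v`. -/
def openStar {V : Type*} (K : AbstractSimplicialComplex V) (v : V) : Set (realization K) :=
  {x | 0 < x.1 v}

/-- The graph of the edges of a complex. Loops being excluded, two vertices are adjacent as soon as
they lie in a common simplex. -/
def oneSkeleton {V : Type*} (K : AbstractSimplicialComplex V) : SimpleGraph V where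
  Adj u v := u ≠ v ∧ ∃ s ∈ K.faces, u ∈ s ∧ v ∈ s
  symm := ⟨fun _ _ ⟨hne, s, hs, hu, hv⟩ => ⟨hne.symm, s, hs, hv, hu⟩⟩
  loopless := ⟨fun _ h => h.1 rfl⟩

section Simplex

variable {V : Type*} {s t : Finset V} {x : V → ℝ}

theorem mem_simplex_of_mem_simplex (hx : x ∈ simplex s) (h : ∀ v, v ∉ t → x v = 0) :
    x ∈ simplex t := by
  classical
  refine ⟨hx.1, h, ?_⟩
  rw [← hx.2.2, Finset.sum_subset Finset.subset_union_left fun v _ hv => h v hv,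
    Finset.sum_subset Finset.subset_union_right fun v _ hv => hx.2.1 v hv]

theorem simplex_mono (h : s ⊆ t) : simplex s ⊆ simplex t := fun _ hx =>
  mem_simplex_of_mem_simplex hx fun v hv => hx.2.1 v fun hvs => hv (h hvs)

theorem simplex_inter [DecidableEq V] : simplex s ∩ simplex t = simplex (s ∩ t) := by
  refine (subset_inter (simplex_mono Finset.inter_subset_left)
    (simplex_mono Finset.inter_subset_right)).antisymm' fun x hx => ?_
  refine mem_simplex_of_mem_simplex hx.1 fun v hv => ?_
  rcases not_and_or.1 (mt Finset.mem_inter.2 hv) with h | h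
  exacts [hx.1.2.1 v h, hx.2.2.1 v h]

theorem simplex_empty : simplex (∅ : Finset V) = ∅ :=
  eq_empty_of_forall_notMem fun _ hx => zero_ne_one (hx.2.2 : (0 : ℝ) = 1)

theorem convex_simplex : Convex ℝ (simplex s) := by
  refine fun x hx y hy α β hα hβ hαβ => ⟨fun v => ?_, fun v hv => ?_, ?_⟩
  · exact add_nonneg (mul_nonneg hα (hx.1 v)) (mul_nonneg hβ (hy.1 v))
  · simp only [Pi.add_apply, Pi.smul_apply, hx.2.1 v hv, hy.2.1 v hv, smul_zero, add_zero]
  · simp only [Pi.add_apply, Pi.smul_apply, smul_eq_mul, Finset.sum_add_distrib,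
      ← Finset.mul_sum, hx.2.2, hy.2.2, mul_one, hαβ]

theorem isCompact_simplex : IsCompact (simplex s) := by
  refine (isCompact_Icc (a := (0 : V → ℝ)) (b := 1)).of_isClosed_subset ?_ fun x hx =>
    ⟨fun v => hx.1 v, fun v => ?_⟩
  · simp only [simplex, ofPred_and, ofPred_forall]
    exact (isClosed_iInter fun v => isClosed_le continuous_const (continuous_apply v)).inter
      ((isClosed_iInter fun v => isClosed_iInter fun _ =>
        isClosed_eq (continuous_apply v) continuous_const).inter
        (isClosed_eq (by fun_prop) continuous_const))
  · by_cases hv : v ∈ s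
    · exact (Finset.single_le_sum (fun w _ => hx.1 w) hv).trans_eq hx.2.2
    · exact (hx.2.1 v hv).trans_le zero_le_one

variable [DecidableEq V] {a b : V}

theorem single_mem_simplex (ha : a ∈ s) : Pi.single a 1 ∈ simplex s := by
  refine ⟨fun v => ?_, fun v hv => Pi.single_eq_of_ne (ne_of_mem_of_not_mem ha hv).symm 1, ?_⟩
  · rw [Pi.single_apply]
    split_ifs <;> norm_num
  · rw [Finset.sum_pi_single', if_pos ha]

theorem eq_of_mem_simplex {y : V → ℝ} (hx : x ∈ simplex (insert a s))
    (hy : y ∈ simplex (insert a s)) (h : ∀ v ∈ s, x v = y v) : x = y := by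
  funext v
  by_cases hvs : v ∈ s
  · exact h v hvs
  rcases eq_or_ne v a with rfl | hva
  · have hsum := hx.2.2.trans hy.2.2.symm
    rwa [Finset.sum_insert hvs, Finset.sum_insert hvs, Finset.sum_congr rfl h,
      add_left_inj] at hsum
  · have hv : v ∉ insert a s := by simp [hva, hvs]
    rw [hx.2.1 v hv, hy.2.1 v hv]

theorem simplex_singleton (a : V) : simplex {a} = {Pi.single a 1} :=
  Subset.antisymm (fun _ hx => eq_of_mem_simplex (s := ∅) hx
    (single_mem_simplex (Finset.mem_singleton_self a)) (by simp))
    (singleton_subset_iff.2 (single_mem_simplex (Finset.mem_singleton_self a)))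

theorem simplex_pair (hab : a ≠ b) :
    simplex {a, b} = segment ℝ (Pi.single a (1 : ℝ)) (Pi.single b 1) := by
  have ha : Pi.single a 1 ∈ simplex {a, b} := single_mem_simplex (by simp)
  have hb : Pi.single b 1 ∈ simplex {a, b} := single_mem_simplex (by simp)
  refine (convex_simplex.segment_subset ha hb).antisymm' fun x hx => ?_
  have hsum := hx.2.2
  rw [Finset.sum_pair hab] at hsum
  refine ⟨x a, x b, hx.1 a, hx.1 b, hsum,
    eq_of_mem_simplex (convex_simplex ha hb (hx.1 a) (hx.1 b) hsum) hx fun v hv => ?_⟩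
  rw [Finset.mem_singleton.1 hv]
  simp [hab]

end Simplex

section Complex

variable {V : Type*} {K : AbstractSimplicialComplex V}

theorem mem_realization {x : V → ℝ} : x ∈ realization K ↔ ∃ s ∈ K.faces, x ∈ simplex s :=
  ⟨fun ⟨h, s, hs, h0, h1⟩ => ⟨s, hs, h, h0, h1⟩, fun ⟨s, hs, h, h0, h1⟩ => ⟨h, s, hs, h0, h1⟩⟩

theorem simplex_subset_realization {s : Finset V} (hs : s ∈ K.faces) :
    simplex s ⊆ realization K := fun _ hx => mem_realization.2 ⟨s, hs, hx⟩

theorem mem_simplex_iff_of_mem_realization {x : V → ℝ} (hx : x ∈ realization K) {t : Finset V} :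
    x ∈ simplex t ↔ ∀ v, v ∉ t → x v = 0 :=
  let ⟨_, _, hxs⟩ := mem_realization.1 hx
  ⟨fun h => h.2.1, mem_simplex_of_mem_simplex hxs⟩

theorem face_of_subset {s t : Finset V} (hs : s ∈ K.faces) (hts : t ⊆ s) (ht : t.Nonempty) :
    t ∈ K.faces :=
  (K.isRelLowerSet_faces hs).2 hts ht

theorem face_of_forall_pos {x : V → ℝ} (hx : x ∈ realization K) {t : Finset V} (ht : t.Nonempty)
    (hpos : ∀ v ∈ t, 0 < x v) : t ∈ K.faces :=
  let ⟨_, hs, hxs⟩ := mem_realization.1 hx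
  face_of_subset hs (fun v hv => of_not_not fun h => (hpos v hv).ne' (hxs.2.1 v h)) ht

theorem infinite_of_noncompactSpace_realization [NoncompactSpace (realization K)] :
    Infinite V := by
  by_contra hfin
  rw [not_infinite_iff_finite] at hfin
  have hcover : realization K = ⋃ s ∈ K.faces, simplex s := by
    ext x
    simp only [mem_realization, mem_iUnion, exists_prop]
  refine not_compactSpace_iff.2 ‹_› (isCompact_iff_compactSpace.1 ?_)
  rw [hcover]
  exact (toFinite _).isCompact_biUnion fun s _ => isCompact_simplex

theorem compl_preimage_simplex (t : Finset V) :
    ((↑) ⁻¹' simplex t : Set (realization K))ᶜ = ⋃ v ∈ (t : Set V)ᶜ, openStar K v := by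
  ext x
  simp only [mem_compl_iff, mem_preimage, mem_simplex_iff_of_mem_realization x.2, not_forall,
    mem_iUnion, exists_prop, openStar, mem_ofPred_eq, (x.2.1 _).lt_iff_ne', Finset.mem_coe]

theorem isOpen_openStar (v : V) : IsOpen (openStar K v) :=
  isOpen_lt continuous_const ((continuous_apply v).comp continuous_subtype_val)

theorem oneSkeleton_adj_iff [DecidableEq V] {u v : V} :
    (oneSkeleton K).Adj u v ↔ u ≠ v ∧ {u, v} ∈ K.faces := by
  refine and_congr_right fun _ => ⟨fun ⟨s, hs, hu, hv⟩ => ?_, fun h => ⟨_, h, by simp⟩⟩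
  exact face_of_subset hs (by simp [Finset.insert_subset_iff, hu, hv]) (by simp)

theorem oneSkeleton_adj_of_mem_openStar {x : realization K} {u v : V} (huv : u ≠ v)
    (hu : x ∈ openStar K u) (hv : x ∈ openStar K v) : (oneSkeleton K).Adj u v := by
  classical
  refine oneSkeleton_adj_iff.2 ⟨huv, face_of_forall_pos x.2 (by simp) fun w hw => ?_⟩
  rcases Finset.mem_insert.1 hw with rfl | hw
  exacts [hu, Finset.mem_singleton.1 hw ▸ hv]

variable [DecidableEq V]

variable (K) in
/-- The vertex `v` as a point of the realization. -/
def vertexPoint (v : V) : realization K :=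
  ⟨Pi.single v 1, simplex_subset_realization (K.singleton_mem v)
    (single_mem_simplex (Finset.mem_singleton_self v))⟩

theorem vertexPoint_mem_openStar (v : V) : vertexPoint K v ∈ openStar K v := by
  simp [vertexPoint, openStar]

theorem vertexPoint_mem_simplex_iff {v : V} {t : Finset V} :
    (vertexPoint K v : V → ℝ) ∈ simplex t ↔ v ∈ t :=
  ⟨fun h => of_not_not fun hv => by simpa [vertexPoint] using h.2.1 v hv, single_mem_simplex⟩

theorem vertexPoint_injective : Function.Injective (vertexPoint K) := fun u v h => by
  have hu : (vertexPoint K u : V → ℝ) ∈ simplex {v} :=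
    h ▸ vertexPoint_mem_simplex_iff.2 (Finset.mem_singleton_self v)
  exact Finset.mem_singleton.1 (vertexPoint_mem_simplex_iff.1 hu)

end Complex

section Connected

variable {V : Type*} {K : AbstractSimplicialComplex V}

theorem exists_mem_openStar_inter {u v : V} (h : (oneSkeleton K).Adj u v) :
    (openStar K u ∩ openStar K v).Nonempty := by
  classical
  obtain ⟨huv, s, hs, hu, hv⟩ := h
  refine ⟨⟨midpoint ℝ (Pi.single u 1) (Pi.single v 1), simplex_subset_realization hs
    (convex_simplex.midpoint_mem (single_mem_simplex hu) (single_mem_simplex hv))⟩, ?_, ?_⟩ <;>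
  simp [openStar, midpoint_eq_smul_add, huv, huv.symm]

theorem isPreconnected_openStar (v : V) : IsPreconnected (openStar K v) := by
  classical
  rw [← Topology.IsInducing.subtypeVal.isPreconnected_image]
  have hstar : StarConvex ℝ (Pi.single v 1) ((↑) '' openStar K v : Set (V → ℝ)) := by
    rintro _ ⟨⟨x, hx⟩, hxv, rfl⟩ α β hα hβ hαβ
    obtain ⟨s, hs, hxs⟩ := mem_realization.1 hx
    have hvs : v ∈ s := of_not_not fun h => (ne_of_gt hxv) (hxs.2.1 v h)
    refine ⟨⟨_, simplex_subset_realization hs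
      (convex_simplex (single_mem_simplex hvs) hxs hα hβ hαβ)⟩, ?_, rfl⟩
    have hconv : Convex ℝ {x : V → ℝ | 0 < x v} :=
      convex_halfSpace_gt (LinearMap.isLinear (LinearMap.proj v)) 0
    exact hconv (vertexPoint_mem_openStar (K := K) v) hxv hα hβ hαβ
  exact (hstar.isPathConnected ⟨vertexPoint K v, vertexPoint_mem_openStar v,
    rfl⟩).isConnected.isPreconnected

theorem exists_walk_of_isPreconnected {S : Set V} (h : IsPreconnected (⋃ v ∈ S, openStar K v))
    {x y : V} (hx : x ∈ S) (hy : y ∈ S) :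
    ∃ p : (oneSkeleton K).Walk x y, ∀ u ∈ p.support, u ∈ S := by
  classical
  by_contra hcon
  let R : Set V := {z | ∃ p : (oneSkeleton K).Walk x z, ∀ u ∈ p.support, u ∈ S}
  have hxR : x ∈ R := ⟨.nil, by simpa using hx⟩
  have hstep : ∀ u v, u ∈ R → v ∈ S → (oneSkeleton K).Adj u v → v ∈ R := by
    rintro u v ⟨p, hp⟩ hv huv
    refine ⟨p.concat huv, fun w hw => ?_⟩
    rw [SimpleGraph.Walk.support_concat, List.mem_append, List.mem_singleton] at hw
    rcases hw with hw | rfl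
    exacts [hp w hw, hv]
  have hopen : ∀ T : Set V, IsOpen (⋃ v ∈ T, openStar K v) := fun T =>
    isOpen_biUnion fun v _ => isOpen_openStar v
  have hmem : ∀ {T : Set V} {v : V}, v ∈ T → vertexPoint K v ∈ ⋃ v ∈ T, openStar K v :=
    fun hv => mem_biUnion hv (vertexPoint_mem_openStar _)
  obtain ⟨z, -, hz1, hz2⟩ := h _ _ (hopen (S ∩ R)) (hopen (S \ R))
    (by rw [← biUnion_union, inter_union_sdiff])
    ⟨_, hmem hx, hmem ⟨hx, hxR⟩⟩ ⟨_, hmem hy, hmem ⟨hy, hcon⟩⟩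
  obtain ⟨u, ⟨-, hu⟩, hzu⟩ := mem_iUnion₂.1 hz1
  obtain ⟨v, ⟨hvS, hv⟩, hzv⟩ := mem_iUnion₂.1 hz2
  exact hv (hstep u v hu hvS
    (oneSkeleton_adj_of_mem_openStar (ne_of_mem_of_not_mem hu hv) hzu hzv))

theorem isPreconnected_of_walks {S : Set V}
    (h : ∀ x ∈ S, ∀ y ∈ S, ∃ p : (oneSkeleton K).Walk x y, ∀ u ∈ p.support, u ∈ S) :
    IsPreconnected (⋃ v ∈ S, openStar K v) := by
  classical
  refine IsPreconnected.biUnion_of_reflTransGen (fun v _ => isPreconnected_openStar v) ?_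
  intro x hx y hy
  obtain ⟨p, hp⟩ := h x hx y hy
  clear hy
  induction p with
  | nil => exact Relation.ReflTransGen.refl
  | cons huv p ih =>
    exact Relation.ReflTransGen.head ⟨exists_mem_openStar_inter huv, hx⟩
      (ih (hp _ (by simp)) fun z hz => hp z (by simp [hz]))

end Connected

/-! ### Triangulated planes -/

/-- The set of points where the smaller of the barycentric coordinates of `a` and `b` is `1 / 3`.
It crosses the edge `{a, b}` in two points and runs through the triangles that contain this edge,
so it is a closed curve exactly when there are two of them. -/
def crossCut {V : Type*} (K : AbstractSimplicialComplex V) (a b : V) : Set (realization K) :=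
  {x | 1 / 3 ≤ x.1 a ∧ 1 / 3 ≤ x.1 b ∧ (x.1 a = 1 / 3 ∨ x.1 b = 1 / 3)}

section General

variable {V : Type*} {K : AbstractSimplicialComplex V}

theorem infinite_of_homeomorph_plane (Ψ : realization K ≃ₜ ℂ) : Infinite V :=
  have : NoncompactSpace (realization K) := Ψ.symm.isClosedEmbedding.noncompactSpace
  infinite_of_noncompactSpace_realization (K := K)

theorem connected_of_homeomorph_plane (Ψ : realization K ≃ₜ ℂ) (x y : V) :
    Nonempty ((oneSkeleton K).Walk x y) := by
  have : PreconnectedSpace (realization K) := Ψ.symm.surjective.denseRange.preconnectedSpace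
    Ψ.symm.continuous
  have hcover := compl_preimage_simplex (K := K) ∅
  rw [simplex_empty, preimage_empty, compl_empty] at hcover
  obtain ⟨p, -⟩ := exists_walk_of_isPreconnected (hcover ▸ isPreconnected_univ) (x := x) (y := y)
    (by simp) (by simp)
  exact ⟨p⟩

theorem isPreconnected_compl_preimage_of_starConvex (Ψ : realization K ≃ₜ ℂ) {T : Set (V → ℝ)}
    (hT : IsCompact T) (hTK : T ⊆ realization K) {x : V → ℝ} (hx : x ∈ T)
    (hstar : StarConvex ℝ x T) : IsPreconnected ((↑) ⁻¹' T : Set (realization K))ᶜ := by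
  have himage : Subtype.val '' ((↑) ⁻¹' T : Set (realization K)) = T := by
    rw [Subtype.image_preimage_coe, inter_eq_right.2 hTK]
  have hcontr : ContractibleSpace (Subtype.val '' ((↑) ⁻¹' T : Set (realization K))) := by
    rw [himage]
    exact hstar.contractibleSpace ⟨x, hx⟩
  have := (Topology.IsEmbedding.subtypeVal.homeomorphImage
    ((↑) ⁻¹' T : Set (realization K))).contractibleSpace
  refine isPreconnected_compl_of_homeomorph_plane Ψ ?_
  rwa [Subtype.isCompact_iff, himage]

theorem exists_walk_avoiding_face (Ψ : realization K ≃ₜ ℂ) {t : Finset V} (ht : t ∈ K.faces)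
    {x y : V} (hx : x ∉ t) (hy : y ∉ t) :
    ∃ p : (oneSkeleton K).Walk x y, ∀ u ∈ p.support, u ∉ t := by
  classical
  obtain ⟨v, hv⟩ := (K.isRelLowerSet_faces ht).1
  have hconn := isPreconnected_compl_preimage_of_starConvex Ψ isCompact_simplex
    (simplex_subset_realization ht) (single_mem_simplex hv)
    (convex_simplex.starConvex (single_mem_simplex hv))
  rw [compl_preimage_simplex] at hconn
  exact exists_walk_of_isPreconnected hconn hx hy

theorem crossCut_subset_preimage_simplex {a b : V} [DecidableEq V] {t : Finset V}
    (ht : ∀ v, {a, b, v} ∈ K.faces → v ∈ t) : crossCut K a b ⊆ (↑) ⁻¹' simplex t := by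
  rintro x ⟨ha, hb, -⟩
  refine (mem_simplex_iff_of_mem_realization x.2).2 fun v hv => ?_
  refine ((x.2.1 v).eq_or_lt'.resolve_right fun hpos => hv (ht v ?_))
  refine face_of_forall_pos x.2 (by simp) fun w hw => ?_
  simp only [Finset.mem_insert, Finset.mem_singleton] at hw
  rcases hw with rfl | rfl | rfl <;> linarith

theorem not_isPreconnected_compl_crossCut {a b : V} (hab : (oneSkeleton K).Adj a b) :
    ¬ IsPreconnected (crossCut K a b)ᶜ := by
  classical
  intro h
  have hcont : ∀ v, Continuous fun x : realization K => x.1 v := fun v =>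
    (continuous_apply v).comp continuous_subtype_val
  let inner : Set (realization K) := {x | 1 / 3 < x.1 a} ∩ {x | 1 / 3 < x.1 b}
  let outer : Set (realization K) := {x | x.1 a < 1 / 3} ∪ {x | x.1 b < 1 / 3}
  have hdisj : Disjoint inner outer := by
    refine disjoint_left.2 fun x hx hx' => ?_
    simp only [inner, outer, mem_inter_iff, mem_union, mem_ofPred_eq] at hx hx'
    grind
  have hcover : (crossCut K a b)ᶜ ⊆ inner ∪ outer := by
    intro x hx
    simp only [crossCut, inner, outer, mem_compl_iff, mem_union, mem_inter_iff, mem_ofPred_eq]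
      at hx ⊢
    grind
  have hinner : ((crossCut K a b)ᶜ ∩ inner).Nonempty := by
    refine ⟨⟨midpoint ℝ (Pi.single a 1) (Pi.single b 1), simplex_subset_realization
      (oneSkeleton_adj_iff.1 hab).2 (convex_simplex.midpoint_mem (single_mem_simplex (by simp))
        (single_mem_simplex (by simp)))⟩, ?_⟩
    simp only [crossCut, inner, midpoint_eq_smul_add, mem_inter_iff, mem_compl_iff, mem_ofPred_eq,
      Pi.smul_apply, Pi.add_apply, Pi.single_eq_same, Pi.single_eq_of_ne hab.ne,
      Pi.single_eq_of_ne hab.ne.symm]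
    norm_num
  have houter : ((crossCut K a b)ᶜ ∩ outer).Nonempty := by
    refine ⟨vertexPoint K a, ?_⟩
    simp only [crossCut, outer, vertexPoint, mem_inter_iff, mem_compl_iff, mem_union,
      mem_ofPred_eq, Pi.single_eq_same, Pi.single_eq_of_ne hab.ne.symm]
    norm_num
  obtain ⟨z, -, hz⟩ := h inner outer
    ((isOpen_lt continuous_const (hcont a)).inter (isOpen_lt continuous_const (hcont b)))
    ((isOpen_lt (hcont a) continuous_const).union (isOpen_lt (hcont b) continuous_const))
    hcover hinner houter
  exact disjoint_left.1 hdisj hz.1 hz.2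

end General

section Triangles

variable {V : Type*} [DecidableEq V] {K : AbstractSimplicialComplex V} {a b c d : V}

theorem exists_path_range_eq_preimage_simplex (hab : (oneSkeleton K).Adj a b) :
    ∃ γ : Path (vertexPoint K a) (vertexPoint K b), range γ = (↑) ⁻¹' simplex {a, b} := by
  obtain ⟨hne, hface⟩ := oneSkeleton_adj_iff.1 hab
  let σ := Path.segment (Pi.single a 1 : V → ℝ) (Pi.single b 1)
  have hσ : range σ = simplex {a, b} := by rw [simplex_pair hne, Path.range_segment]
  have hmem : ∀ t, σ t ∈ realization K := fun t =>
    simplex_subset_realization hface (hσ ▸ mem_range_self t)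
  refine ⟨⟨⟨fun t => ⟨σ t, hmem t⟩, σ.continuous.subtype_mk _⟩, Subtype.ext σ.source,
    Subtype.ext σ.target⟩, ?_⟩
  ext x
  simp only [mem_preimage, ← hσ]
  exact exists_congr fun t => Subtype.ext_iff

theorem not_isPreconnected_compl_triangle (Ψ : realization K ≃ₜ ℂ)
    (hab : (oneSkeleton K).Adj a b) (hbc : (oneSkeleton K).Adj b c)
    (hca : (oneSkeleton K).Adj c a) :
    ¬ IsPreconnected
      ((↑) ⁻¹' (simplex {a, b} ∪ (simplex {c, a} ∪ simplex {b, c})) : Set (realization K))ᶜ := by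
  obtain ⟨α, hα⟩ := exists_path_range_eq_preimage_simplex hab
  obtain ⟨β, hβ⟩ := exists_path_range_eq_preimage_simplex hca.symm
  obtain ⟨γ, hγ⟩ := exists_path_range_eq_preimage_simplex hbc.symm
  have hβγ : range (β.trans γ) = (↑) ⁻¹' (simplex {c, a} ∪ simplex {b, c}) := by
    rw [Path.trans_range, hβ, hγ, Finset.pair_comm a c, Finset.pair_comm c b, preimage_union]
  have hvertex : ∀ v, ((↑) ⁻¹' simplex {v} : Set (realization K)) = {vertexPoint K v} := fun v => by
    ext x
    rw [simplex_singleton, mem_singleton_iff, Subtype.ext_iff]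
    rfl
  have hinter : range α ∩ range (β.trans γ) ⊆ {vertexPoint K a, vertexPoint K b} := by
    have hA : ({a, b} ∩ {c, a} : Finset V) = {a} := by grind [hab.ne, hbc.ne, hca.ne]
    have hB : ({a, b} ∩ {b, c} : Finset V) = {b} := by grind [hab.ne, hbc.ne, hca.ne]
    rw [hα, hβγ, ← preimage_inter, inter_union_distrib_left, simplex_inter, simplex_inter, hA, hB,
      preimage_union, hvertex, hvertex, singleton_union]
  rw [preimage_union, ← hα, ← hβγ]
  exact not_isPreconnected_compl_union_range_of_homeomorph_plane Ψ α (β.trans γ)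
    (vertexPoint_injective.ne hab.ne) hinter

theorem face_of_not_separatesVertices (Ψ : realization K ≃ₜ ℂ)
    (hab : (oneSkeleton K).Adj a b) (hbc : (oneSkeleton K).Adj b c)
    (hca : (oneSkeleton K).Adj c a) (h : ¬ SeparatesVertices (oneSkeleton K) {a, b, c}) :
    {a, b, c} ∈ K.faces := by
  by_contra hface
  have hboundary : ((↑) ⁻¹' (simplex {a, b} ∪ (simplex {c, a} ∪ simplex {b, c})) :
      Set (realization K)) = (↑) ⁻¹' simplex {a, b, c} := by
    refine Subset.antisymm (preimage_mono (union_subset (simplex_mono ?_)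
      (union_subset (simplex_mono ?_) (simplex_mono ?_)))) fun x hx => ?_
    iterate 3 grind
    have hzero : x.1 a = 0 ∨ x.1 b = 0 ∨ x.1 c = 0 := by
      by_contra! hne
      refine hface (face_of_forall_pos x.2 (by simp) fun v hv => (x.2.1 v).lt_of_ne' ?_)
      simp only [Finset.mem_insert, Finset.mem_singleton] at hv
      rcases hv with rfl | rfl | rfl
      exacts [hne.1, hne.2.1, hne.2.2]
    have hmem : ∀ {u v w : V}, ({a, b, c} : Finset V) = {u, v, w} → x.1 u = 0 →
        x.1 ∈ simplex {v, w} := fun {u v w} hperm hu => by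
      refine mem_simplex_of_mem_simplex (hperm ▸ hx) fun z hz => ?_
      rcases eq_or_ne z u with rfl | hzu
      exacts [hu, hx.2.1 z (hperm ▸ by simp_all)]
    rcases hzero with ha | hb | hc
    · exact .inr (.inr (hmem rfl ha))
    · exact .inr (.inl (hmem (by grind) hb))
    · exact .inl (hmem (by grind) hc)
  have hwalk : ∀ x ∈ ((({a, b, c} : Finset V) : Set V))ᶜ,
      ∀ y ∈ ((({a, b, c} : Finset V) : Set V))ᶜ, ∃ p : (oneSkeleton K).Walk x y,
        ∀ u ∈ p.support, u ∈ ((({a, b, c} : Finset V) : Set V))ᶜ := by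
    simpa [SeparatesVertices] using h
  refine not_isPreconnected_compl_triangle Ψ hab hbc hca ?_
  rw [hboundary, compl_preimage_simplex]
  exact isPreconnected_of_walks hwalk

/-- The triangle `abc` and the cone over its boundary with apex `d` would bound a sphere: both
have connected complement, and so has their intersection, the boundary of `abc`. -/
theorem not_tetrahedron (Ψ : realization K ≃ₜ ℂ) (hd : d ∉ ({a, b, c} : Finset V)) (hab : a ≠ b)
    (hbc : b ≠ c) (hca : c ≠ a) (habc : {a, b, c} ∈ K.faces) (habd : {d, a, b} ∈ K.faces)
    (hcad : {d, c, a} ∈ K.faces) : {d, b, c} ∉ K.faces := by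
  intro hbcd
  have := infinite_of_homeomorph_plane Ψ
  obtain ⟨e, he⟩ := Infinite.exists_notMem_finset ({a, b, c, d} : Finset V)
  set cone := simplex {d, a, b} ∪ (simplex {d, c, a} ∪ simplex {d, b, c}) with hcone
  have hstar : ∀ s : Finset V, StarConvex ℝ (Pi.single d 1) (simplex (insert d s)) := fun s =>
    convex_simplex.starConvex (single_mem_simplex (by simp))
  have hdcone : Pi.single d 1 ∈ cone := .inl (single_mem_simplex (by simp))
  have hconeC : IsPreconnected ((↑) ⁻¹' cone : Set (realization K))ᶜ :=
    isPreconnected_compl_preimage_of_starConvex Ψ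
      (isCompact_simplex.union (isCompact_simplex.union isCompact_simplex))
      (union_subset (simplex_subset_realization habd) (union_subset
        (simplex_subset_realization hcad) (simplex_subset_realization hbcd)))
      hdcone ((hstar _).union ((hstar _).union (hstar _)))
  have ha : Pi.single a 1 ∈ simplex {a, b, c} := single_mem_simplex (by simp)
  have hbase : IsPreconnected ((↑) ⁻¹' simplex {a, b, c} : Set (realization K))ᶜ :=
    isPreconnected_compl_preimage_of_starConvex Ψ isCompact_simplex
      (simplex_subset_realization habc) ha (convex_simplex.starConvex ha)
  have hinter : simplex {a, b} ∪ (simplex {c, a} ∪ simplex {b, c}) = simplex {a, b, c} ∩ cone := by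
    have hA : ({a, b, c} ∩ {d, a, b} : Finset V) = {a, b} := by grind
    have hB : ({a, b, c} ∩ {d, c, a} : Finset V) = {c, a} := by grind
    have hC : ({a, b, c} ∩ {d, b, c} : Finset V) = {b, c} := by grind
    simp only [hcone, inter_union_distrib_left, simplex_inter, hA, hB, hC]
  have hadj : ∀ {u v}, u ≠ v → {u, v} ⊆ ({a, b, c} : Finset V) → (oneSkeleton K).Adj u v :=
    fun hne hsub => oneSkeleton_adj_iff.2 ⟨hne, face_of_subset habc hsub (by simp)⟩
  refine not_isPreconnected_compl_triangle Ψ (hadj hab (by grind)) (hadj hbc (by grind))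
    (hadj hca (by grind)) ?_
  rw [hinter, preimage_inter, compl_inter]
  refine hbase.union (vertexPoint K e) ?_ ?_ hconeC <;>
  simp only [hcone, mem_compl_iff, mem_preimage, mem_union, vertexPoint_mem_simplex_iff] <;>
  grind

theorem exists_face_insert (Ψ : realization K ≃ₜ ℂ) (hab : (oneSkeleton K).Adj a b) :
    ∃ c ∉ ({a, b} : Finset V), {a, b, c} ∈ K.faces := by
  by_contra! hnone
  refine not_isPreconnected_compl_crossCut hab
    (isPreconnected_compl_of_finite_of_homeomorph_plane Ψ ?_)
  have hmem : ∀ x ∈ crossCut K a b, x.1 ∈ simplex {b, a} :=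
    crossCut_subset_preimage_simplex fun v hv => by
      rw [Finset.pair_comm]
      exact of_not_not fun h => hnone v h hv
  refine Finite.of_finite_image (f := fun x => x.1 a)
    ((toFinite {1 / 3, 2 / 3}).subset ?_) fun x hx y hy hxy => Subtype.ext
    (eq_of_mem_simplex (hmem x hx) (hmem y hy) (by simpa using hxy))
  rintro _ ⟨x, hx, rfl⟩
  have hsum := (hmem x hx).2.2
  rw [Finset.sum_pair hab.ne.symm] at hsum
  rcases hx.2.2 with h | h
  · exact .inl h
  · right
    change x.1 a = 2 / 3
    linarith

theorem exists_face_insert_ne (Ψ : realization K ≃ₜ ℂ) (hab : (oneSkeleton K).Adj a b)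
    (hc : c ∉ ({a, b} : Finset V)) (habc : {a, b, c} ∈ K.faces) :
    ∃ d ∉ ({a, b, c} : Finset V), {a, b, d} ∈ K.faces := by
  by_contra! hnone
  refine not_isPreconnected_compl_crossCut hab ?_
  set T : Set (V → ℝ) := {x | x ∈ simplex {a, b, c} ∧
    (1 / 3 ≤ x a ∧ 1 / 3 ≤ x b ∧ (x a = 1 / 3 ∨ x b = 1 / 3))}
  have hT : crossCut K a b = (↑) ⁻¹' T := by
    refine Subset.antisymm (fun x hx => ⟨crossCut_subset_preimage_simplex (fun v hv => ?_) hx, hx⟩)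
      fun x hx => hx.2
    exact of_not_not fun h => hnone v h hv
  have hcompact : IsCompact T := by
    refine isCompact_simplex.inter_right (.inter ?_ (.inter ?_ (.union ?_ ?_)))
    exacts [isClosed_le continuous_const (continuous_apply a),
      isClosed_le continuous_const (continuous_apply b),
      isClosed_eq (continuous_apply a) continuous_const,
      isClosed_eq (continuous_apply b) continuous_const]
  let barycenter : V → ℝ := fun v => if v ∈ ({a, b, c} : Finset V) then 1 / 3 else 0
  have hbary : barycenter ∈ T := by
    have hcard : ({a, b, c} : Finset V).card = 3 := by
      grind [Finset.card_eq_three, hab.ne]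
    refine ⟨⟨fun v => ?_, fun v hv => if_neg hv, ?_⟩, by simp [barycenter]⟩
    · positivity
    · rw [Finset.sum_congr rfl fun v hv => if_pos hv]
      simp [hcard]
  rw [hT]
  refine isPreconnected_compl_preimage_of_starConvex Ψ hcompact
    (fun x hx => simplex_subset_realization habc hx.1) hbary ?_
  rintro x ⟨hx, hxa, hxb, hor⟩ α β hα hβ hαβ
  refine ⟨convex_simplex hbary.1 hx hα hβ hαβ, ?_⟩
  have hα' : α = 1 - β := by linarith
  simp only [Pi.add_apply, Pi.smul_apply, smul_eq_mul, barycenter, Finset.mem_insert,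
    true_or, or_true, if_true, hα']
  refine ⟨by nlinarith, by nlinarith, hor.imp (fun h => ?_) fun h => ?_⟩ <;>
  · rw [h]
    ring

end Triangles

/-! ### Straight drawings of triangulations -/

/-- The determinant of two plane vectors. -/
def cross (x y : ℂ) : ℝ := x.re * y.im - x.im * y.re

theorem cross_swap (x y : ℂ) : cross y x = -cross x y := by
  unfold cross; ring

/-- The closed simplex spanned by the points `z i`, `i ∈ T`. -/
def closedTri {V : Type*} (z : V → ℂ) (T : Finset V) : Set ℂ :=
  {p | ∃ w : V → ℝ, (∀ i ∈ T, 0 ≤ w i) ∧ ∑ i ∈ T, w i = 1 ∧ ∑ i ∈ T, w i • z i = p}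

/-- The open simplex spanned by the points `z i`, `i ∈ T`. -/
def openTri {V : Type*} (z : V → ℂ) (T : Finset V) : Set ℂ :=
  {p | ∃ w : V → ℝ, (∀ i ∈ T, 0 < w i) ∧ ∑ i ∈ T, w i = 1 ∧ ∑ i ∈ T, w i • z i = p}

theorem exists_first_exit {V : Type*} {T : Finset V} {w w' : V → ℝ} (hw : ∀ i ∈ T, 0 < w i)
    (hw' : ∃ i ∈ T, w' i < 0) : ∃ τ : ℝ, 0 < τ ∧ τ < 1 ∧
      (∀ i ∈ T, 0 ≤ (1 - τ) * w i + τ * w' i) ∧ ∃ i ∈ T, (1 - τ) * w i + τ * w' i = 0 := by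
  obtain ⟨i₀, hi₀, hneg⟩ := hw'
  have hT : T.Nonempty := ⟨i₀, hi₀⟩
  let m : ℝ → ℝ := fun τ => T.inf' hT fun i => (1 - τ) * w i + τ * w' i
  have hm : Continuous m := Continuous.finset_inf'_apply hT fun i _ => by fun_prop
  have hm_zero : 0 < m 0 := by
    simp only [m, Finset.lt_inf'_iff]
    intro i hi
    simpa using hw i hi
  have hm_one : m 1 < 0 := by
    simp only [m, Finset.inf'_lt_iff]
    exact ⟨i₀, hi₀, by simpa using hneg⟩
  obtain ⟨τ, hτ, hmτ⟩ := intermediate_value_Icc' (zero_le_one' ℝ) hm.continuousOn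
    (show (0 : ℝ) ∈ Icc (m 1) (m 0) from ⟨hm_one.le, hm_zero.le⟩)
  refine ⟨τ, lt_of_le_of_ne hτ.1 ?_, lt_of_le_of_ne hτ.2 ?_, fun i hi => ?_, ?_⟩
  · rintro rfl
    exact hm_zero.ne' hmτ
  · rintro rfl
    exact hm_one.ne hmτ
  · rw [← hmτ]
    exact Finset.inf'_le _ hi
  · obtain ⟨i, hi, h⟩ := Finset.exists_mem_eq_inf' hT fun i => (1 - τ) * w i + τ * w' i
    exact ⟨i, hi, by rw [← h]; exact hmτ⟩

theorem exists_weights {a b c : ℂ} (h : cross (b - a) (c - a) ≠ 0) (p : ℂ) :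
    ∃ α β γ : ℝ, α + β + γ = 1 ∧ p = α • a + β • b + γ • c ∧
      γ * cross (b - a) (c - a) = cross (b - a) (p - a) := by
  set D := cross (b - a) (c - a) with hD
  refine ⟨1 - cross (p - a) (c - a) / D - cross (b - a) (p - a) / D,
    cross (p - a) (c - a) / D, cross (b - a) (p - a) / D, by ring, ?_, by field_simp⟩
  apply Complex.ext
  · simp only [Complex.add_re, Complex.real_smul, Complex.mul_re, Complex.ofReal_re,
      Complex.ofReal_im, zero_mul, sub_zero]
    field_simp
    rw [hD]
    simp only [cross, Complex.sub_re, Complex.sub_im]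
    ring
  · simp only [Complex.add_im, Complex.real_smul, Complex.mul_im, Complex.ofReal_re,
      Complex.ofReal_im, zero_mul, add_zero]
    field_simp
    rw [hD]
    simp only [cross, Complex.sub_re, Complex.sub_im]
    ring

theorem weights_unique {a b c : ℂ} (h : cross (b - a) (c - a) ≠ 0) {α β γ : ℝ}
    (hs : α + β + γ = 0) (hp : α • a + β • b + γ • c = 0) : α = 0 ∧ β = 0 ∧ γ = 0 := by
  have hre := congrArg Complex.re hp
  have him := congrArg Complex.im hp
  simp only [Complex.add_re, Complex.add_im, Complex.real_smul, Complex.mul_re, Complex.mul_im,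
    Complex.ofReal_re, Complex.ofReal_im, zero_mul, sub_zero, add_zero, Complex.zero_re,
    Complex.zero_im] at hre him
  have hα : α = -β - γ := by linarith
  subst hα
  have hβ : β * cross (b - a) (c - a) = 0 := by
    simp only [cross, Complex.sub_re, Complex.sub_im]
    linear_combination (c.im - a.im) * hre - (c.re - a.re) * him
  have hγ : γ * cross (b - a) (c - a) = 0 := by
    simp only [cross, Complex.sub_re, Complex.sub_im]
    linear_combination -(b.im - a.im) * hre + (b.re - a.re) * him
  have hβ0 := (mul_eq_zero.1 hβ).resolve_right h
  have hγ0 := (mul_eq_zero.1 hγ).resolve_right h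
  exact ⟨by rw [hβ0, hγ0]; ring, hβ0, hγ0⟩

theorem wbtw_cases_of_cross_eq_zero {a b c : ℂ} (h : cross (b - a) (c - a) = 0) :
    Wbtw ℝ a b c ∨ Wbtw ℝ b c a ∨ Wbtw ℝ c a b := by
  rcases eq_or_ne a b with rfl | hab
  · exact Or.inl (wbtw_self_left ℝ _ _)
  have hba : b - a ≠ 0 := sub_ne_zero.2 hab.symm
  have him : ((c - a) / (b - a)).im = 0 := by
    rw [Complex.div_im, ← sub_div, div_eq_zero_iff]
    exact Or.inl (by unfold cross at h; linarith)
  have hc : c = ((c - a) / (b - a)).re • (b - a) +ᵥ a := by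
    rw [Complex.real_smul, Complex.conj_eq_iff_re.1 (Complex.conj_eq_iff_im.2 him),
      div_mul_cancel₀ _ hba, vadd_eq_add, sub_add_cancel]
  refine Collinear.wbtw_or_wbtw_or_wbtw
    ((collinear_iff_of_mem (mem_insert a _)).2 ⟨b - a, ?_⟩)
  rintro p (rfl | rfl | rfl)
  exacts [⟨0, by simp⟩, ⟨1, by simp⟩, ⟨_, hc⟩]

theorem sum_three {V M : Type*} [DecidableEq V] [AddCommMonoid M] {a b c : V} (hab : a ≠ b)
    (hbc : b ≠ c) (hca : c ≠ a) (f : V → M) : ∑ i ∈ {a, b, c}, f i = f a + f b + f c := by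
  rw [Finset.sum_insert (by simp [hab, hca.symm]), Finset.sum_insert (by simpa using hbc),
    Finset.sum_singleton, add_assoc]

theorem exists_fun_three {V : Type*} {a b c : V} (hab : a ≠ b) (hbc : b ≠ c) (hca : c ≠ a)
    (α β γ : ℝ) : ∃ w : V → ℝ, w a = α ∧ w b = β ∧ w c = γ := by
  classical
  exact ⟨fun i => if i = a then α else if i = b then β else γ, by simp, by simp [hab.symm],
    by simp [hca, hbc.symm]⟩

theorem mem_openTri {V : Type*} [DecidableEq V] (z : V → ℂ) {a b c : V} (hab : a ≠ b)
    (hbc : b ≠ c) (hca : c ≠ a) {α β γ : ℝ} (hα : 0 < α) (hβ : 0 < β) (hγ : 0 < γ)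
    (h : α + β + γ = 1) : α • z a + β • z b + γ • z c ∈ openTri z {a, b, c} := by
  obtain ⟨w, rfl, rfl, rfl⟩ := exists_fun_three hab hbc hca α β γ
  refine ⟨w, ?_, ?_, ?_⟩
  · simp only [Finset.mem_insert, Finset.mem_singleton]
    rintro i (rfl | rfl | rfl) <;> assumption
  · rw [sum_three hab hbc hca, h]
  · rw [sum_three hab hbc hca]

theorem openTri_subset_closedTri {V : Type*} (z : V → ℂ) (T : Finset V) :
    openTri z T ⊆ closedTri z T :=
  fun _ ⟨w, hw, h1, h2⟩ => ⟨w, fun i hi => (hw i hi).le, h1, h2⟩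

theorem mem_closedTri_of_mem {V : Type*} (z : V → ℂ) {T : Finset V} {i : V} (hi : i ∈ T) :
    z i ∈ closedTri z T := by
  classical
  refine ⟨Pi.single i 1, fun j _ => by rw [Pi.single_apply]; split_ifs <;> norm_num, ?_, ?_⟩
  · rw [Finset.sum_pi_single', if_pos hi]
  · rw [Finset.sum_eq_single_of_mem i hi fun j _ hj => by rw [Pi.single_eq_of_ne hj, zero_smul],
      Pi.single_eq_same, one_smul]

theorem openSegment_subset_openTri {V : Type*} {z : V → ℂ} {T : Finset V} {p q : ℂ}
    (hp : p ∈ openTri z T) (hq : q ∈ closedTri z T) : openSegment ℝ p q ⊆ openTri z T := by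
  obtain ⟨w, hw, h1, rfl⟩ := hp
  obtain ⟨w', hw', h1', rfl⟩ := hq
  rintro _ ⟨s, t, hs, ht, hst, rfl⟩
  refine ⟨fun i => s * w i + t * w' i, fun i hi => ?_, ?_, ?_⟩
  · exact add_pos_of_pos_of_nonneg (mul_pos hs (hw i hi)) (mul_nonneg ht.le (hw' i hi))
  · rw [Finset.sum_add_distrib, ← Finset.mul_sum, ← Finset.mul_sum, h1, h1', mul_one, mul_one,
      hst]
  · simp only [add_smul, mul_smul, Finset.sum_add_distrib, Finset.smul_sum]

theorem inter_openTri_nonempty_of_cross_pos {V : Type*} [DecidableEq V] {z : V → ℂ} {a b c d : V}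
    (hab : a ≠ b) (hbc : b ≠ c) (hca : c ≠ a) (hbd : b ≠ d) (hda : d ≠ a)
    (hc : 0 < cross (z b - z a) (z c - z a)) (hd : 0 < cross (z b - z a) (z d - z a)) :
    (openTri z {a, b, c} ∩ openTri z {a, b, d}).Nonempty := by
  obtain ⟨α, β, γ, hsum, hzd, hcross⟩ := exists_weights hc.ne' (z d)
  have hγ : 0 < γ := by
    rw [← hcross] at hd
    exact pos_of_mul_pos_left hd hc.le
  -- Start at the midpoint of the common edge and move slightly towards `z d`.
  have hsmall : ∀ x : ℝ, ∀ᶠ δ : ℝ in 𝓝[>] 0, 0 < (1 - δ) / 2 + δ * x := fun x =>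
    ((Continuous.tendsto' (by fun_prop) 0 (1 / 2) (by norm_num)).mono_left
      nhdsWithin_le_nhds).eventually_const_lt (by norm_num)
  obtain ⟨δ, hδα, hδβ, hδ0, hδ⟩ :=
    ((hsmall α).and ((hsmall β).and ((hsmall 0).and self_mem_nhdsWithin))).exists
  rw [mul_zero, add_zero] at hδ0
  refine ⟨((1 - δ) / 2) • z a + ((1 - δ) / 2) • z b + δ • z d, ?_,
    mem_openTri z hab hbd hda hδ0 hδ0 hδ (by ring)⟩
  convert mem_openTri z hab hbc hca hδα hδβ (mul_pos hδ hγ) (by linear_combination δ * hsum)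
    using 1
  rw [hzd]
  module

/-- A straight-line drawing `z` of a graph together with its triangular faces. The last two fields
are combinatorial substitutes for planarity: a face does not separate the graph, and some vertex is
drawn outside it. -/
structure IsDrawing {V : Type*} (G : SimpleGraph V) (F : Set (Finset V)) (z : V → ℂ) : Prop where
  card : ∀ T ∈ F, T.card = 3
  injective : Function.Injective z
  adj : ∀ T ∈ F, ∀ u ∈ T, ∀ v ∈ T, u ≠ v → G.Adj u v
  notMem_segment : ∀ a b d, G.Adj a b → d ≠ a → d ≠ b → z d ∉ segment ℝ (z a) (z b)
  disjoint_segment : ∀ a b c d, G.Adj a b → G.Adj c d → a ≠ c → a ≠ d → b ≠ c → b ≠ d →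
    Disjoint (segment ℝ (z a) (z b)) (segment ℝ (z c) (z d))
  avoid : ∀ T ∈ F, ∀ x y, x ∉ T → y ∉ T → ∃ p : G.Walk x y, ∀ u ∈ p.support, u ∉ T
  outside : ∀ T ∈ F, ∃ x, x ∉ T ∧ z x ∉ closedTri z T

namespace IsDrawing

variable {V : Type*} {G : SimpleGraph V} {F : Set (Finset V)} {z : V → ℂ}

theorem exists_eq_triple [DecidableEq V] (h : IsDrawing G F z) {T : Finset V} (hT : T ∈ F) :
    ∃ a b c, a ≠ b ∧ b ≠ c ∧ c ≠ a ∧ T = {a, b, c} := by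
  obtain ⟨a, b, c, hab, hac, hbc, e⟩ := Finset.card_eq_three.1 (h.card T hT)
  exact ⟨a, b, c, hab, hbc, hac.symm, e⟩

theorem cross_ne_zero [DecidableEq V] (h : IsDrawing G F z) {a b c : V} (hab : a ≠ b)
    (hbc : b ≠ c) (hca : c ≠ a) (hT : {a, b, c} ∈ F) : cross (z b - z a) (z c - z a) ≠ 0 := by
  intro h0
  have adj_ab := h.adj _ hT a (by simp) b (by simp) hab
  have adj_bc := h.adj _ hT b (by simp) c (by simp) hbc
  have adj_ca := h.adj _ hT c (by simp) a (by simp) hca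
  rcases wbtw_cases_of_cross_eq_zero h0 with hw | hw | hw <;> rw [← mem_segment_iff_wbtw] at hw
  · exact h.notMem_segment a c b adj_ca.symm hab.symm hbc hw
  · exact h.notMem_segment b a c adj_ab.symm hbc.symm hca hw
  · exact h.notMem_segment c b a adj_bc.symm hca.symm hab hw

theorem weights_eq (h : IsDrawing G F z) {T : Finset V} (hT : T ∈ F) {w w' : V → ℝ}
    (h1 : ∑ i ∈ T, w i = ∑ i ∈ T, w' i) (h2 : ∑ i ∈ T, w i • z i = ∑ i ∈ T, w' i • z i) :
    ∀ i ∈ T, w i = w' i := by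
  classical
  obtain ⟨a, b, c, hab, hbc, hca, rfl⟩ := h.exists_eq_triple hT
  rw [sum_three hab hbc hca, sum_three hab hbc hca] at h1 h2
  obtain ⟨ha, hb, hc⟩ := weights_unique (h.cross_ne_zero hab hbc hca hT)
    (α := w a - w' a) (β := w b - w' b) (γ := w c - w' c) (by linarith)
    (by rw [← sub_eq_zero] at h2; rw [← h2]; module)
  simp only [Finset.mem_insert, Finset.mem_singleton]
  rintro i (rfl | rfl | rfl) <;> linarith

theorem exists_weights (h : IsDrawing G F z) {T : Finset V} (hT : T ∈ F) (p : ℂ) :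
    ∃ w : V → ℝ, ∑ i ∈ T, w i = 1 ∧ ∑ i ∈ T, w i • z i = p := by
  classical
  obtain ⟨a, b, c, hab, hbc, hca, rfl⟩ := h.exists_eq_triple hT
  obtain ⟨α, β, γ, h1, h2, -⟩ :=
    DiskPatterns.exists_weights (h.cross_ne_zero hab hbc hca hT) p
  obtain ⟨w, rfl, rfl, rfl⟩ := exists_fun_three hab hbc hca α β γ
  exact ⟨w, by rw [sum_three hab hbc hca, h1], by rw [sum_three hab hbc hca, h2]⟩

theorem exists_mem_segment_of_weight_eq_zero (h : IsDrawing G F z) {T : Finset V} (hT : T ∈ F)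
    {w : V → ℝ} (hw : ∀ i ∈ T, 0 ≤ w i) (h1 : ∑ i ∈ T, w i = 1) (h0 : ∃ i ∈ T, w i = 0) :
    ∃ a b, G.Adj a b ∧ a ∈ T ∧ b ∈ T ∧ ∑ i ∈ T, w i • z i ∈ segment ℝ (z a) (z b) := by
  classical
  obtain ⟨c, hc, hc0⟩ := h0
  obtain ⟨a, b, hab, hTc⟩ : ∃ a b, a ≠ b ∧ T.erase c = {a, b} :=
    Finset.card_eq_two.1 (by rw [Finset.card_erase_of_mem hc, h.card T hT])
  have ha : a ∈ T := Finset.mem_of_mem_erase (hTc ▸ Finset.mem_insert_self a {b})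
  have hb : b ∈ T := Finset.mem_of_mem_erase (by rw [hTc]; simp)
  refine ⟨a, b, h.adj T hT a ha b hb hab, ha, hb, w a, w b, hw a ha, hw b hb, ?_, ?_⟩
  · rw [← h1, ← Finset.sum_erase _ hc0, hTc, Finset.sum_pair hab]
  · rw [← Finset.sum_erase T (a := c) (by rw [hc0, zero_smul]), hTc, Finset.sum_pair hab]

theorem exists_mem_segment_of_exit (h : IsDrawing G F z) {T : Finset V} (hT : T ∈ F) {p q : ℂ}
    (hp : p ∈ openTri z T) (hq : q ∉ closedTri z T) :
    ∃ x ∈ openSegment ℝ p q, ∃ a b, G.Adj a b ∧ a ∈ T ∧ b ∈ T ∧ x ∈ segment ℝ (z a) (z b) := by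
  obtain ⟨w, hw, h1, rfl⟩ := hp
  obtain ⟨w', h1', rfl⟩ := h.exists_weights hT q
  have hneg : ∃ i ∈ T, w' i < 0 := by
    by_contra! hcon
    exact hq ⟨w', hcon, h1', rfl⟩
  obtain ⟨τ, hτ0, hτ1, hnonneg, hzero⟩ := exists_first_exit hw hneg
  refine ⟨_, ⟨1 - τ, τ, sub_pos.2 hτ1, hτ0, sub_add_cancel _ _, rfl⟩, ?_⟩
  have := h.exists_mem_segment_of_weight_eq_zero hT (w := fun i => (1 - τ) * w i + τ * w' i)
    hnonneg (by rw [Finset.sum_add_distrib, ← Finset.mul_sum, ← Finset.mul_sum, h1, h1']; ring)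
    hzero
  simpa only [add_smul, mul_smul, Finset.sum_add_distrib, Finset.smul_sum] using this

theorem mem_openTri_of_mem_closedTri (h : IsDrawing G F z) {T : Finset V} (hT : T ∈ F) {d : V}
    (hd : d ∉ T) (hmem : z d ∈ closedTri z T) : z d ∈ openTri z T := by
  obtain ⟨w, hw, h1, h2⟩ := hmem
  refine ⟨w, fun i hi => lt_of_le_of_ne (hw i hi) fun h0 => ?_, h1, h2⟩
  obtain ⟨a, b, hab, ha, hb, hd'⟩ :=
    h.exists_mem_segment_of_weight_eq_zero hT hw h1 ⟨i, hi, h0.symm⟩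
  exact h.notMem_segment a b d hab (fun e => hd (e ▸ ha)) (fun e => hd (e ▸ hb)) (h2 ▸ hd')

theorem mem_closedTri_of_adj (h : IsDrawing G F z) {T : Finset V} (hT : T ∈ F) {d e : V}
    (hde : G.Adj d e) (hd : d ∉ T) (he : e ∉ T) (hmem : z d ∈ closedTri z T) :
    z e ∈ closedTri z T := by
  by_contra hout
  obtain ⟨x, hx, a, b, hab, ha, hb, hx'⟩ :=
    h.exists_mem_segment_of_exit hT (h.mem_openTri_of_mem_closedTri hT hd hmem) hout
  exact disjoint_left.1 (h.disjoint_segment d e a b hde hab (fun e => hd (e ▸ ha))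
    (fun e => hd (e ▸ hb)) (fun e => he (e ▸ ha)) (fun e => he (e ▸ hb)))
    (openSegment_subset_segment ℝ _ _ hx) hx'

theorem notMem_closedTri (h : IsDrawing G F z) {T : Finset V} (hT : T ∈ F) {d : V} (hd : d ∉ T) :
    z d ∉ closedTri z T := by
  intro hmem
  obtain ⟨x, hx, hout⟩ := h.outside T hT
  obtain ⟨p, hp⟩ := h.avoid T hT d x hd hx
  refine hout ?_
  clear hx hout
  induction p with
  | nil => exact hmem
  | cons hadj q ih =>
    have hnext : _ ∉ T := hp _ (List.mem_cons_of_mem _ q.start_mem_support)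
    exact ih hnext (h.mem_closedTri_of_adj hT hadj hd hnext hmem)
      fun u hu => hp u (List.mem_cons_of_mem _ hu)

theorem eq_of_mem_segment_of_mem_segment (h : IsDrawing G F z) {a b d : V} (hab : G.Adj a b)
    (had : G.Adj a d) {p : ℂ} (hp : p ∈ segment ℝ (z a) (z b)) (hp' : p ∈ segment ℝ (z a) (z d))
    (hpa : p ≠ z a) : b = d := by
  by_contra hbd
  rw [mem_segment_iff_wbtw, wbtw_iff_left_eq_or_right_mem_image_Ici] at hp hp'
  obtain ⟨r, hr, hzb⟩ := hp.resolve_left hpa.symm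
  obtain ⟨s, hs, hzd⟩ := hp'.resolve_left hpa.symm
  rcases wbtw_or_wbtw_smul_vadd_of_nonneg (z a) (p -ᵥ z a) (zero_le_one.trans hr : 0 ≤ r)
    (zero_le_one.trans hs : 0 ≤ s) with hw | hw <;>
  rw [← AffineMap.lineMap_apply, ← AffineMap.lineMap_apply, hzb, hzd, ← mem_segment_iff_wbtw] at hw
  · exact h.notMem_segment a d b had hab.ne' hbd hw
  · exact h.notMem_segment a b d hab had.ne' (Ne.symm hbd) hw

theorem edge_eq_of_mem_openSegment (h : IsDrawing G F z) {a b c d : V} (hab : G.Adj a b)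
    (hcd : G.Adj c d) {p : ℂ} (hp : p ∈ openSegment ℝ (z a) (z b))
    (hp' : p ∈ segment ℝ (z c) (z d)) : s(a, b) = s(c, d) := by
  have hpa : p ≠ z a := fun e =>
    hab.ne (h.injective (left_mem_openSegment_iff.1 (e ▸ hp)))
  have hpb : p ≠ z b := fun e =>
    hab.ne (h.injective (right_mem_openSegment_iff.1 (e ▸ hp)))
  have hseg := openSegment_subset_segment ℝ _ _ hp
  by_cases hac : a = c
  · subst hac
    rw [h.eq_of_mem_segment_of_mem_segment hab hcd hseg hp' hpa]
  by_cases had : a = d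
  · subst had
    rw [segment_symm] at hp'
    rw [h.eq_of_mem_segment_of_mem_segment hab hcd.symm hseg hp' hpa, Sym2.eq_swap]
  rw [segment_symm] at hseg
  by_cases hbc : b = c
  · subst hbc
    exact absurd (h.eq_of_mem_segment_of_mem_segment hab.symm hcd hseg hp' hpb) had
  by_cases hbd : b = d
  · subst hbd
    rw [segment_symm] at hp'
    exact absurd (h.eq_of_mem_segment_of_mem_segment hab.symm hcd.symm hseg hp' hpb) hac
  rw [segment_symm] at hseg
  exact absurd hp' (disjoint_left.1 (h.disjoint_segment a b c d hab hcd hac had hbc hbd) hseg)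

theorem disjoint_segment_openTri (h : IsDrawing G F z) {T : Finset V} (hT : T ∈ F) {a b : V}
    (ha : a ∈ T) (hb : b ∈ T) : Disjoint (segment ℝ (z a) (z b)) (openTri z T) := by
  classical
  refine disjoint_left.2 ?_
  rintro _ ⟨s, t, -, -, hst, rfl⟩ ⟨w, hw, h1, h2⟩
  obtain ⟨c, hc, hcab⟩ : ∃ c ∈ T, c ∉ ({a, b} : Finset V) :=
    Finset.exists_mem_notMem_of_card_lt_card
      (by rw [h.card T hT]; exact Finset.card_le_two.trans_lt (by simp))
  simp only [Finset.mem_insert, Finset.mem_singleton, not_or] at hcab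
  have hwc := h.weights_eq hT (w := w)
    (w' := fun i => (if i = a then s else 0) + if i = b then t else 0)
    (by simp only [h1, Finset.sum_add_distrib, Finset.sum_ite_eq', ha, hb, if_true, hst])
    (by simp only [h2, add_smul, ite_smul, zero_smul, Finset.sum_add_distrib, Finset.sum_ite_eq',
      ha, hb, if_true]) c hc
  rw [if_neg hcab.1, if_neg hcab.2, add_zero] at hwc
  exact (hw c hc).ne' hwc

theorem mem_of_mem_segment_of_mem_openTri (h : IsDrawing G F z) {T : Finset V} (hT : T ∈ F)
    {a b : V} (hab : G.Adj a b) {p : ℂ} (hp : p ∈ segment ℝ (z a) (z b)) (hpT : p ∈ openTri z T) :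
    a ∈ T := by
  by_contra ha
  obtain ⟨q, hq, c, d, hcd, hc, hd, hq'⟩ :=
    h.exists_mem_segment_of_exit hT hpT (h.notMem_closedTri hT ha)
  have hqab : q ∈ openSegment ℝ (z a) (z b) := by
    obtain ⟨s, t, hs, ht, hst, rfl⟩ := hp
    obtain ⟨u, v, hu, hv, huv, rfl⟩ := hq
    have ht0 : t ≠ 0 := by
      rintro rfl
      rw [add_zero] at hst
      rw [hst, one_smul, zero_smul, add_zero] at hpT
      exact h.notMem_closedTri hT ha (openTri_subset_closedTri z T hpT)
    refine ⟨u * s + v, u * t, by positivity, by positivity, by linear_combination u * hst + huv, ?_⟩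
    module
  have hmem : a ∈ s(c, d) := h.edge_eq_of_mem_openSegment hab hcd hqab hq' ▸ Sym2.mem_mk_left a b
  rcases Sym2.mem_iff.1 hmem with rfl | rfl
  exacts [ha hc, ha hd]

theorem eq_of_mem_openTri (h : IsDrawing G F z) {T T' : Finset V} (hT : T ∈ F) (hT' : T' ∈ F)
    {p : ℂ} (hp : p ∈ openTri z T) (hp' : p ∈ openTri z T') : T = T' := by
  by_contra hne
  obtain ⟨d, hd', hd⟩ : ∃ d ∈ T', d ∉ T := by
    by_contra! hsub
    exact hne (Finset.eq_of_subset_of_card_le hsub (by rw [h.card T hT, h.card T' hT'])).symm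
  obtain ⟨q, hq, a, b, hab, -, -, hqab⟩ :=
    h.exists_mem_segment_of_exit hT hp (h.notMem_closedTri hT hd)
  have hqT' := openSegment_subset_openTri hp' (mem_closedTri_of_mem z hd') hq
  have ha := h.mem_of_mem_segment_of_mem_openTri hT' hab hqab hqT'
  have hb := h.mem_of_mem_segment_of_mem_openTri hT' hab.symm (segment_symm ℝ (z a) _ ▸ hqab) hqT'
  exact disjoint_left.1 (h.disjoint_segment_openTri hT' ha hb) hqab hqT'

theorem eq_of_cross_pos [DecidableEq V] (h : IsDrawing G F z) {a b c d : V} (hab : a ≠ b)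
    (hbc : b ≠ c) (hca : c ≠ a) (hbd : b ≠ d) (hda : d ≠ a) (hT : {a, b, c} ∈ F)
    (hT' : {a, b, d} ∈ F) (hc : 0 < cross (z b - z a) (z c - z a))
    (hd : 0 < cross (z b - z a) (z d - z a)) : c = d := by
  obtain ⟨p, hp, hp'⟩ := inter_openTri_nonempty_of_cross_pos hab hbc hca hbd hda hc hd
  have hmem : c ∈ ({a, b, d} : Finset V) := h.eq_of_mem_openTri hT hT' hp hp' ▸ by simp
  simpa [hca, hbc.symm] using hmem

end IsDrawing

/-! ### Inversive products and the drawing by centers -/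

/-- The inversive product of two disks, the cosine of the dihedral angle of intersecting disks. -/
noncomputable def invProd (D D' : ClosedDisk) : ℝ :=
  (Complex.normSq (D.center - D'.center) - D.radius ^ 2 - D'.radius ^ 2) /
    (2 * D.radius * D'.radius)

theorem invProd_comm (D D' : ClosedDisk) : invProd D D' = invProd D' D := by
  unfold invProd
  rw [← Complex.normSq_neg, neg_sub]
  ring

theorem normSq_center_sub (D D' : ClosedDisk) : Complex.normSq (D.center - D'.center) =
    D.radius ^ 2 + D'.radius ^ 2 + 2 * D.radius * D'.radius * invProd D D' := by
  have h := D.radius_pos.ne'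
  have h' := D'.radius_pos.ne'
  unfold invProd
  field_simp
  ring

theorem invProd_eq_cos {D D' : ClosedDisk} {θ : ℝ} (h : HasDihedralAngle D D' θ) :
    invProd D D' = Real.cos θ := by
  obtain ⟨p, ⟨hp, hp'⟩, rfl⟩ := h
  have hD := D.radius_pos
  have hD' := D'.radius_pos
  have e1 : ‖p - D.center‖ = D.radius := by simpa [ClosedDisk.boundary, dist_eq_norm] using hp
  have e2 : ‖p - D'.center‖ = D'.radius := by simpa [ClosedDisk.boundary, dist_eq_norm] using hp'
  rw [InnerProductGeometry.cos_angle]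
  simp only [ClosedDisk.ccwTangent, norm_neg, norm_mul, Complex.norm_I, one_mul, e1, e2]
  have e1' : Complex.normSq (p - D.center) = D.radius ^ 2 := by rw [Complex.normSq_eq_norm_sq, e1]
  have e2' : Complex.normSq (p - D'.center) = D'.radius ^ 2 := by
    rw [Complex.normSq_eq_norm_sq, e2]
  unfold invProd
  rw [div_eq_div_iff (by positivity) (by positivity), ← e1', ← e2', inner_neg_left,
    Complex.inner]
  simp only [Complex.normSq_apply, Complex.mul_re, Complex.sub_re, Complex.sub_im,
    Complex.conj_re, Complex.conj_im, Complex.mul_im, Complex.I_re, Complex.I_im]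
  ring

theorem one_lt_invProd {D D' : ClosedDisk} (h : ¬ (D.carrier ∩ D'.carrier).Nonempty) :
    1 < invProd D D' := by
  have hD := D.radius_pos
  have hD' := D'.radius_pos
  have hlt : D.radius + D'.radius < ‖D.center - D'.center‖ := by
    by_contra! hle
    rw [not_nonempty_iff_eq_empty, ← disjoint_iff_inter_eq_empty] at h
    have := (disjoint_closedBall_closedBall_iff hD.le hD'.le).1 h
    rw [dist_eq_norm] at this
    linarith
  have h2 : (D.radius + D'.radius) ^ 2 < Complex.normSq (D.center - D'.center) := by
    rw [Complex.normSq_eq_norm_sq]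
    gcongr
  unfold invProd
  rw [lt_div_iff₀ (by positivity)]
  linarith

theorem normSq_sub_combination {s t : ℝ} (hst : s + t = 1) (a b d : ℂ) :
    Complex.normSq (d - (s • a + t • b)) + s * t * Complex.normSq (a - b) =
      s * Complex.normSq (d - a) + t * Complex.normSq (d - b) := by
  obtain rfl := eq_sub_of_add_eq' hst
  simp only [Complex.normSq_apply, Complex.sub_re, Complex.sub_im, Complex.add_re, Complex.add_im,
    Complex.real_smul, Complex.mul_re, Complex.mul_im, Complex.ofReal_re, Complex.ofReal_im]
  ring

theorem center_notMem_segment {A B D : ClosedDisk} (hAB : invProd A B ≤ 1)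
    (hDA : 0 ≤ invProd D A) (hDB : 0 ≤ invProd D B) :
    D.center ∉ segment ℝ A.center B.center := by
  rintro ⟨s, t, hs, ht, hst, e⟩
  have h := normSq_sub_combination hst A.center B.center D.center
  rw [e, sub_self, map_zero, normSq_center_sub, normSq_center_sub, normSq_center_sub] at h
  have hA := A.radius_pos
  have hB := B.radius_pos
  have hD := D.radius_pos
  have hAB' : 0 ≤ s * t * (2 * A.radius * B.radius * (1 - invProd A B)) := by
    have := sub_nonneg.2 hAB
    positivity
  have hDA' : 0 ≤ s * (2 * D.radius * A.radius * invProd D A) := by positivity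
  have hDB' : 0 ≤ t * (2 * D.radius * B.radius * invProd D B) := by positivity
  obtain rfl := eq_sub_of_add_eq' hst
  linarith [sq_nonneg (s * A.radius - (1 - s) * B.radius), sq_pos_of_pos hD]

/-- The weighted radii `s r_A`, `t r_B`, `u r_C`, `v r_D` turn the coincidence of two weighted
centers into the vanishing of a sum whose terms are all nonnegative for disks with inversive
products as in `invProd_eq_zero_of_not_disjoint_segment`. -/
theorem sum_eq_zero_of_combination_eq {A B C D : ClosedDisk} {s t u v : ℝ} (hst : s + t = 1)
    (huv : u + v = 1) (e : s • A.center + t • B.center = u • C.center + v • D.center) :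
    (s * A.radius - t * B.radius) ^ 2 + (u * C.radius - v * D.radius) ^ 2 +
      2 * (s * A.radius) * (t * B.radius) * (1 - invProd A B) +
      2 * (u * C.radius) * (v * D.radius) * (1 - invProd C D) +
      2 * (s * A.radius) * (u * C.radius) * invProd A C +
      2 * (s * A.radius) * (v * D.radius) * invProd A D +
      2 * (t * B.radius) * (u * C.radius) * invProd B C +
      2 * (t * B.radius) * (v * D.radius) * invProd B D = 0 := by
  have hA := normSq_sub_combination huv C.center D.center A.center
  have hB := normSq_sub_combination huv C.center D.center B.center
  have hX := normSq_sub_combination hst A.center B.center (u • C.center + v • D.center)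
  rw [e, sub_self, map_zero, ← Complex.normSq_neg (_ + _ - A.center), neg_sub,
    ← Complex.normSq_neg (_ + _ - B.center), neg_sub] at hX
  simp only [normSq_center_sub] at hA hB hX
  obtain rfl := eq_sub_of_add_eq' hst
  obtain rfl := eq_sub_of_add_eq' huv
  linear_combination -hX - s * hA - (1 - s) * hB

theorem pos_and_pos_of_mul_eq_mul {s t a b : ℝ} (hs : 0 ≤ s) (hst : s + t = 1)
    (ha : 0 < a) (hb : 0 < b) (h : s * a = t * b) : 0 < s * a ∧ 0 < t * b := by
  have hpos : 0 < s * a := by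
    refine (mul_nonneg hs ha.le).lt_of_ne' fun h0 => ?_
    have hs0 := (mul_eq_zero.1 h0).resolve_right ha.ne'
    have ht0 := (mul_eq_zero.1 (h ▸ h0)).resolve_right hb.ne'
    linarith
  exact ⟨hpos, h ▸ hpos⟩

theorem invProd_eq_zero_of_not_disjoint_segment {A B C D : ClosedDisk} (hAB : invProd A B ≤ 1)
    (hCD : invProd C D ≤ 1) (hAC : 0 ≤ invProd A C) (hAD : 0 ≤ invProd A D)
    (hBC : 0 ≤ invProd B C) (hBD : 0 ≤ invProd B D)
    (h : ¬ Disjoint (segment ℝ A.center B.center) (segment ℝ C.center D.center)) :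
    invProd A C = 0 ∧ invProd A D = 0 ∧ invProd B C = 0 ∧ invProd B D = 0 := by
  obtain ⟨_, ⟨s, t, hs, ht, hst, rfl⟩, u, v, hu, hv, huv, e⟩ := not_disjoint_iff.1 h
  have hsum := sum_eq_zero_of_combination_eq hst huv e.symm
  have hA := mul_nonneg hs A.radius_pos.le
  have hB := mul_nonneg ht B.radius_pos.le
  have hC := mul_nonneg hu C.radius_pos.le
  have hD := mul_nonneg hv D.radius_pos.le
  have hAB' := mul_nonneg (mul_nonneg (mul_nonneg zero_le_two hA) hB) (sub_nonneg.2 hAB)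
  have hCD' := mul_nonneg (mul_nonneg (mul_nonneg zero_le_two hC) hD) (sub_nonneg.2 hCD)
  have hAC' := mul_nonneg (mul_nonneg (mul_nonneg zero_le_two hA) hC) hAC
  have hAD' := mul_nonneg (mul_nonneg (mul_nonneg zero_le_two hA) hD) hAD
  have hBC' := mul_nonneg (mul_nonneg (mul_nonneg zero_le_two hB) hC) hBC
  have hBD' := mul_nonneg (mul_nonneg (mul_nonneg zero_le_two hB) hD) hBD
  have hsq := sq_nonneg (s * A.radius - t * B.radius)
  have hsq' := sq_nonneg (u * C.radius - v * D.radius)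
  obtain ⟨hA, hB⟩ := pos_and_pos_of_mul_eq_mul hs hst A.radius_pos B.radius_pos
    (sub_eq_zero.1 (pow_eq_zero_iff two_ne_zero |>.1 (by linarith)))
  obtain ⟨hC, hD⟩ := pos_and_pos_of_mul_eq_mul hu huv C.radius_pos D.radius_pos
    (sub_eq_zero.1 (pow_eq_zero_iff two_ne_zero |>.1 (by linarith)))
  have eq_zero : ∀ {a b x : ℝ}, 0 < a → 0 < b → 2 * a * b * x = 0 → x = 0 := fun ha hb h =>
    (mul_eq_zero.1 h).resolve_left (by positivity)
  exact ⟨eq_zero hA hC (by linarith), eq_zero hA hD (by linarith), eq_zero hB hC (by linarith),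
    eq_zero hB hD (by linarith)⟩

theorem center_ne_of_invProd_nonneg {D D' : ClosedDisk} (h : 0 ≤ invProd D D') :
    D.center ≠ D'.center := by
  intro e
  have hD := D.radius_pos
  have hD' := D'.radius_pos
  have hsum := normSq_center_sub D D'
  rw [e, sub_self, map_zero] at hsum
  exact absurd hsum (by positivity)

/-! ### Combinatorial and geometric data of a realization -/

/-- The combinatorial properties of a triangulated plane, with graph `G` and set of faces `F`. -/
structure IsTriangulation {V : Type*} (G : SimpleGraph V) (F : Set (Finset V)) : Prop where
  card : ∀ T ∈ F, T.card = 3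
  adj : ∀ T ∈ F, ∀ u ∈ T, ∀ v ∈ T, u ≠ v → G.Adj u v
  two_faces : ∀ a b, G.Adj a b → ∃ S ∈ F, ∃ T ∈ F, S ≠ T ∧ a ∈ S ∧ b ∈ S ∧ a ∈ T ∧ b ∈ T
  finite_nbrs : ∀ v, {u | G.Adj v u}.Finite
  connected : ∀ x y, Nonempty (G.Walk x y)
  infinite : Infinite V

/-- The geometric properties of a pattern of disks, with contact graph and faces given by a
triangulation, that are used in the rigidity proof. -/
structure IsPacking {V : Type*} (G : SimpleGraph V) (F : Set (Finset V)) (P : V → ClosedDisk) :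
    Prop where
  invProd_nonneg : ∀ u v, u ≠ v → 0 ≤ invProd (P u) (P v)
  invProd_le_one : ∀ u v, G.Adj u v → invProd (P u) (P v) ≤ 1
  drawing : IsDrawing G F fun v => (P v).center

theorem closedTri_subset_convexHull {V : Type*} (z : V → ℂ) (T : Finset V) :
    closedTri z T ⊆ convexHull ℝ (z '' T) := by
  rintro p ⟨w, hw, h1, rfl⟩
  exact (convex_convexHull ℝ _).sum_mem hw h1 fun i hi =>
    subset_convexHull ℝ _ (mem_image_of_mem z hi)

theorem exists_notMem_closedTri {V : Type*} [Infinite V] {P : V → ClosedDisk}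
    (hP : IsLocallyFiniteIn P (Metric.ball 0 1)) (T : Finset V) :
    ∃ x, x ∉ T ∧ (P x).center ∉ closedTri (fun v => (P v).center) T := by
  have hc : ∀ v, (P v).center ∈ (P v).carrier := fun v =>
    Metric.mem_closedBall_self (P v).radius_pos.le
  by_contra! hcon
  have hfin := hP.2 (convexHull ℝ ((fun v => (P v).center) '' T))
    (convexHull_min (by rintro _ ⟨v, -, rfl⟩; exact hP.1 v (hc v)) (convex_ball 0 1))
    ((T.finite_toSet.image _).isCompact_convexHull ℝ)
  refine infinite_univ (hfin.subset fun v _ => ⟨(P v).center, hc v, ?_⟩)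
  by_cases hv : v ∈ T
  · exact subset_convexHull ℝ _ (mem_image_of_mem _ hv)
  · exact closedTri_subset_convexHull _ _ (hcon v hv)

theorem Realizes.invProd_eq {V : Type*} {G : SimpleGraph V} {Θ : Sym2 V → ℝ} {P : V → ClosedDisk}
    (hP : Realizes P G Θ) {u v : V} (h : G.Adj u v) :
    invProd (P u) (P v) = Real.cos (Θ s(u, v)) := by
  have := hP.dihedralAngle u v (by rw [hP.contactGraph_eq]; exact Or.inl h)
  rw [invProd_eq_cos this, completedAngle, if_pos (by simpa using h)]

theorem Realizes.invProd_of_not_adj {V : Type*} {G : SimpleGraph V} {Θ : Sym2 V → ℝ}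
    {P : V → ClosedDisk} (hP : Realizes P G Θ) {u v : V} (huv : u ≠ v) (h : ¬ G.Adj u v) :
    1 ≤ invProd (P u) (P v) := by
  by_cases hc : ((P u).carrier ∩ (P v).carrier).Nonempty
  · have := hP.dihedralAngle u v ⟨huv, hc⟩
    rw [invProd_eq_cos this, completedAngle, if_neg (by simpa using h), Real.cos_zero]
  · exact (one_lt_invProd hc).le

theorem Realizes.invProd_nonneg {V : Type*} {G : SimpleGraph V} {Θ : Sym2 V → ℝ}
    {P : V → ClosedDisk} (hΘ : ∀ e ∈ G.edgeSet, Θ e ∈ Icc 0 (Real.pi / 2)) (hP : Realizes P G Θ)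
    {u v : V} (huv : u ≠ v) : 0 ≤ invProd (P u) (P v) := by
  by_cases h : G.Adj u v
  · rw [hP.invProd_eq h]
    have := hΘ s(u, v) (by simpa using h)
    exact Real.cos_nonneg_of_neg_pi_div_two_le_of_le (by linarith [this.1, Real.pi_pos]) this.2
  · exact zero_le_one.trans (hP.invProd_of_not_adj huv h)

theorem Realizes.invProd_le_one {V : Type*} {G : SimpleGraph V} {Θ : Sym2 V → ℝ}
    {P : V → ClosedDisk} (hP : Realizes P G Θ) {u v : V} (h : G.Adj u v) :
    invProd (P u) (P v) ≤ 1 :=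
  hP.invProd_eq h ▸ Real.cos_le_one _

theorem Realizes.adj_and_angle_eq_of_invProd_eq_zero {V : Type*} {G : SimpleGraph V}
    {Θ : Sym2 V → ℝ} {P : V → ClosedDisk} (hΘ : ∀ e ∈ G.edgeSet, Θ e ∈ Icc 0 (Real.pi / 2))
    (hP : Realizes P G Θ) {u v : V} (huv : u ≠ v) (h : invProd (P u) (P v) = 0) :
    G.Adj u v ∧ Θ s(u, v) = Real.pi / 2 := by
  have hadj : G.Adj u v := by
    by_contra hadj
    exact absurd (hP.invProd_of_not_adj huv hadj) (by rw [h]; norm_num)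
  refine ⟨hadj, ?_⟩
  have hmem := hΘ s(u, v) hadj
  rw [hP.invProd_eq hadj] at h
  by_contra hne
  exact (Real.cos_pos_of_mem_Ioo ⟨by linarith [hmem.1, Real.pi_pos],
    lt_of_le_of_ne hmem.2 hne⟩).ne' h

/-- The triangles of a simplicial complex, which are its faces in the sense of a planar map. -/
def triangles {V : Type*} (K : AbstractSimplicialComplex V) : Set (Finset V) :=
  {T | T ∈ K.faces ∧ T.card = 3}

section Complex

variable {V : Type*} {K : AbstractSimplicialComplex V} {Θ : Sym2 V → ℝ} {P : V → ClosedDisk}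

theorem mem_triangles_of_mem_faces [DecidableEq V] {a b c : V} (hab : a ≠ b)
    (hc : c ∉ ({a, b} : Finset V)) (h : {a, b, c} ∈ K.faces) : {a, b, c} ∈ triangles K := by
  simp only [Finset.mem_insert, Finset.mem_singleton, not_or] at hc
  exact ⟨h, Finset.card_eq_three.2 ⟨a, b, c, hab, Ne.symm hc.1, Ne.symm hc.2, rfl⟩⟩

theorem isTriangulation_triangles (hlf : ∀ v : V, {s | s ∈ K.faces ∧ v ∈ s}.Finite)
    (Ψ : realization K ≃ₜ ℂ) : IsTriangulation (oneSkeleton K) (triangles K) where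
  card T hT := hT.2
  adj T hT u hu v hv huv := ⟨huv, T, hT.1, hu, hv⟩
  two_faces a b hab := by
    classical
    obtain ⟨c, hc, habc⟩ := exists_face_insert Ψ hab
    obtain ⟨d, hd, habd⟩ := exists_face_insert_ne Ψ hab hc habc
    have hd' : d ∉ ({a, b} : Finset V) := fun h => hd (by
      simp only [Finset.mem_insert, Finset.mem_singleton] at h ⊢
      tauto)
    exact ⟨_, mem_triangles_of_mem_faces hab.ne hc habc, _,
      mem_triangles_of_mem_faces hab.ne hd' habd,
      fun e => hd (e ▸ by simp), by simp, by simp, by simp, by simp⟩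
  finite_nbrs v := ((hlf v).biUnion fun s _ => s.finite_toSet).subset
    fun _ ⟨_, s, hs, hv, hu⟩ => mem_biUnion (x := s) ⟨hs, hv⟩ hu
  connected := connected_of_homeomorph_plane Ψ
  infinite := infinite_of_homeomorph_plane Ψ

theorem Realizes.face_of_invProd_eq_zero [DecidableEq V] (Ψ : realization K ≃ₜ ℂ)
    (hΘ : ∀ e ∈ (oneSkeleton K).edgeSet, Θ e ∈ Icc 0 (Real.pi / 2))
    (hsep : SeparatingTriangleCondition (oneSkeleton K) Θ) (hP : Realizes P (oneSkeleton K) Θ)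
    {u v w : V} (huv : (oneSkeleton K).Adj u v) (hwu : w ≠ u) (hwv : w ≠ v)
    (hu : invProd (P u) (P w) = 0) (hv : invProd (P v) (P w) = 0) : {u, v, w} ∈ K.faces := by
  obtain ⟨adj_vw, angle_vw⟩ := hP.adj_and_angle_eq_of_invProd_eq_zero hΘ hwv.symm hv
  rw [invProd_comm] at hu
  obtain ⟨adj_wu, angle_wu⟩ := hP.adj_and_angle_eq_of_invProd_eq_zero hΘ hwu hu
  refine face_of_not_separatesVertices Ψ huv adj_vw adj_wu fun hs => ?_
  have hlt := hsep u v w huv adj_vw adj_wu hs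
  have := (hΘ s(u, v) huv).1
  linarith

/-- Crossing edges would be mutually orthogonal, so that their endpoints would span the boundary of
a tetrahedron. -/
theorem Realizes.disjoint_segment_center (Ψ : realization K ≃ₜ ℂ)
    (hΘ : ∀ e ∈ (oneSkeleton K).edgeSet, Θ e ∈ Icc 0 (Real.pi / 2))
    (hsep : SeparatingTriangleCondition (oneSkeleton K) Θ) (hP : Realizes P (oneSkeleton K) Θ)
    {a b c d : V} (hab : (oneSkeleton K).Adj a b) (hcd : (oneSkeleton K).Adj c d) (hac : a ≠ c)
    (had : a ≠ d) (hbc : b ≠ c) (hbd : b ≠ d) :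
    Disjoint (segment ℝ (P a).center (P b).center) (segment ℝ (P c).center (P d).center) := by
  classical
  by_contra hmeet
  obtain ⟨ac, ad, bc, bd⟩ := invProd_eq_zero_of_not_disjoint_segment (hP.invProd_le_one hab)
    (hP.invProd_le_one hcd) (hP.invProd_nonneg hΘ hac) (hP.invProd_nonneg hΘ had)
    (hP.invProd_nonneg hΘ hbc) (hP.invProd_nonneg hΘ hbd) hmeet
  have face {u v w : V} (huv : (oneSkeleton K).Adj u v) (hwu : w ≠ u) (hwv : w ≠ v)
      (hu : invProd (P u) (P w) = 0) (hv : invProd (P v) (P w) = 0) : {u, v, w} ∈ K.faces :=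
    hP.face_of_invProd_eq_zero Ψ hΘ hsep huv hwu hwv hu hv
  rw [invProd_comm] at ac ad bc bd
  have hcda : {c, d, a} ∈ K.faces := face hcd hac had ac ad
  have hcdb : {c, d, b} ∈ K.faces := face hcd hbc hbd bc bd
  rw [invProd_comm] at ac ad bc bd
  have habc : {a, b, c} ∈ K.faces := face hab hac.symm hbc.symm ac bc
  have habd : {a, b, d} ∈ K.faces := face hab had.symm hbd.symm ad bd
  refine not_tetrahedron Ψ (a := a) (b := b) (c := c) (d := d) ?_ hab.ne hbc hac.symm habc ?_ ?_ ?_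
  · simp [had.symm, hbd.symm, hcd.ne']
  · rwa [Finset.insert_comm, Finset.pair_comm d b]
  · rwa [Finset.insert_comm]
  · rwa [Finset.insert_comm, Finset.pair_comm] at hcdb

theorem Realizes.isPacking (Ψ : realization K ≃ₜ ℂ)
    (hΘ : ∀ e ∈ (oneSkeleton K).edgeSet, Θ e ∈ Icc 0 (Real.pi / 2))
    (hsep : SeparatingTriangleCondition (oneSkeleton K) Θ) (hP : Realizes P (oneSkeleton K) Θ)
    (hfin : IsLocallyFiniteIn P (Metric.ball 0 1)) :
    IsPacking (oneSkeleton K) (triangles K) P where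
  invProd_nonneg _ _ huv := hP.invProd_nonneg hΘ huv
  invProd_le_one _ _ := hP.invProd_le_one
  drawing :=
    { card := fun _ hT => hT.2
      injective := fun _ _ e => by_contra fun huv =>
        center_ne_of_invProd_nonneg (hP.invProd_nonneg hΘ huv) e
      adj := fun T hT _ hu _ hv huv => ⟨huv, T, hT.1, hu, hv⟩
      notMem_segment := fun _ _ _ hab hda hdb => center_notMem_segment (hP.invProd_le_one hab)
        (hP.invProd_nonneg hΘ hda) (hP.invProd_nonneg hΘ hdb)
      disjoint_segment := fun _ _ _ _ hab hcd hac had hbc hbd =>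
        hP.disjoint_segment_center Ψ hΘ hsep hab hcd hac had hbc hbd
      avoid := fun _ hT _ _ hx hy => exists_walk_avoiding_face Ψ hT.1 hx hy
      outside := fun T _ =>
        have := infinite_of_homeomorph_plane Ψ
        exists_notMem_closedTri hfin T }

theorem IsDiskTriangulationGraph.exists_homeomorph_plane {G : SimpleGraph V}
    (hG : IsDiskTriangulationGraph G) : ∃ K : AbstractSimplicialComplex V,
      (∀ v : V, {s | s ∈ K.faces ∧ v ∈ s}.Finite) ∧ Nonempty (realization K ≃ₜ ℂ) ∧
        oneSkeleton K = G := by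
  classical
  obtain ⟨K, ⟨hlf, ⟨Φ⟩⟩, hadj⟩ := hG
  refine ⟨K, hlf, ⟨Φ.trans (Homeomorph.unitBall (E := ℂ)).symm⟩, ?_⟩
  ext u v
  rw [hadj, oneSkeleton_adj_iff]
  refine and_congr_right fun _ => ⟨fun h => ⟨_, h, by simp⟩, ?_⟩
  rintro ⟨s, hs, e⟩
  rwa [show s = {u, v} from Finset.coe_injective (by rw [e]; simp)] at hs

theorem exists_isTriangulation {G : SimpleGraph V} (hG : IsDiskTriangulationGraph G)
    (hΘ : ∀ e ∈ G.edgeSet, Θ e ∈ Icc 0 (Real.pi / 2)) (hsep : SeparatingTriangleCondition G Θ) :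
    ∃ F : Set (Finset V), IsTriangulation G F ∧ ∀ P : V → ClosedDisk, Realizes P G Θ →
      IsLocallyFiniteIn P (Metric.ball 0 1) → IsPacking G F P := by
  obtain ⟨K, hlf, ⟨Ψ⟩, rfl⟩ := hG.exists_homeomorph_plane
  exact ⟨triangles K, isTriangulation_triangles hlf Ψ,
    fun _ hP hfin => hP.isPacking Ψ hΘ hsep hfin⟩

end Complex

/-! ### Flowers -/

/-- The neighbors of a vertex. -/
abbrev Nbr {V : Type*} (G : SimpleGraph V) (v : V) : Type _ := {a // G.Adj v a}

theorem exists_eq_insert {V : Type*} [DecidableEq V] {T : Finset V} (hT : T.card = 3) {a b : V}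
    (hab : a ≠ b) (ha : a ∈ T) (hb : b ∈ T) : ∃ c, c ≠ a ∧ c ≠ b ∧ T = {a, b, c} := by
  have hb' : b ∈ T.erase a := Finset.mem_erase.2 ⟨hab.symm, hb⟩
  obtain ⟨c, hc⟩ : ∃ c, (T.erase a).erase b = {c} := Finset.card_eq_one.1 (by
    rw [Finset.card_erase_of_mem hb', Finset.card_erase_of_mem ha, hT])
  have hcT : c ∈ (T.erase a).erase b := hc ▸ Finset.mem_singleton_self c
  simp only [Finset.mem_erase] at hcT
  exact ⟨c, hcT.2.1, hcT.1, by rw [← hc, Finset.insert_erase hb', Finset.insert_erase ha]⟩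

theorem cross_sub_swap (a b c : ℂ) : cross (a - b) (c - b) = -cross (b - a) (c - a) := by
  simp only [cross, Complex.sub_re, Complex.sub_im]
  ring

theorem IsDrawing.exists_sides {V : Type*} [DecidableEq V] {G : SimpleGraph V}
    {F : Set (Finset V)} {z : V → ℂ} (hF : IsTriangulation G F) (h : IsDrawing G F z) {v a : V}
    (hva : G.Adj v a) : ∃ c d, c ≠ v ∧ c ≠ a ∧ d ≠ v ∧ d ≠ a ∧ {v, a, c} ∈ F ∧ {v, a, d} ∈ F ∧
      0 < cross (z a - z v) (z c - z v) ∧ cross (z a - z v) (z d - z v) < 0 := by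
  obtain ⟨S, hS, T, hT, hST, hvS, haS, hvT, haT⟩ := hF.two_faces v a hva
  obtain ⟨c, hcv, hca, rfl⟩ := exists_eq_insert (hF.card S hS) hva.ne hvS haS
  obtain ⟨d, hdv, hda, rfl⟩ := exists_eq_insert (hF.card T hT) hva.ne hvT haT
  have hcd : c ≠ d := fun e => hST (by rw [e])
  rcases lt_or_gt_of_ne (h.cross_ne_zero hva.ne hca.symm hcv hS) with hc | hc <;>
    rcases lt_or_gt_of_ne (h.cross_ne_zero hva.ne hda.symm hdv hT) with hd | hd
  · refine absurd (h.eq_of_cross_pos hva.ne' hcv.symm hca hdv.symm hda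
      (by rwa [Finset.insert_comm]) (by rwa [Finset.insert_comm]) ?_ ?_) hcd
    · rwa [cross_sub_swap, neg_pos]
    · rwa [cross_sub_swap, neg_pos]
  · exact ⟨d, c, hdv, hda, hcv, hca, hT, hS, hd, hc⟩
  · exact ⟨c, d, hcv, hca, hdv, hda, hS, hT, hc, hd⟩
  · exact absurd (h.eq_of_cross_pos hva.ne hca.symm hcv hda.symm hdv hS hT hc hd) hcd

/-- The counterclockwise angle from `x` to `y`, assumed to be less than `π`, contains directions
just below the negative real axis: this is where the principal argument jumps. -/
def Wraps (x y : ℂ) : Prop := 0 ≤ x.im ∧ y.im < 0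

theorem arg_mem_Ioo_of_im_pos {q : ℂ} (hq : 0 < q.im) : q.arg ∈ Ioo 0 Real.pi := by
  refine ⟨(Complex.arg_nonneg_iff.2 hq.le).lt_of_ne' fun h => ?_,
    (Complex.arg_le_pi q).lt_of_ne fun h => ?_⟩
  · exact hq.ne' (Complex.arg_eq_zero_iff.1 h).2
  · exact hq.ne' (Complex.arg_eq_pi_iff.1 h).2

open Classical in
theorem arg_mul_eq_add_sub_ite {x q : ℂ} (hx : x ≠ 0) (hq : 0 < q.im) :
    (x * q).arg = x.arg + q.arg - if Wraps x (x * q) then 2 * Real.pi else 0 := by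
  obtain ⟨hq_pos, hq_lt⟩ := arg_mem_Ioo_of_im_pos hq
  have hx_gt := Complex.neg_pi_lt_arg x
  have hx_le := Complex.arg_le_pi x
  have harg : (x * q).arg = ((x.arg + q.arg : ℝ) : Real.Angle).toReal := by
    rw [Real.Angle.coe_add, ← Complex.arg_mul_coe_angle hx (by rintro rfl; simp at hq),
      Complex.arg_coe_angle_toReal_eq_arg]
  rcases le_or_gt (x.arg + q.arg) Real.pi with hle | hgt
  · rw [Real.Angle.toReal_coe_eq_self_iff.2 ⟨by linarith, hle⟩] at harg
    have hnot : ¬ Wraps x (x * q) := fun ⟨hx0, hlt⟩ => by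
      linarith [Complex.arg_nonneg_iff.2 hx0, Complex.arg_neg_iff.2 hlt]
    rw [if_neg hnot, harg, sub_zero]
  · rw [Real.Angle.toReal_coe_eq_self_sub_two_pi_iff.2 ⟨hgt, by linarith⟩] at harg
    have hwraps : Wraps x (x * q) :=
      ⟨Complex.arg_nonneg_iff.1 (by linarith), Complex.arg_neg_iff.1 (by linarith)⟩
    rw [if_pos hwraps, harg]

theorem cross_smul_eq (x y d : ℂ) : cross x y • d = cross d y • x + cross x d • y := by
  apply Complex.ext <;>
    simp only [cross, Complex.add_re, Complex.add_im, Complex.real_smul, Complex.mul_re,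
      Complex.mul_im, Complex.ofReal_re, Complex.ofReal_im] <;>
    ring

theorem eventually_mem_openTri {V : Type*} [DecidableEq V] {z : V → ℂ} {v a b : V} (hva : v ≠ a)
    (hab : a ≠ b) (hbv : b ≠ v) {d : ℂ} (h : 0 < cross (z a - z v) (z b - z v))
    (had : 0 < cross (z a - z v) d) (hdb : 0 < cross d (z b - z v)) :
    ∀ᶠ δ : ℝ in 𝓝[>] 0, z v + δ • d ∈ openTri z {v, a, b} := by
  set α := cross d (z b - z v) / cross (z a - z v) (z b - z v) with hα
  set β := cross (z a - z v) d / cross (z a - z v) (z b - z v) with hβ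
  have hd : d = α • (z a - z v) + β • (z b - z v) := by
    rw [hα, hβ, div_eq_inv_mul, div_eq_inv_mul, mul_smul, mul_smul, ← smul_add, ← cross_smul_eq,
      inv_smul_smul₀ h.ne']
  have hα_pos : 0 < α := div_pos hdb h
  have hβ_pos : 0 < β := div_pos had h
  have hsmall : ∀ᶠ δ : ℝ in 𝓝[>] 0, 0 < 1 - δ * α - δ * β :=
    nhdsWithin_le_nhds ((by fun_prop : Continuous fun δ : ℝ => 1 - δ * α - δ * β).continuousAt
      |>.eventually_const_lt (by simp))
  filter_upwards [hsmall, self_mem_nhdsWithin] with δ hδ hδ_pos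
  convert mem_openTri z hva hab hbv hδ (mul_pos hδ_pos hα_pos) (mul_pos hδ_pos hβ_pos) (by ring)
    using 1
  rw [hd]
  module

theorem Wraps.eventually_cross_pos {x y : ℂ} (h : Wraps x y) (hxy : 0 < cross x y) :
    ∀ᶠ ε : ℝ in 𝓝[>] 0, 0 < cross x ⟨-1, -ε⟩ ∧ 0 < cross ⟨-1, -ε⟩ y := by
  obtain ⟨hx, hy⟩ := h
  have hleft : ∀ᶠ ε : ℝ in 𝓝[>] 0, 0 < cross x ⟨-1, -ε⟩ := by
    rcases hx.lt_or_eq with hx | hx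
    · exact nhdsWithin_le_nhds
        ((by unfold cross; fun_prop : Continuous fun ε : ℝ => cross x ⟨-1, -ε⟩).continuousAt
          |>.eventually_const_lt (by simpa [cross] using hx))
    · have hre : x.re < 0 := by
        rw [cross, ← hx] at hxy
        nlinarith
      filter_upwards [self_mem_nhdsWithin] with ε (hε : 0 < ε)
      rw [cross, ← hx]
      nlinarith
  refine hleft.and (nhdsWithin_le_nhds
    ((by unfold cross; fun_prop : Continuous fun ε : ℝ => cross ⟨-1, -ε⟩ y).continuousAt
      |>.eventually_const_lt (by simpa [cross] using hy)))

/-- The angular ordering of the neighbors of `v` in a drawing: `σ` maps every neighbor to the next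
one in counterclockwise order. -/
structure IsFlower {V : Type*} [DecidableEq V] {G : SimpleGraph V} (F : Set (Finset V)) (z : V → ℂ)
    (v : V) (σ : Equiv.Perm (Nbr G v)) : Prop where
  face : ∀ a, {v, a.1, (σ a).1} ∈ F
  pos : ∀ a : Nbr G v, 0 < cross (z a - z v) (z (σ a) - z v)
  eq_or_eq : ∀ a b : Nbr G v, a ≠ b → {v, a.1, b.1} ∈ F → b = σ a ∨ a = σ b

section Flower

variable {V : Type*} [DecidableEq V] {G : SimpleGraph V} {F : Set (Finset V)} {z : V → ℂ} {v : V}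

theorem IsDrawing.exists_nbr_sides (hF : IsTriangulation G F) (h : IsDrawing G F z)
    (a : Nbr G v) : ∃ c d : Nbr G v, c ≠ a ∧ d ≠ a ∧ {v, a.1, c.1} ∈ F ∧ {v, a.1, d.1} ∈ F ∧
      0 < cross (z a - z v) (z c - z v) ∧ cross (z a - z v) (z d - z v) < 0 := by
  obtain ⟨c, d, hcv, hca, hdv, hda, hc, hd, hcross⟩ := h.exists_sides hF a.2
  exact ⟨⟨c, hF.adj _ hc v (by simp) c (by simp) hcv.symm⟩,
    ⟨d, hF.adj _ hd v (by simp) d (by simp) hdv.symm⟩, fun e => hca (congrArg Subtype.val e),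
    fun e => hda (congrArg Subtype.val e), hc, hd, hcross⟩

theorem IsDrawing.nbr_eq_of_cross_pos (h : IsDrawing G F z) {a c d : Nbr G v} (hca : c ≠ a)
    (hda : d ≠ a) (hc : {v, a.1, c.1} ∈ F) (hd : {v, a.1, d.1} ∈ F)
    (hc_pos : 0 < cross (z a - z v) (z c - z v)) (hd_pos : 0 < cross (z a - z v) (z d - z v)) :
    c = d :=
  Subtype.ext <| h.eq_of_cross_pos a.2.ne (fun e => hca (Subtype.ext e.symm)) c.2.ne'
    (fun e => hda (Subtype.ext e.symm)) d.2.ne' hc hd hc_pos hd_pos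

theorem IsDrawing.nbr_eq_of_cross_neg (h : IsDrawing G F z) {a c d : Nbr G v} (hca : c ≠ a)
    (hda : d ≠ a) (hc : {v, a.1, c.1} ∈ F) (hd : {v, a.1, d.1} ∈ F)
    (hc_neg : cross (z a - z v) (z c - z v) < 0) (hd_neg : cross (z a - z v) (z d - z v) < 0) :
    c = d := by
  rw [Finset.insert_comm] at hc hd
  exact Subtype.ext <| h.eq_of_cross_pos a.2.ne' c.2.ne (fun e => hca (Subtype.ext e)) d.2.ne
    (fun e => hda (Subtype.ext e)) hc hd (by rwa [cross_sub_swap, neg_pos])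
    (by rwa [cross_sub_swap, neg_pos])

theorem IsDrawing.exists_isFlower (hF : IsTriangulation G F) (h : IsDrawing G F z) (v : V) :
    ∃ σ : Equiv.Perm (Nbr G v), IsFlower F z v σ := by
  choose next prev next_ne prev_ne next_face prev_face next_pos prev_neg using
    h.exists_nbr_sides hF (v := v)
  have swap {a b : V} (hab : {v, a, b} ∈ F) : {v, b, a} ∈ F := by rwa [Finset.pair_comm]
  let σ : Equiv.Perm (Nbr G v) :=
    { toFun := next
      invFun := prev
      left_inv := fun a => h.nbr_eq_of_cross_neg (prev_ne _) (next_ne a).symm (prev_face _)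
        (swap (next_face a)) (prev_neg _) (by rw [cross_swap, neg_lt_zero]; exact next_pos a)
      right_inv := fun a => h.nbr_eq_of_cross_pos (next_ne _) (prev_ne a).symm (next_face _)
        (swap (prev_face a)) (next_pos _) (by rw [cross_swap, neg_pos]; exact prev_neg a) }
  refine ⟨σ, next_face, next_pos, fun a b hab hface => ?_⟩
  have hne := h.cross_ne_zero a.2.ne (fun e => hab (Subtype.ext e)) b.2.ne' hface
  rcases lt_or_gt_of_ne hne with hneg | hpos
  · exact Or.inr (h.nbr_eq_of_cross_pos hab (next_ne b) (swap hface) (next_face b)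
      (by rwa [cross_swap, neg_pos]) (next_pos b))
  · exact Or.inl (h.nbr_eq_of_cross_pos hab.symm (next_ne a) hface (next_face a) hpos (next_pos a))

variable {σ : Equiv.Perm (Nbr G v)}

theorem IsFlower.ne_apply (hσ : IsFlower F z v σ) (a : Nbr G v) : a.1 ≠ (σ a).1 := fun e =>
  (hσ.pos a).ne' (by rw [← e, cross]; ring)

theorem im_div_pos_of_cross_pos {x y : ℂ} (h : 0 < cross x y) : 0 < (y / x).im := by
  have hx : x ≠ 0 := by
    rintro rfl
    simp [cross] at h
  have hn := Complex.normSq_pos.2 hx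
  rw [Complex.div_im, ← sub_div]
  exact div_pos (by rw [cross] at h; linarith) hn

theorem IsFlower.im_div_pos (hσ : IsFlower F z v σ) (a : Nbr G v) :
    0 < ((z (σ a) - z v) / (z a - z v)).im :=
  im_div_pos_of_cross_pos (hσ.pos a)

theorem IsFlower.eventually_mem_openTri (hσ : IsFlower F z v σ) {a : Nbr G v}
    (ha : Wraps (z a - z v) (z (σ a) - z v)) : ∀ᶠ ε : ℝ in 𝓝[>] 0, ∀ᶠ δ : ℝ in 𝓝[>] 0,
      z v + δ • (⟨-1, -ε⟩ : ℂ) ∈ openTri z {v, a.1, (σ a).1} :=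
  (ha.eventually_cross_pos (hσ.pos a)).mono fun _ ⟨hleft, hright⟩ =>
    DiskPatterns.eventually_mem_openTri a.2.ne (hσ.ne_apply a) (σ a).2.ne' (hσ.pos a) hleft hright

theorem IsFlower.eq_of_wraps (h : IsDrawing G F z) (hσ : IsFlower F z v σ) {a b : Nbr G v}
    (ha : Wraps (z a - z v) (z (σ a) - z v)) (hb : Wraps (z b - z v) (z (σ b) - z v)) : a = b := by
  obtain ⟨ε, hεa, hεb⟩ := ((hσ.eventually_mem_openTri ha).and (hσ.eventually_mem_openTri hb)).exists
  obtain ⟨δ, hδa, hδb⟩ := (hεa.and hεb).exists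
  have hface := h.eq_of_mem_openTri (hσ.face a) (hσ.face b) hδa hδb
  have hmem : a.1 ∈ ({v, b.1, (σ b).1} : Finset V) := hface ▸ by simp
  simp only [Finset.mem_insert, Finset.mem_singleton, a.2.ne', false_or] at hmem
  refine Subtype.ext (hmem.resolve_right fun e => ?_)
  exact hb.2.not_ge (e ▸ ha.1)

open Classical in
theorem IsFlower.sum_arg_eq_card_mul (h : IsDrawing G F z) (hσ : IsFlower F z v σ)
    {S : Finset (Nbr G v)} (hmap : S.map σ.toEmbedding = S) :
    ∑ a ∈ S, ((z (σ a) - z v) / (z a - z v)).arg =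
      (S.filter fun a : Nbr G v => Wraps (z a - z v) (z (σ a) - z v)).card * (2 * Real.pi) := by
  have hne : ∀ a : Nbr G v, z a - z v ≠ 0 := fun a => sub_ne_zero.2 (h.injective.ne a.2.ne')
  have harg : ∀ a : Nbr G v, ((z (σ a) - z v) / (z a - z v)).arg =
      (z (σ a) - z v).arg - (z a - z v).arg +
        if Wraps (z a - z v) (z (σ a) - z v) then 2 * Real.pi else 0 := by
    intro a
    have := arg_mul_eq_add_sub_ite (hne a) (hσ.im_div_pos a)
    rw [mul_div_cancel₀ _ (hne a)] at this
    linarith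
  have hsum : ∑ a ∈ S, (z (σ a) - z v).arg = ∑ a ∈ S, (z a - z v).arg := by
    conv_rhs => rw [← hmap, Finset.sum_map]
    rfl
  rw [Finset.sum_congr rfl fun a _ => harg a, Finset.sum_add_distrib, Finset.sum_sub_distrib, hsum,
    sub_self, zero_add, ← Finset.sum_filter, Finset.sum_const, nsmul_eq_mul]

theorem IsFlower.sum_arg (h : IsDrawing G F z) (hσ : IsFlower F z v σ)
    {S : Finset (Nbr G v)} (hS : S.Nonempty) (hmap : S.map σ.toEmbedding = S) :
    ∑ a ∈ S, ((z (σ a) - z v) / (z a - z v)).arg = 2 * Real.pi := by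
  classical
  have hpos : 0 < ∑ a ∈ S, ((z (σ a) - z v) / (z a - z v)).arg :=
    Finset.sum_pos (fun a _ => (arg_mem_Ioo_of_im_pos (hσ.im_div_pos a)).1) hS
  rw [hσ.sum_arg_eq_card_mul h hmap] at hpos ⊢
  have hcard : (S.filter fun a : Nbr G v => Wraps (z a - z v) (z (σ a) - z v)).card = 1 := by
    refine le_antisymm (Finset.card_le_one.2 fun a ha b hb =>
      hσ.eq_of_wraps h (Finset.mem_filter.1 ha).2 (Finset.mem_filter.1 hb).2)
      (Nat.one_le_iff_ne_zero.2 fun h0 => ?_)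
    rw [h0, Nat.cast_zero, zero_mul] at hpos
    exact hpos.false
  rw [hcard, Nat.cast_one, one_mul]

theorem IsFlower.induction (h : IsDrawing G F z) [Finite (Nbr G v)] (hσ : IsFlower F z v σ)
    {p : Nbr G v → Prop} (hp : ∀ a, p a → p (σ a)) {a : Nbr G v} (ha : p a) (b : Nbr G v) :
    p b := by
  classical
  have := Fintype.ofFinite (Nbr G v)
  by_contra hb
  set S := Finset.univ.filter p with hS
  have hmap : S.map σ.toEmbedding = S := by
    refine Finset.eq_of_subset_of_card_le (fun x hx => ?_) (by rw [Finset.card_map])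
    obtain ⟨y, hy, rfl⟩ := Finset.mem_map.1 hx
    exact Finset.mem_filter.2 ⟨Finset.mem_univ _, hp y (Finset.mem_filter.1 hy).2⟩
  have hmap' : Sᶜ.map σ.toEmbedding = Sᶜ := by
    refine Finset.eq_of_subset_of_card_le (fun x hx => ?_) (by rw [Finset.card_map])
    obtain ⟨y, hy, rfl⟩ := Finset.mem_map.1 hx
    rw [Finset.mem_compl] at hy ⊢
    rw [← hmap]
    simpa using hy
  have sum_S := hσ.sum_arg h ⟨a, by simpa [hS] using ha⟩ hmap
  have sum_compl := hσ.sum_arg h ⟨b, by simpa [hS] using hb⟩ hmap'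
  have sum_univ := hσ.sum_arg h (S := Finset.univ) ⟨a, Finset.mem_univ a⟩ (by ext; simp)
  rw [← Finset.sum_add_sum_compl S, sum_S, sum_compl] at sum_univ
  linarith [Real.pi_pos]

end Flower

/-! ### Lorentz boosts of `ℝ^{2,1}` -/

/-- The Euclidean inner product of the plane. -/
def dot (x y : ℂ) : ℝ := x.re * y.re + x.im * y.im

/-- The spatial part of the boost, of velocity direction `n`, of the vector `(X, T)`. -/
noncomputable def boostX (n X : ℂ) (T : ℝ) : ℂ :=
  X + (dot X n / (1 + √(1 + Complex.normSq n)) - T) • n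

/-- The time part of the boost of `(X, T)`. -/
noncomputable def boostT (n X : ℂ) (T : ℝ) : ℝ := √(1 + Complex.normSq n) * T - dot X n

theorem sq_sqrt_one_add_normSq (n : ℂ) :
    √(1 + Complex.normSq n) ^ 2 = 1 + (n.re * n.re + n.im * n.im) := by
  rw [Real.sq_sqrt (by have := Complex.normSq_nonneg n; linarith), Complex.normSq_apply]

theorem dot_boostX (n X Y : ℂ) (S T : ℝ) :
    dot (boostX n X S) (boostX n Y T) = boostT n X S * boostT n Y T + (dot X Y - S * T) := by
  have hm := sq_sqrt_one_add_normSq n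
  have hm_nonneg : 0 ≤ √(1 + Complex.normSq n) := Real.sqrt_nonneg _
  unfold boostX boostT
  generalize √(1 + Complex.normSq n) = m at *
  obtain ⟨x, hx⟩ : ∃ x, x = dot X n / (1 + m) := ⟨_, rfl⟩
  obtain ⟨y, hy⟩ : ∃ y, y = dot Y n / (1 + m) := ⟨_, rfl⟩
  have hx' : dot X n = x * (1 + m) := by rw [hx]; field_simp
  have hy' : dot Y n = y * (1 + m) := by rw [hy]; field_simp
  rw [← hx, ← hy, hx', hy']
  simp only [dot, Complex.add_re, Complex.add_im, Complex.real_smul, Complex.mul_re,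
    Complex.mul_im, Complex.ofReal_re, Complex.ofReal_im, zero_mul, sub_zero, add_zero] at *
  linear_combination (y - T) * hx' + (x - S) * hy' - (x - S) * (y - T) * hm

theorem cross_boostX (n X Y : ℂ) (S T : ℝ) : cross (boostX n X S) (boostX n Y T) =
    √(1 + Complex.normSq n) * cross X Y - T * cross X n + S * cross Y n := by
  have hm := sq_sqrt_one_add_normSq n
  have hm_nonneg : 0 ≤ √(1 + Complex.normSq n) := Real.sqrt_nonneg _
  unfold boostX
  generalize √(1 + Complex.normSq n) = m at *
  simp only [dot, cross, Complex.add_re, Complex.add_im, Complex.real_smul, Complex.mul_re,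
    Complex.mul_im, Complex.ofReal_re, Complex.ofReal_im, zero_mul, sub_zero, add_zero] at *
  field_simp
  linear_combination -(1 + m) * (X.re * Y.im - X.im * Y.re) * hm

theorem boostX_zero (X : ℂ) (T : ℝ) : boostX 0 X T = X := by
  simp [boostX]

theorem continuous_boostX_smul (n X : ℂ) (T : ℝ) :
    Continuous fun τ : ℝ => boostX (τ • n) X T := by
  have hsqrt : Continuous fun τ : ℝ => √(1 + Complex.normSq (τ • n)) :=
    (continuous_const.add (Complex.continuous_normSq.comp (by fun_prop))).sqrt
  have hdot : Continuous fun τ : ℝ => dot X (τ • n) := by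
    simp only [dot, Complex.real_smul, Complex.mul_re, Complex.mul_im, Complex.ofReal_re,
      Complex.ofReal_im]
    fun_prop
  have hne : ∀ τ : ℝ, 1 + √(1 + Complex.normSq (τ • n)) ≠ 0 := fun τ => by positivity
  exact continuous_const.add
    (((hdot.div (continuous_const.add hsqrt) hne).sub continuous_const).smul (by fun_prop))

theorem dot_self (x : ℂ) : dot x x = Complex.normSq x := (Complex.normSq_apply x).symm

/-- Two vectors `(X, S)` and `(Y, T)` of `ℝ^{2,1}` describing two neighbors of a given disk: `p` and
`q` are their inversive products with that disk and `c` is their inversive product with each other,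
so that the component of `(X, S, p)` and of `(Y, T, q)` in `ℝ^{3,1}` along the given disk has been
split off. -/
structure IsConfig (p q c : ℝ) (X : ℂ) (S : ℝ) (Y : ℂ) (T : ℝ) : Prop where
  left_mem : p ∈ Icc (0 : ℝ) 1
  right_mem : q ∈ Icc (0 : ℝ) 1
  nonneg : 0 ≤ c
  left_ne : S ≠ 0 ∨ X ≠ 0
  right_ne : T ≠ 0 ∨ Y ≠ 0
  dot_left : dot X X = S * S + (1 - p * p)
  dot_right : dot Y Y = T * T + (1 - q * q)
  dot_eq : dot X Y = S * T - (p * q + c)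

theorem boost_ne (n : ℂ) {X : ℂ} {S : ℝ} (h : S ≠ 0 ∨ X ≠ 0) :
    boostT n X S ≠ 0 ∨ boostX n X S ≠ 0 := by
  by_contra! ⟨hT, hX⟩
  have orthogonal : ∀ Y T, dot X Y - S * T = 0 := fun Y T => by
    have := dot_boostX n X Y S T
    rw [hT, hX] at this
    simpa [dot] using this.symm
  have hS0 : S = 0 := by simpa [dot] using orthogonal 0 1
  have hX0 : X = 0 := by
    have := orthogonal X S
    rwa [hS0, zero_mul, sub_zero, dot_self, Complex.normSq_eq_zero] at this
  tauto

theorem exists_pos_smul_of_neg_div_notMem_slitPlane {x y : ℂ} (hx : x ≠ 0) (hy : y ≠ 0)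
    (h : -(y / x) ∉ Complex.slitPlane) : ∃ r : ℝ, 0 < r ∧ y = r • x := by
  simp only [Complex.mem_slitPlane_iff, Complex.neg_re, Complex.neg_im, neg_pos, not_or, not_lt,
    neg_eq_zero, not_not] at h
  obtain ⟨hre, him⟩ := h
  have hyx : y = (y / x).re • x := by
    rw [Complex.real_smul, ← div_eq_iff hx]
    exact Complex.ext rfl him
  refine ⟨_, hre.lt_of_ne fun h0 => hy ?_, hyx⟩
  rw [hyx, ← h0, zero_smul]

namespace IsConfig

variable {p q c : ℝ} {X Y : ℂ} {S T : ℝ}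

theorem boost (h : IsConfig p q c X S Y T) (n : ℂ) :
    IsConfig p q c (boostX n X S) (boostT n X S) (boostX n Y T) (boostT n Y T) where
  left_mem := h.left_mem
  right_mem := h.right_mem
  nonneg := h.nonneg
  left_ne := boost_ne n h.left_ne
  right_ne := boost_ne n h.right_ne
  dot_left := by rw [dot_boostX, h.dot_left]; ring
  dot_right := by rw [dot_boostX, h.dot_right]; ring
  dot_eq := by rw [dot_boostX, h.dot_eq]; ring

theorem left_ne_zero (h : IsConfig p q c X S Y T) : X ≠ 0 := by
  rintro rfl
  have hS : 0 < S * S := mul_self_pos.2 (h.left_ne.resolve_right (not_not.2 rfl))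
  have hdot : 0 = S * S + (1 - p * p) := by simpa [dot] using h.dot_left
  nlinarith [h.left_mem.1, h.left_mem.2]

theorem symm (h : IsConfig p q c X S Y T) : IsConfig q p c Y T X S where
  left_mem := h.right_mem
  right_mem := h.left_mem
  nonneg := h.nonneg
  left_ne := h.right_ne
  right_ne := h.left_ne
  dot_left := h.dot_right
  dot_right := h.dot_left
  dot_eq := by
    have := h.dot_eq
    simp only [dot] at *
    linarith

theorem right_ne_zero (h : IsConfig p q c X S Y T) : Y ≠ 0 := h.symm.left_ne_zero

theorem right_ne_smul (h : IsConfig p q c X S Y T) {r : ℝ} (hr : 0 < r) : Y ≠ r • X := by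
  intro hY
  obtain ⟨p0, p1⟩ := h.left_mem
  obtain ⟨q0, q1⟩ := h.right_mem
  have dot_left := h.dot_left
  have dot_eq : r * dot X X = S * T - (p * q + c) := by
    rw [← h.dot_eq, hY]; simp [dot]; ring
  have dot_right : r ^ 2 * dot X X = T * T + (1 - q * q) := by
    rw [← h.dot_right, hY]; simp [dot]; ring
  have sum_eq_zero :
      (r * S - T) ^ 2 + r ^ 2 * (1 - p * p) + (1 - q * q) + 2 * r * (p * q + c) = 0 := by
    linear_combination 2 * r * dot_eq - r ^ 2 * dot_left - dot_right
  have hp : 0 ≤ r ^ 2 * (1 - p * p) := mul_nonneg (sq_nonneg r) (by nlinarith)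
  have hq : 0 ≤ 1 - q * q := by nlinarith
  have hpqc : 0 ≤ 2 * r * (p * q + c) :=
    mul_nonneg (by positivity) (add_nonneg (mul_nonneg p0 q0) h.nonneg)
  have hsq := sq_nonneg (r * S - T)
  have hp1 : 1 - p * p = 0 :=
    (mul_eq_zero.1 (by linarith : r ^ 2 * (1 - p * p) = 0)).resolve_left (by positivity)
  have hq1 : 1 - q * q = 0 := by linarith
  have hpqc0 : p * q + c = 0 :=
    (mul_eq_zero.1 (by linarith : 2 * r * (p * q + c) = 0)).resolve_left (by positivity)
  nlinarith [h.nonneg, hq1]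

theorem neg_div_mem_slitPlane (h : IsConfig p q c X S Y T) : -(Y / X) ∈ Complex.slitPlane := by
  by_contra hcon
  obtain ⟨r, hr, hY⟩ := exists_pos_smul_of_neg_div_notMem_slitPlane h.left_ne_zero h.right_ne_zero
    hcon
  exact h.right_ne_smul hr hY

end IsConfig

/-! ### Total angles -/

/-- The angle in `(0, 2π]` from the direction of `x` to that of `y`. -/
noncomputable def turn (x y : ℂ) : ℝ := Real.pi + (-(y / x)).arg

theorem turn_of_im_pos {x y : ℂ} (h : 0 < (y / x).im) : turn x y = (y / x).arg := by
  rw [turn, Complex.arg_neg_eq_arg_sub_pi_of_im_pos h]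
  ring

theorem abs_arg_le_turn (x y : ℂ) : |(y / x).arg| ≤ turn x y := by
  have hlt := Complex.neg_pi_lt_arg (y / x)
  have hle := Complex.arg_le_pi (y / x)
  rcases lt_trichotomy (y / x).im 0 with him | him | him
  · rw [turn, Complex.arg_neg_eq_arg_add_pi_of_im_neg him, abs_le]
    constructor <;> linarith
  · rcases le_or_gt 0 (y / x).re with hre | hre
    · rw [Complex.arg_eq_zero_iff.2 ⟨hre, him⟩, abs_zero, turn]
      linarith [Complex.neg_pi_lt_arg (-(y / x))]
    · have harg : (-(y / x)).arg = 0 :=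
        Complex.arg_eq_zero_iff.2 ⟨by simpa using hre.le, by simpa using him⟩
      rw [turn, harg, Complex.arg_eq_pi_iff.2 ⟨hre, him⟩, abs_of_pos Real.pi_pos, add_zero]
  · rw [turn_of_im_pos him, abs_of_nonneg (Complex.arg_nonneg_iff.2 him.le)]

theorem exp_turn_mul_I {x y : ℂ} (hx : x ≠ 0) (hy : y ≠ 0) :
    Complex.exp (turn x y * Complex.I) = (y / ‖y‖) / (x / ‖x‖) := by
  have hpolar := Complex.norm_mul_exp_arg_mul_I (-(y / x))
  have hx' : (‖x‖ : ℂ) ≠ 0 := by simpa using hx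
  have hy' : (‖y‖ : ℂ) ≠ 0 := by simpa using hy
  rw [norm_neg, norm_div, Complex.ofReal_div] at hpolar
  rw [turn, Complex.ofReal_add, add_mul, Complex.exp_add, Complex.exp_pi_mul_I]
  field_simp at hpolar ⊢
  linear_combination -hpolar

theorem exp_sum_turn_mul_I {N : Type*} [Fintype N] (σ : Equiv.Perm N) {x : N → ℂ}
    (hx : ∀ a, x a ≠ 0) : Complex.exp ((∑ a, turn (x a) (x (σ a)) : ℝ) * Complex.I) = 1 := by
  rw [Complex.ofReal_sum, Finset.sum_mul, Complex.exp_sum,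
    Finset.prod_congr rfl fun a _ => exp_turn_mul_I (hx a) (hx (σ a)), Finset.prod_div_distrib,
    Equiv.prod_comp σ fun a => x a / (‖x a‖ : ℂ), div_self]
  exact Finset.prod_ne_zero_iff.2 fun a _ => div_ne_zero (hx a) (by simpa using hx a)

theorem sum_turn_eq_of_homotopy {N : Type*} [Fintype N] (σ : Equiv.Perm N) (X : N → ℝ → ℂ)
    (hX : ∀ a, Continuous (X a)) (hne : ∀ a τ, X a τ ≠ 0)
    (hs : ∀ a τ, -(X (σ a) τ / X a τ) ∈ Complex.slitPlane) (s t : ℝ) :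
    ∑ a, turn (X a s) (X (σ a) s) = ∑ a, turn (X a t) (X (σ a) t) := by
  have harg : ∀ a, Continuous fun τ => (-(X (σ a) τ / X a τ)).arg := fun a =>
    continuous_iff_continuousAt.2 fun τ => (Complex.continuousAt_arg (hs a τ)).comp
      (f := fun τ => -(X (σ a) τ / X a τ))
      (((hX (σ a)).continuousAt.div (hX a).continuousAt (hne a τ)).neg)
  have hcont : Continuous fun τ : ℝ =>
      ((∑ a, turn (X a τ) (X (σ a) τ) : ℝ) : ℂ) * Complex.I :=
    (Complex.continuous_ofReal.comp (continuous_finsetSum _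
      fun a _ => continuous_const.add (harg a))).mul continuous_const
  have hexp := fun τ => exp_sum_turn_mul_I σ fun a => hne a τ
  have heq := Complex.isCoveringMap_exp.const_of_comp hcont
    (fun τ υ => Subtype.ext ((hexp τ).trans (hexp υ).symm)) s t
  exact_mod_cast mul_right_cancel₀ Complex.I_ne_zero heq

/-! ### Minkowski space -/

/-- The Minkowski form of `ℝ^{2,1}`, positive on timelike vectors. -/
noncomputable def mink : LinearMap.BilinForm ℝ (Fin 3 → ℝ) :=
  LinearMap.mk₂ ℝ (fun X Y => X 2 * Y 2 - X 0 * Y 0 - X 1 * Y 1)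
    (fun X X' Y => by simp only [Pi.add_apply]; ring)
    (fun r X Y => by simp only [Pi.smul_apply, smul_eq_mul]; ring)
    (fun X Y Y' => by simp only [Pi.add_apply]; ring)
    (fun r X Y => by simp only [Pi.smul_apply, smul_eq_mul]; ring)

theorem mink_apply (X Y : Fin 3 → ℝ) : mink X Y = X 2 * Y 2 - X 0 * Y 0 - X 1 * Y 1 := rfl

/-- The signed volume spanned by three vectors of `ℝ^{2,1}`. -/
noncomputable def vol (X Y Z : Fin 3 → ℝ) : ℝ := (Pi.basisFun ℝ (Fin 3)).det ![X, Y, Z]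

theorem vol_apply (X Y Z : Fin 3 → ℝ) : vol X Y Z =
    X 0 * Y 1 * Z 2 - X 0 * Y 2 * Z 1 - X 1 * Y 0 * Z 2 + X 1 * Y 2 * Z 0 + X 2 * Y 0 * Z 1 -
      X 2 * Y 1 * Z 0 := by
  rw [vol, Pi.basisFun_det]
  exact Matrix.det_fin_three ![X, Y, Z]

theorem vol_swap (X Y Z : Fin 3 → ℝ) : vol X Z Y = -vol X Y Z := by
  simp only [vol_apply]
  ring

theorem vol_map (L : (Fin 3 → ℝ) →ₗ[ℝ] Fin 3 → ℝ) (X Y Z : Fin 3 → ℝ) :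
    vol (L X) (L Y) (L Z) = LinearMap.det L * vol X Y Z := by
  rw [vol, vol, ← Module.Basis.det_comp]
  congr 1
  ext i
  fin_cases i <;> rfl

theorem vol_sq (X Y Z : Fin 3 → ℝ) : vol X Y Z ^ 2 = mink X X * mink Y Y * mink Z Z +
    2 * mink X Y * mink X Z * mink Y Z - mink X X * mink Y Z ^ 2 - mink Y Y * mink X Z ^ 2 -
    mink Z Z * mink X Y ^ 2 := by
  simp only [vol_apply, mink_apply]
  ring

/-! ### Hyperbolic data of disks -/

theorem sqrt_sq_sub_one_pos {k : ℝ} (hk : 1 < k) : 0 < √(k ^ 2 - 1) :=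
  Real.sqrt_pos.2 (sub_pos.2 (one_lt_pow₀ hk two_ne_zero))

namespace ClosedDisk

/-- The image of a disk under the homothety of factor `r` fixing the origin. -/
noncomputable def scale (r : ℝ) (hr : 0 < r) (D : ClosedDisk) : ClosedDisk :=
  ⟨r • D.center, r * D.radius, mul_pos hr D.radius_pos⟩

/-- The geodesic curvature of the boundary circle of a disk, in the hyperbolic metric of the unit
disk. It is larger than `1` exactly when the disk lies in the open unit disk. -/
noncomputable def curv (D : ClosedDisk) : ℝ :=
  (1 + D.radius ^ 2 - Complex.normSq D.center) / (2 * D.radius)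

/-- The vector of Minkowski space that represents a disk; for a disk in the unit disk it is a
positive multiple of the hyperbolic center. -/
noncomputable def vec (D : ClosedDisk) : Fin 3 → ℝ :=
  ![D.center.re / D.radius, D.center.im / D.radius,
    (1 + Complex.normSq D.center - D.radius ^ 2) / (2 * D.radius)]

/-- The spatial part of the vector of `ℝ^{2,1}` that represents `A`, as seen from `D`. -/
noncomputable def relX (D A : ClosedDisk) : ℂ := (1 / A.radius) • (A.center - D.center)

/-- The time part of the vector of `ℝ^{2,1}` that represents `A`, as seen from `D`. -/
noncomputable def relT (D A : ClosedDisk) : ℝ := D.radius / A.radius + invProd D A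

/-- The velocity of the boost moving the hyperbolic center of `D` to the origin. -/
noncomputable def boostVec (D : ClosedDisk) : ℂ := (1 / √(D.curv ^ 2 - 1)) • D.center

theorem norm_center_scale_add_radius (r : ℝ) (hr : 0 < r) (D : ClosedDisk) :
    ‖(D.scale r hr).center‖ + (D.scale r hr).radius = r * (‖D.center‖ + D.radius) := by
  rw [scale, norm_smul, Real.norm_of_nonneg hr.le, mul_add]

theorem invProd_scale (r : ℝ) (hr : 0 < r) (A B : ClosedDisk) :
    invProd (A.scale r hr) (B.scale r hr) = invProd A B := by
  have hA := A.radius_pos.ne'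
  have hB := B.radius_pos.ne'
  simp only [invProd, scale]
  rw [← smul_sub, Complex.real_smul, map_mul, Complex.normSq_ofReal]
  field_simp

theorem norm_add_radius_lt_one {D : ClosedDisk} (h : D.carrier ⊆ Metric.ball 0 1) :
    ‖D.center‖ + D.radius < 1 := by
  have hD := D.radius_pos
  rcases eq_or_ne D.center 0 with h0 | h0
  · have hmem : (D.radius : ℂ) ∈ D.carrier := by
      simp [carrier, h0, abs_of_pos hD]
    simpa [h0, abs_of_pos hD] using h hmem
  · have hn : 0 < ‖D.center‖ := norm_pos_iff.2 h0
    have hmem : (1 + D.radius / ‖D.center‖) • D.center ∈ D.carrier := by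
      rw [carrier, Metric.mem_closedBall, dist_eq_norm, add_smul, one_smul, add_sub_cancel_left,
        norm_smul, Real.norm_of_nonneg (by positivity), div_mul_cancel₀ _ hn.ne']
    have hlt := h hmem
    rwa [mem_ball_zero_iff, norm_smul, Real.norm_of_nonneg (by positivity), add_mul,
      div_mul_cancel₀ _ hn.ne', one_mul] at hlt

theorem one_lt_curv {D : ClosedDisk} (h : ‖D.center‖ + D.radius < 1) : 1 < D.curv := by
  have hD := D.radius_pos
  rw [curv, lt_div_iff₀ (by positivity), Complex.normSq_eq_norm_sq]
  nlinarith [norm_nonneg D.center]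

theorem mink_vec (D E : ClosedDisk) : mink D.vec E.vec = invProd D E + D.curv * E.curv := by
  have hD := D.radius_pos.ne'
  have hE := E.radius_pos.ne'
  simp only [mink_apply, vec, Matrix.cons_val, curv, invProd, Complex.normSq_apply,
    Complex.sub_re, Complex.sub_im]
  field_simp
  ring

theorem mink_vec_self (D : ClosedDisk) : mink D.vec D.vec = D.curv ^ 2 - 1 := by
  have hD := D.radius_pos.ne'
  simp only [mink_apply, vec, Matrix.cons_val, curv, Complex.normSq_apply]
  field_simp
  ring

theorem dot_relX (D A B : ClosedDisk) : dot (relX D A) (relX D B) =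
    relT D A * relT D B - (invProd D A * invProd D B + invProd A B) := by
  have hA := A.radius_pos.ne'
  have hB := B.radius_pos.ne'
  have hD := D.radius_pos.ne'
  simp only [dot, relX, relT, invProd, Complex.real_smul, Complex.mul_re, Complex.mul_im,
    Complex.ofReal_re, Complex.ofReal_im, Complex.normSq_apply, Complex.sub_re, Complex.sub_im,
    zero_mul, sub_zero, add_zero]
  field_simp
  ring

theorem invProd_self (A : ClosedDisk) : invProd A A = -1 := by
  have hA := A.radius_pos.ne'
  rw [invProd, sub_self, map_zero]
  field_simp
  ring

theorem relT_pos {D A : ClosedDisk} (h : 0 ≤ invProd D A) : 0 < relT D A :=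
  add_pos_of_pos_of_nonneg (div_pos D.radius_pos A.radius_pos) h

theorem isConfig {D A B : ClosedDisk} (hA : invProd D A ∈ Icc (0 : ℝ) 1)
    (hB : invProd D B ∈ Icc (0 : ℝ) 1) (hAB : 0 ≤ invProd A B) :
    IsConfig (invProd D A) (invProd D B) (invProd A B) (relX D A) (relT D A) (relX D B)
      (relT D B) where
  left_mem := hA
  right_mem := hB
  nonneg := hAB
  left_ne := .inl (relT_pos hA.1).ne'
  right_ne := .inl (relT_pos hB.1).ne'
  dot_left := by rw [dot_relX, invProd_self]; ring
  dot_right := by rw [dot_relX, invProd_self]; ring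
  dot_eq := dot_relX D A B

theorem sqrt_boostVec {D : ClosedDisk} (h : ‖D.center‖ + D.radius < 1) :
    √(1 + Complex.normSq (boostVec D)) =
      (1 - D.radius ^ 2 - Complex.normSq D.center) / (2 * D.radius * √(D.curv ^ 2 - 1)) := by
  have hd := D.radius_pos
  have hs := sqrt_sq_sub_one_pos (one_lt_curv h)
  have hsq := Real.sq_sqrt (Real.sqrt_pos.1 hs).le
  have hn : 0 ≤ 1 - D.radius ^ 2 - Complex.normSq D.center := by
    rw [Complex.normSq_eq_norm_sq]
    nlinarith [norm_nonneg D.center]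
  rw [Real.sqrt_eq_iff_mul_self_eq (add_nonneg zero_le_one (Complex.normSq_nonneg _))
    (by positivity), boostVec, Complex.real_smul, map_mul, Complex.normSq_ofReal]
  generalize √(D.curv ^ 2 - 1) = w at *
  have hc : D.curv * (2 * D.radius) = 1 + D.radius ^ 2 - Complex.normSq D.center := by
    rw [curv]
    field_simp
  field_simp
  rw [hsq]
  linear_combination (D.curv * (2 * D.radius) + 1 + D.radius ^ 2 - Complex.normSq D.center) * hc

theorem boostT_rel {D : ClosedDisk} (h : ‖D.center‖ + D.radius < 1) (A : ClosedDisk) :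
    boostT (boostVec D) (relX D A) (relT D A) =
      (A.curv + D.curv * invProd D A) / √(D.curv ^ 2 - 1) := by
  have hd := D.radius_pos.ne'
  have ha := A.radius_pos.ne'
  have hs := (sqrt_sq_sub_one_pos (one_lt_curv h)).ne'
  rw [boostT, sqrt_boostVec h, boostVec]
  generalize √(D.curv ^ 2 - 1) = w at *
  simp only [dot, relX, relT, invProd, curv, Complex.real_smul, Complex.mul_re, Complex.mul_im,
    Complex.ofReal_re, Complex.ofReal_im, Complex.normSq_apply, Complex.sub_re, Complex.sub_im,
    zero_mul, sub_zero, add_zero]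
  field_simp
  ring

theorem cross_boostX_rel {D : ClosedDisk} (h : ‖D.center‖ + D.radius < 1) (A B : ClosedDisk) :
    cross (boostX (boostVec D) (relX D A) (relT D A)) (boostX (boostVec D) (relX D B) (relT D B)) =
      vol D.vec A.vec B.vec / √(D.curv ^ 2 - 1) := by
  have hd := D.radius_pos.ne'
  have ha := A.radius_pos.ne'
  have hb := B.radius_pos.ne'
  have hs := (sqrt_sq_sub_one_pos (one_lt_curv h)).ne'
  rw [cross_boostX, sqrt_boostVec h, boostVec]
  generalize √(D.curv ^ 2 - 1) = w at *
  simp only [cross, vol_apply, vec, Matrix.cons_val, relX, relT, invProd, Complex.real_smul,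
    Complex.mul_re, Complex.mul_im, Complex.ofReal_re, Complex.ofReal_im, Complex.normSq_apply,
    Complex.sub_re, Complex.sub_im, zero_mul, sub_zero, add_zero]
  field_simp
  ring

theorem vol_vec_sq (A B C : ClosedDisk) : vol A.vec B.vec C.vec ^ 2 =
    (1 - invProd B C ^ 2) * A.curv ^ 2 + (1 - invProd A C ^ 2) * B.curv ^ 2 +
      (1 - invProd A B ^ 2) * C.curv ^ 2 +
      2 * (invProd A B + invProd A C * invProd B C) * (A.curv * B.curv) +
      2 * (invProd A C + invProd A B * invProd B C) * (A.curv * C.curv) +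
      2 * (invProd B C + invProd A B * invProd A C) * (B.curv * C.curv) +
      (invProd A B ^ 2 + invProd A C ^ 2 + invProd B C ^ 2 +
        2 * invProd A B * invProd A C * invProd B C - 1) := by
  rw [vol_sq, mink_vec_self, mink_vec_self, mink_vec_self, mink_vec, mink_vec, mink_vec]
  ring

theorem vol_vec_ne_zero {A B C : ClosedDisk} (hA : 1 < A.curv) (hB : 1 < B.curv) (hC : 1 < C.curv)
    (hAB : invProd A B ∈ Icc (0 : ℝ) 1) (hAC : invProd A C ∈ Icc (0 : ℝ) 1)
    (hBC : invProd B C ∈ Icc (0 : ℝ) 1) : vol A.vec B.vec C.vec ≠ 0 := by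
  have hsq := vol_vec_sq A B C
  obtain ⟨p0, p1⟩ := hAB
  obtain ⟨q0, q1⟩ := hAC
  obtain ⟨r0, r1⟩ := hBC
  generalize invProd A B = p at *
  generalize invProd A C = q at *
  generalize invProd B C = r at *
  have le_mul_sq : ∀ u k : ℝ, 0 ≤ u → u ≤ 1 → 1 < k → 1 - u ^ 2 ≤ (1 - u ^ 2) * k ^ 2 :=
    fun u k hu hu1 hk =>
      le_mul_of_one_le_right (sub_nonneg.2 (pow_le_one₀ hu hu1)) (one_le_pow₀ hk.le)
  have hA2 := le_mul_sq r _ r0 r1 hA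
  have hB2 := le_mul_sq q _ q0 q1 hB
  have hC2 := le_mul_sq p _ p0 p1 hC
  have hABnn : 0 ≤ 2 * (p + q * r) * (A.curv * B.curv) := by positivity
  have hACnn : 0 ≤ 2 * (q + p * r) * (A.curv * C.curv) := by positivity
  have hBCnn : 0 ≤ 2 * (r + p * q) * (B.curv * C.curv) := by positivity
  have hpqr : 0 ≤ 2 * p * q * r := by positivity
  exact pow_ne_zero_iff two_ne_zero |>.1 (by linarith : 0 < vol A.vec B.vec C.vec ^ 2).ne'

theorem vol_vec_scale (r : ℝ) (hr : 0 < r) (A B C : ClosedDisk) :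
    2 * A.radius * B.radius * C.radius * r *
        vol (A.scale r hr).vec (B.scale r hr).vec (C.scale r hr).vec =
      (1 - r ^ 2) * cross (B.center - A.center) (C.center - A.center) +
        r ^ 2 * (2 * A.radius * B.radius * C.radius * vol A.vec B.vec C.vec) := by
  have hA := A.radius_pos.ne'
  have hB := B.radius_pos.ne'
  have hC := C.radius_pos.ne'
  simp only [vol_apply, vec, Matrix.cons_val, scale, cross, Complex.real_smul, Complex.mul_re,
    Complex.mul_im, Complex.ofReal_re, Complex.ofReal_im, Complex.normSq_apply, Complex.sub_re,
    Complex.sub_im, zero_mul, sub_zero, add_zero]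
  field_simp
  ring

/-- Shrinking the disks towards the origin deforms the triangle of hyperbolic centers into the
triangle of Euclidean centers, and by `vol_vec_ne_zero` it never degenerates on the way. -/
theorem vol_vec_pos {A B C : ClosedDisk} (hA : ‖A.center‖ + A.radius < 1)
    (hB : ‖B.center‖ + B.radius < 1) (hC : ‖C.center‖ + C.radius < 1)
    (hAB : invProd A B ∈ Icc (0 : ℝ) 1) (hAC : invProd A C ∈ Icc (0 : ℝ) 1)
    (hBC : invProd B C ∈ Icc (0 : ℝ) 1)
    (h : 0 < cross (B.center - A.center) (C.center - A.center)) :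
    0 < vol A.vec B.vec C.vec := by
  have hpos : 0 < 2 * A.radius * B.radius * C.radius := by
    have := A.radius_pos
    have := B.radius_pos
    have := C.radius_pos
    positivity
  have curv_scale : ∀ r : ℝ, ∀ hr : 0 < r, r ≤ 1 → ∀ D : ClosedDisk, ‖D.center‖ + D.radius < 1 →
      1 < (D.scale r hr).curv := fun r hr hr1 D hD => one_lt_curv <| by
    rw [norm_center_scale_add_radius]
    exact mul_lt_one_of_nonneg_of_lt_one_right hr1 (add_nonneg (norm_nonneg _) D.radius_pos.le) hD
  have hne : ∀ r : ℝ, 0 < r → r ≤ 1 →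
      (1 - r ^ 2) * cross (B.center - A.center) (C.center - A.center) +
        r ^ 2 * (2 * A.radius * B.radius * C.radius * vol A.vec B.vec C.vec) ≠ 0 := by
    intro r hr hr1
    rw [← vol_vec_scale r hr]
    refine mul_ne_zero (mul_pos hpos hr).ne' (vol_vec_ne_zero (curv_scale r hr hr1 A hA)
      (curv_scale r hr hr1 B hB) (curv_scale r hr hr1 C hC) ?_ ?_ ?_)
    all_goals rwa [invProd_scale]
  by_contra! hcon
  have hcon' := mul_nonpos_of_nonneg_of_nonpos hpos.le hcon
  generalize 2 * A.radius * B.radius * C.radius * vol A.vec B.vec C.vec = v at *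
  generalize cross (B.center - A.center) (C.center - A.center) = d at *
  have hdv : 0 < d - v := by linarith
  refine hne √(d / (d - v)) (Real.sqrt_pos.2 (by positivity))
    (Real.sqrt_le_one.2 ((div_le_one hdv).2 (by linarith))) ?_
  rw [Real.sq_sqrt (by positivity)]
  field_simp
  ring

end ClosedDisk

/-! ### Comparison of angles -/

theorem abs_arg_div_comm (x y : ℂ) : |(y / x).arg| = |(x / y).arg| := by
  rw [← Complex.abs_arg_inv, inv_div]

namespace IsConfig

variable {p q c : ℝ} {X Y : ℂ} {S T : ℝ}

theorem cos_arg (h : IsConfig p q c X S Y T) : Real.cos |(Y / X).arg| =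
    (S * T - (p * q + c)) / (√(S * S + (1 - p * p)) * √(T * T + (1 - q * q))) := by
  have hX := h.left_ne_zero
  have hY := h.right_ne_zero
  rw [Real.cos_abs, Complex.cos_arg (div_ne_zero hY hX), ← h.dot_left, ← h.dot_right, ← h.dot_eq,
    dot_self, dot_self, norm_div, Complex.div_re, Complex.normSq_eq_norm_sq,
    Complex.normSq_eq_norm_sq, Real.sqrt_sq (norm_nonneg _), Real.sqrt_sq (norm_nonneg _), dot]
  have h1 := norm_ne_zero_iff.2 hX
  have h2 := norm_ne_zero_iff.2 hY
  field_simp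

theorem left_pos (h : IsConfig p q c X S Y T) : 0 < S * S + (1 - p * p) := by
  rw [← h.dot_left, dot_self]
  exact Complex.normSq_pos.2 h.left_ne_zero

end IsConfig

theorem abs_div_sqrt_lt {y z P : ℝ} (hP : 0 < P) (hyz : |y| < z) :
    |y| / √(y * y + P) < z / √(z * z + P) := by
  have hz : 0 < z := (abs_nonneg y).trans_lt hyz
  have hlt : y * y < z * z := by
    rw [← abs_mul_abs_self y]
    exact mul_self_lt_mul_self (abs_nonneg y) hyz
  have hy : 0 < y * y + P := add_pos_of_nonneg_of_pos (mul_self_nonneg y) hP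
  rw [div_lt_div_iff₀ (Real.sqrt_pos.2 hy) (Real.sqrt_pos.2 (by positivity))]
  refine lt_of_pow_lt_pow_left₀ 2 (by positivity) ?_
  rw [mul_pow, mul_pow, Real.sq_sqrt (by positivity), Real.sq_sqrt hy.le, sq_abs]
  linear_combination P * hlt

theorem abs_div_sqrt_le {y z P : ℝ} (hP : 0 ≤ P) (hyz : |y| < z) :
    |y| / √(y * y + P) ≤ z / √(z * z + P) := by
  rcases hP.eq_or_lt with rfl | hP
  · have hz : 0 < z := (abs_nonneg y).trans_lt hyz
    rw [add_zero, add_zero, Real.sqrt_mul_self_eq_abs, Real.sqrt_mul_self hz.le, div_self hz.ne']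
    exact div_self_le_one _
  · exact (abs_div_sqrt_lt hP hyz).le

section

variable {S S' T T' P Q : ℝ}

theorem div_sqrt_mul_div_sqrt_le_abs :
    S / √(S * S + P) * (T / √(T * T + Q)) ≤ |S| / √(S * S + P) * (|T| / √(T * T + Q)) := by
  refine (le_abs_self _).trans_eq ?_
  rw [abs_mul, abs_div, abs_div, abs_of_nonneg (Real.sqrt_nonneg _),
    abs_of_nonneg (Real.sqrt_nonneg _)]

theorem div_sqrt_mul_div_sqrt_le (hP : 0 ≤ P) (hQ : 0 ≤ Q) (hS : |S| < S') (hT : |T| < T') :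
    S / √(S * S + P) * (T / √(T * T + Q)) ≤ S' / √(S' * S' + P) * (T' / √(T' * T' + Q)) :=
  div_sqrt_mul_div_sqrt_le_abs.trans <| mul_le_mul (abs_div_sqrt_le hP hS) (abs_div_sqrt_le hQ hT)
    (by positivity) (div_nonneg ((abs_nonneg S).trans hS.le) (Real.sqrt_nonneg _))

theorem div_sqrt_mul_div_sqrt_lt (hP : 0 < P) (hQ : 0 ≤ Q) (hS : |S| < S') (hT : |T| < T') :
    S / √(S * S + P) * (T / √(T * T + Q)) < S' / √(S' * S' + P) * (T' / √(T' * T' + Q)) := by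
  have hT' : 0 < T' := (abs_nonneg T).trans_lt hT
  calc S / √(S * S + P) * (T / √(T * T + Q))
      ≤ |S| / √(S * S + P) * (|T| / √(T * T + Q)) := div_sqrt_mul_div_sqrt_le_abs
    _ ≤ |S| / √(S * S + P) * (T' / √(T' * T' + Q)) :=
        mul_le_mul_of_nonneg_left (abs_div_sqrt_le hQ hT) (by positivity)
    _ < S' / √(S' * S' + P) * (T' / √(T' * T' + Q)) :=
        mul_lt_mul_of_pos_right (abs_div_sqrt_lt hP hS) (by positivity)

end

theorem sqrt_mul_self_add_lt {y z P : ℝ} (hy : 0 < y * y + P) (hyz : |y| < z) :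
    √(y * y + P) < √(z * z + P) := by
  refine Real.sqrt_lt_sqrt hy.le (add_lt_add_left ?_ _)
  rw [← abs_mul_abs_self y]
  exact mul_self_lt_mul_self (abs_nonneg y) hyz

theorem IsConfig.arg_lt {p q c : ℝ} {X Y X' Y' : ℂ} {S T S' T' : ℝ} (h : IsConfig p q c X S Y T)
    (h' : IsConfig p q c X' S' Y' T') (hS : |S| < S') (hT : |T| < T') :
    |(Y' / X').arg| < |(Y / X).arg| := by
  have arg_mem : ∀ z : ℂ, |z.arg| ∈ Icc 0 Real.pi := fun z =>
    ⟨abs_nonneg _, Complex.abs_arg_le_pi z⟩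
  obtain ⟨hp, hp1⟩ := h.left_mem
  obtain ⟨hq, hq1⟩ := h.right_mem
  have hP : 0 ≤ 1 - p * p := sub_nonneg.2 (mul_le_one₀ hp1 hp hp1)
  have hQ : 0 ≤ 1 - q * q := sub_nonneg.2 (mul_le_one₀ hq1 hq hq1)
  rw [← Real.strictAntiOn_cos.lt_iff_gt (arg_mem _) (arg_mem _), h.cos_arg, h'.cos_arg, sub_div,
    sub_div, mul_div_mul_comm, mul_div_mul_comm]
  rcases (add_nonneg (mul_nonneg hp hq) h.nonneg).lt_or_eq with he | he
  · have hu := Real.sqrt_pos.2 h.left_pos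
    have hw := Real.sqrt_pos.2 h.symm.left_pos
    have hden := mul_lt_mul'' (sqrt_mul_self_add_lt h.left_pos hS)
      (sqrt_mul_self_add_lt h.symm.left_pos hT) hu.le hw.le
    linarith [div_sqrt_mul_div_sqrt_le hP hQ hS hT,
      div_lt_div_of_pos_left he (mul_pos hu hw) hden]
  · have hpq : p * q = 0 := by linarith [mul_nonneg hp hq, h.nonneg]
    rw [← he, zero_div, zero_div, sub_zero, sub_zero]
    rcases mul_eq_zero.1 hpq with rfl | rfl
    · exact div_sqrt_mul_div_sqrt_lt (by norm_num) hQ hS hT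
    · rw [mul_comm (S / _), mul_comm (S' / _)]
      exact div_sqrt_mul_div_sqrt_lt (by norm_num) hP hT hS

/-! ### Angles around a vertex -/

section Flower

variable {V : Type*} [DecidableEq V] {G : SimpleGraph V} {F : Set (Finset V)} {z : V → ℂ} {v : V}
  {σ : Equiv.Perm (Nbr G v)}

theorem IsFlower.adj (hF : IsTriangulation G F) (hσ : IsFlower F z v σ) (a : Nbr G v) :
    G.Adj a.1 (σ a).1 := by
  refine hF.adj _ (hσ.face a) a.1 (by simp) (σ a).1 (by simp) fun e => ?_
  have := hσ.pos a
  rw [← e] at this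
  simp only [cross] at this
  linarith

theorem IsFlower.apply_apply_ne (hσ : IsFlower F z v σ) (a : Nbr G v) : σ (σ a) ≠ a := by
  intro e
  have hpos := hσ.pos a
  have hpos_next := hσ.pos (σ a)
  rw [e, cross_swap] at hpos_next
  linarith

/-- Both sides add up `g` over the two neighbors that span a face with `v` and `a`. -/
theorem IsFlower.add_symm_eq {z' : V → ℂ} {σ' : Equiv.Perm (Nbr G v)}
    (hF : IsTriangulation G F) (hσ : IsFlower F z v σ) (hσ' : IsFlower F z' v σ')
    (g : Nbr G v → ℝ) (a : Nbr G v) : g (σ a) + g (σ.symm a) = g (σ' a) + g (σ'.symm a) := by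
  have eq_or_eq : ∀ b, a ≠ b → {v, a.1, b.1} ∈ F → b = σ a ∨ b = σ.symm a := fun b hb h =>
    (hσ.eq_or_eq a b hb h).imp_right fun h => by rw [h, Equiv.symm_apply_apply]
  have ne_next : a ≠ σ' a := fun e => (hσ'.adj hF a).ne (congrArg Subtype.val e)
  have ne_prev : a ≠ σ'.symm a := fun e => ne_next (by
    conv_lhs => rw [← σ'.apply_symm_apply a, ← e])
  have next_ne_prev : σ' a ≠ σ'.symm a := fun e => hσ'.apply_apply_ne a (by
    rw [e, Equiv.apply_symm_apply])
  have face_prev : {v, a.1, (σ'.symm a).1} ∈ F := by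
    have := hσ'.face (σ'.symm a)
    rwa [Equiv.apply_symm_apply, Finset.pair_comm] at this
  rcases eq_or_eq _ ne_next (hσ'.face a) with hnext | hnext <;>
    rcases eq_or_eq _ ne_prev face_prev with hprev | hprev
  · exact absurd (hnext.trans hprev.symm) next_ne_prev
  · rw [hnext, hprev]
  · rw [hnext, hprev, add_comm]
  · exact absurd (hnext.trans hprev.symm) next_ne_prev

theorem IsFlower.sum_symm_eq [Fintype (Nbr G v)] {z' : V → ℂ} {σ' : Equiv.Perm (Nbr G v)}
    (hF : IsTriangulation G F) (hσ : IsFlower F z v σ) (hσ' : IsFlower F z' v σ')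
    {f : Nbr G v → Nbr G v → ℝ} (hf : ∀ a b, f a b = f b a) :
    ∑ a, f a (σ a) = ∑ a, f a (σ' a) := by
  have two_mul_sum : ∀ τ : Equiv.Perm (Nbr G v), 2 * ∑ a, f a (τ a) =
      ∑ a, (f a (τ a) + f a (τ.symm a)) := by
    intro τ
    rw [Finset.sum_add_distrib, two_mul]
    congr 1
    rw [← Equiv.sum_comp τ fun a => f a (τ.symm a)]
    exact Finset.sum_congr rfl fun a _ => by rw [Equiv.symm_apply_apply, hf]
  refine mul_left_cancel₀ (two_ne_zero' ℝ) ?_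
  rw [two_mul_sum, two_mul_sum]
  exact Finset.sum_congr rfl fun a _ => hσ.add_symm_eq hF hσ' (f a) a

end Flower

theorem IsTriangulation.nonempty_nbr {V : Type*} {G : SimpleGraph V} {F : Set (Finset V)}
    (hF : IsTriangulation G F) (v : V) : Nonempty (Nbr G v) := by
  have := hF.infinite
  obtain ⟨x, hx⟩ := exists_ne v
  obtain ⟨p⟩ := hF.connected v x
  cases p with
  | nil => exact absurd rfl hx
  | cons h _ => exact ⟨_, h⟩

theorem ClosedDisk.relX_div_relX {D A : ClosedDisk} (h : A.center ≠ D.center) (B : ClosedDisk) :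
    D.relX B / D.relX A = ((A.radius / B.radius : ℝ) : ℂ) *
      ((B.center - D.center) / (A.center - D.center)) := by
  have hA : (A.radius : ℂ) ≠ 0 := Complex.ofReal_ne_zero.2 A.radius_pos.ne'
  have hB : (B.radius : ℂ) ≠ 0 := Complex.ofReal_ne_zero.2 B.radius_pos.ne'
  have hDA : A.center - D.center ≠ 0 := sub_ne_zero.2 h
  simp only [ClosedDisk.relX, Complex.real_smul]
  push_cast
  field_simp

theorem IsPacking.invProd_mem {V : Type*} {G : SimpleGraph V} {F : Set (Finset V)}
    {P : V → ClosedDisk} (hP : IsPacking G F P) {u v : V} (h : G.Adj u v) :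
    invProd (P u) (P v) ∈ Icc (0 : ℝ) 1 :=
  ⟨hP.invProd_nonneg u v h.ne, hP.invProd_le_one u v h⟩

section Packing

variable {V : Type*} [DecidableEq V] {G : SimpleGraph V} {F : Set (Finset V)} {P : V → ClosedDisk}
  {v : V} {σ : Equiv.Perm (Nbr G v)}

theorem IsPacking.isConfig (hF : IsTriangulation G F) (hP : IsPacking G F P)
    (hσ : IsFlower F (fun v => (P v).center) v σ) (a : Nbr G v) :
    IsConfig (invProd (P v) (P a)) (invProd (P v) (P (σ a))) (invProd (P a) (P (σ a)))
      ((P v).relX (P a)) ((P v).relT (P a)) ((P v).relX (P (σ a))) ((P v).relT (P (σ a))) :=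
  ClosedDisk.isConfig (hP.invProd_mem a.2) (hP.invProd_mem (σ a).2)
    (hP.invProd_mem (hσ.adj hF a)).1

/-- Boosting by `τ • n` with `τ` going from `1` to `0` deforms the directions of the neighbors into
their Euclidean directions, and the total turn cannot change on the way. -/
theorem IsPacking.sum_turn [Fintype (Nbr G v)] (hF : IsTriangulation G F) (hP : IsPacking G F P)
    (hσ : IsFlower F (fun v => (P v).center) v σ) (n : ℂ) :
    ∑ a : Nbr G v, turn (boostX n ((P v).relX (P a)) ((P v).relT (P a)))
      (boostX n ((P v).relX (P (σ a))) ((P v).relT (P (σ a)))) = 2 * Real.pi := by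
  have homotopy := sum_turn_eq_of_homotopy σ
    (fun (a : Nbr G v) (τ : ℝ) => boostX (τ • n) ((P v).relX (P a)) ((P v).relT (P a)))
    (fun a => continuous_boostX_smul n _ _)
    (fun a τ => ((hP.isConfig hF hσ a).boost (τ • n)).left_ne_zero)
    (fun a τ => ((hP.isConfig hF hσ a).boost (τ • n)).neg_div_mem_slitPlane) 1 0
  simp only [one_smul, zero_smul, boostX_zero] at homotopy
  have := hF.nonempty_nbr v
  rw [homotopy, ← hσ.sum_arg hP.drawing Finset.univ_nonempty (by ext; simp)]
  refine Finset.sum_congr rfl fun a _ => ?_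
  have hdiv := ClosedDisk.relX_div_relX (hP.drawing.injective.ne a.2.ne') (P (σ a))
  have hpos : 0 < (P a).radius / (P (σ a)).radius := div_pos (P a).radius_pos (P (σ a)).radius_pos
  rw [turn_of_im_pos, hdiv, Complex.arg_real_mul _ hpos]
  rw [hdiv, Complex.im_ofReal_mul]
  exact mul_pos hpos (hσ.im_div_pos a)

/-- The angle at the hyperbolic center of `D` between the hyperbolic centers of `A` and `B`. -/
noncomputable def ClosedDisk.hypAngle (D A B : ClosedDisk) : ℝ :=
  |(boostX D.boostVec (D.relX B) (D.relT B) / boostX D.boostVec (D.relX A) (D.relT A)).arg|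

theorem ClosedDisk.hypAngle_comm (D A B : ClosedDisk) : D.hypAngle A B = D.hypAngle B A :=
  abs_arg_div_comm _ _

theorem IsPacking.sum_hypAngle_le [Fintype (Nbr G v)] (hF : IsTriangulation G F)
    (hP : IsPacking G F P) (hσ : IsFlower F (fun v => (P v).center) v σ) :
    ∑ a : Nbr G v, (P v).hypAngle (P a) (P (σ a)) ≤ 2 * Real.pi := by
  rw [← hP.sum_turn hF hσ (P v).boostVec]
  exact Finset.sum_le_sum fun a _ => abs_arg_le_turn _ _

theorem IsPacking.vol_pos (hF : IsTriangulation G F) (hP : IsPacking G F P)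
    (hin : ∀ v, ‖(P v).center‖ + (P v).radius < 1)
    (hσ : IsFlower F (fun v => (P v).center) v σ) (a : Nbr G v) :
    0 < vol (P v).vec (P a).vec (P (σ a)).vec :=
  ClosedDisk.vol_vec_pos (hin _) (hin _) (hin _) (hP.invProd_mem a.2) (hP.invProd_mem (σ a).2)
    (hP.invProd_mem (hσ.adj hF a)) (hσ.pos a)

theorem IsPacking.sum_hypAngle_eq [Fintype (Nbr G v)] (hF : IsTriangulation G F)
    (hP : IsPacking G F P) (hin : ∀ v, ‖(P v).center‖ + (P v).radius < 1)
    (hσ : IsFlower F (fun v => (P v).center) v σ) :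
    ∑ a : Nbr G v, (P v).hypAngle (P a) (P (σ a)) = 2 * Real.pi := by
  rw [← hP.sum_turn hF hσ (P v).boostVec]
  refine Finset.sum_congr rfl fun a _ => ?_
  have him : 0 < (boostX (P v).boostVec ((P v).relX (P (σ a))) ((P v).relT (P (σ a))) /
      boostX (P v).boostVec ((P v).relX (P a)) ((P v).relT (P a))).im := by
    refine im_div_pos_of_cross_pos ?_
    rw [ClosedDisk.cross_boostX_rel (hin v)]
    exact div_pos (hP.vol_pos hF hin hσ a) (sqrt_sq_sub_one_pos (ClosedDisk.one_lt_curv (hin v)))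
  rw [turn_of_im_pos him, ClosedDisk.hypAngle, abs_of_nonneg (Complex.arg_nonneg_iff.2 him.le)]

end Packing

section Comparison

variable {V : Type*} {G : SimpleGraph V} {F : Set (Finset V)} {P P' : V → ClosedDisk}

/-- If the neighbors were closer in `P` than in `P'`, the angles around `v` would be larger in `P`
and add up to more than `2 * π`. -/
theorem IsPacking.not_forall_boostT_lt (hF : IsTriangulation G F)
    (hP : IsPacking G F P) (hP' : IsPacking G F P')
    (hinv : ∀ u v, G.Adj u v → invProd (P u) (P v) = invProd (P' u) (P' v))
    (hin : ∀ v, ‖(P' v).center‖ + (P' v).radius < 1) (v : V) :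
    ¬ ∀ a : Nbr G v, |boostT (P v).boostVec ((P v).relX (P a)) ((P v).relT (P a))| <
      boostT (P' v).boostVec ((P' v).relX (P' a)) ((P' v).relT (P' a)) := by
  classical
  intro hlt
  have : Fintype (Nbr G v) := (hF.finite_nbrs v).fintype
  have := hF.nonempty_nbr v
  obtain ⟨σ, hσ⟩ := hP.drawing.exists_isFlower hF v
  obtain ⟨σ', hσ'⟩ := hP'.drawing.exists_isFlower hF v
  have sum_lt : ∑ a : Nbr G v, (P' v).hypAngle (P' a) (P' (σ a)) <
      ∑ a : Nbr G v, (P v).hypAngle (P a) (P (σ a)) := by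
    refine Finset.sum_lt_sum_of_nonempty Finset.univ_nonempty fun a _ => ?_
    have hconf := (hP.isConfig hF hσ a).boost (P v).boostVec
    have hconf' := (ClosedDisk.isConfig (hP'.invProd_mem a.2) (hP'.invProd_mem (σ a).2)
      (hP'.invProd_mem (hσ.adj hF a)).1).boost (P' v).boostVec
    rw [← hinv _ _ a.2, ← hinv _ _ (σ a).2, ← hinv _ _ (hσ.adj hF a)] at hconf'
    exact hconf.arg_lt hconf' (hlt a) (hlt (σ a))
  rw [hσ.sum_symm_eq hF hσ' (f := fun a b => (P' v).hypAngle (P' a) (P' b))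
    fun a b => ClosedDisk.hypAngle_comm _ _ _, hP'.sum_hypAngle_eq hF hin hσ'] at sum_lt
  exact sum_lt.not_ge (hP.sum_hypAngle_le hF hσ)

/-! ### Comparison of curvatures -/

theorem ClosedDisk.abs_curv_le_one {D A : ClosedDisk} (hD : ‖D.center‖ + D.radius < 1)
    (hA : 1 ≤ ‖A.center‖ + A.radius) (h : invProd D A ∈ Icc (0 : ℝ) 1) : |A.curv| ≤ 1 := by
  have hd := D.radius_pos
  have ha := A.radius_pos
  have hdist := normSq_center_sub D A
  rw [Complex.normSq_eq_norm_sq] at hdist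
  have radius_le : A.radius ≤ ‖D.center - A.center‖ := by
    refine le_of_sq_le_sq ?_ (norm_nonneg _)
    have : 0 ≤ 2 * D.radius * A.radius * invProd D A := mul_nonneg (by positivity) h.1
    linarith [sq_nonneg D.radius]
  have dist_le : ‖D.center - A.center‖ ≤ D.radius + A.radius := by
    refine le_of_sq_le_sq ?_ (by positivity)
    have : 2 * D.radius * A.radius * invProd D A ≤ 2 * D.radius * A.radius :=
      mul_le_of_le_one_right (by positivity) h.2
    linarith
  have norm_le : ‖A.center‖ ≤ 1 + A.radius := by
    linarith [norm_sub_norm_le A.center D.center, norm_sub_rev A.center D.center]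
  have le_norm : |1 - A.radius| ≤ ‖A.center‖ := by
    rw [abs_le]
    constructor <;> linarith [norm_sub_le D.center A.center]
  rw [curv, Complex.normSq_eq_norm_sq, abs_div, abs_of_pos (by positivity : 0 < 2 * A.radius),
    div_le_one (by positivity), abs_le]
  have := pow_le_pow_left₀ (norm_nonneg _) norm_le 2
  have := pow_le_pow_left₀ (abs_nonneg _) le_norm 2
  rw [sq_abs] at this
  constructor <;> linarith

/-- The maximum principle: the ratio `m` cannot be smaller at all the neighbors of `u`. -/
theorem IsPacking.exists_nbr_mul_curv_le (hF : IsTriangulation G F) (hP : IsPacking G F P)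
    (hP' : IsPacking G F P')
    (hinv : ∀ u v, G.Adj u v → invProd (P u) (P v) = invProd (P' u) (P' v))
    (hin : ∀ v, ‖(P' v).center‖ + (P' v).radius < 1) {u : V}
    (hu : ‖(P u).center‖ + (P u).radius < 1) {m : ℝ} (hm : 1 ≤ m)
    (hmu : (P u).curv ^ 2 - 1 = m ^ 2 * ((P' u).curv ^ 2 - 1)) :
    ∃ a : Nbr G u, m * (P' a).curv ≤ |(P a).curv| := by
  by_contra! hlt
  refine hP.not_forall_boostT_lt hF hP' hinv hin u fun a => ?_
  have hk := ClosedDisk.one_lt_curv hu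
  have hm0 : 0 ≤ m := zero_le_one.trans hm
  have curv_le_mul : (P u).curv ≤ m * (P' u).curv := by
    refine le_of_sq_le_sq ?_
      (mul_nonneg hm0 (zero_le_one.trans (ClosedDisk.one_lt_curv (hin u)).le))
    linarith [one_le_pow₀ hm (n := 2)]
  have hw := sqrt_sq_sub_one_pos hk
  have hw' := sqrt_sq_sub_one_pos (ClosedDisk.one_lt_curv (hin u))
  have sqrt_eq : √((P u).curv ^ 2 - 1) = m * √((P' u).curv ^ 2 - 1) := by
    rw [hmu, Real.sqrt_mul (sq_nonneg m), Real.sqrt_sq hm0]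
  have hp := (hP.invProd_mem a.2).1
  rw [ClosedDisk.boostT_rel hu, ClosedDisk.boostT_rel (hin u), abs_div, abs_of_pos hw,
    div_lt_div_iff₀ hw hw', sqrt_eq, ← hinv u a a.2]
  calc |(P a).curv + (P u).curv * invProd (P u) (P a)| * √((P' u).curv ^ 2 - 1)
      ≤ (|(P a).curv| + (P u).curv * invProd (P u) (P a)) * √((P' u).curv ^ 2 - 1) := by
        refine mul_le_mul_of_nonneg_right ((abs_add_le _ _).trans_eq ?_) hw'.le
        rw [abs_of_nonneg (mul_nonneg (zero_le_one.trans hk.le) hp)]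
    _ < (m * (P' a).curv + m * (P' u).curv * invProd (P u) (P a)) * √((P' u).curv ^ 2 - 1) :=
        mul_lt_mul_of_pos_right
          (add_lt_add_of_lt_of_le (hlt a) (mul_le_mul_of_nonneg_right curv_le_mul hp)) hw'
    _ = ((P' a).curv + (P' u).curv * invProd (P u) (P a)) * (m * √((P' u).curv ^ 2 - 1)) := by
        ring

theorem IsPacking.curv_le (hF : IsTriangulation G F) (hP : IsPacking G F P)
    (hP' : IsPacking G F P')
    (hinv : ∀ u v, G.Adj u v → invProd (P u) (P v) = invProd (P' u) (P' v))
    (hin : ∀ v, ‖(P' v).center‖ + (P' v).radius < 1)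
    (hfin : {v | ‖(P v).center‖ + (P v).radius < 1}.Finite) {v : V}
    (hv : ‖(P v).center‖ + (P v).radius < 1) : (P v).curv ≤ (P' v).curv := by
  by_contra! hcon
  have hk' : ∀ w, 1 < (P' w).curv := fun w => ClosedDisk.one_lt_curv (hin w)
  have sub_pos' : ∀ w, 0 < (P' w).curv ^ 2 - 1 := fun w =>
    sub_pos.2 (one_lt_pow₀ (hk' w) two_ne_zero)
  let ratio : V → ℝ := fun w => ((P w).curv ^ 2 - 1) / ((P' w).curv ^ 2 - 1)
  obtain ⟨u, hu, hmax⟩ := exists_max_image _ ratio hfin ⟨v, hv⟩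
  have one_lt_ratio : 1 < ratio u := by
    refine lt_of_lt_of_le ?_ (hmax v hv)
    rw [one_lt_div (sub_pos' v)]
    gcongr
    linarith [hk' v]
  have hm := Real.lt_sqrt_of_sq_lt (by rwa [one_pow] : 1 ^ 2 < ratio u)
  have hsq := Real.sq_sqrt (zero_le_one.trans one_lt_ratio.le)
  generalize √(ratio u) = m at *
  obtain ⟨a, ha⟩ := hP.exists_nbr_mul_curv_le hF hP' hinv hin hu hm.le
    (by rw [hsq, div_mul_cancel₀ _ (sub_pos' u).ne'])
  by_cases ha_in : ‖(P a).center‖ + (P a).radius < 1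
  · have hle := hmax a.1 ha_in
    rw [← hsq, div_le_iff₀ (sub_pos' a)] at hle
    have := pow_le_pow_left₀ (mul_pos (zero_lt_one.trans hm) (zero_lt_one.trans (hk' a))).le ha 2
    rw [sq_abs, mul_pow] at this
    linarith [one_lt_pow₀ hm two_ne_zero]
  · have := ClosedDisk.abs_curv_le_one hu (not_lt.1 ha_in) (hP.invProd_mem a.2)
    linarith [one_lt_mul_of_lt_of_le hm (hk' a).le]

theorem IsDrawing.smul {z : V → ℂ} (h : IsDrawing G F z) {r : ℝ} (hr : r ≠ 0) :
    IsDrawing G F fun v => r • z v := by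
  have inj : Function.Injective (r • · : ℂ → ℂ) := smul_right_injective ℂ hr
  have segment_smul : ∀ p q : ℂ, segment ℝ (r • p) (r • q) = (r • · : ℂ → ℂ) '' segment ℝ p q :=
    fun p q => (image_segment ℝ (LinearMap.lsmul ℝ ℂ r).toAffineMap p q).symm
  refine ⟨h.card, inj.comp h.injective, h.adj, fun a b d hab hda hdb => ?_,
    fun a b c d hab hcd hac had hbc hbd => ?_, h.avoid, fun T hT => ?_⟩
  · rw [segment_smul, inj.mem_set_image]
    exact h.notMem_segment a b d hab hda hdb
  · rw [segment_smul, segment_smul, disjoint_image_iff inj]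
    exact h.disjoint_segment a b c d hab hcd hac had hbc hbd
  · obtain ⟨x, hx, hxT⟩ := h.outside T hT
    refine ⟨x, hx, ?_⟩
    rintro ⟨w, hw, hw1, hwx⟩
    simp only [smul_comm _ r, ← Finset.smul_sum] at hwx
    exact hxT ⟨w, hw, hw1, inj hwx⟩

theorem IsPacking.scale (hP : IsPacking G F P) {r : ℝ} (hr : 0 < r) :
    IsPacking G F fun v => (P v).scale r hr where
  invProd_nonneg u v h := by
    rw [ClosedDisk.invProd_scale]
    exact hP.invProd_nonneg u v h
  invProd_le_one u v h := by
    rw [ClosedDisk.invProd_scale]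
    exact hP.invProd_le_one u v h
  drawing := hP.drawing.smul hr.ne'

theorem IsLocallyFiniteIn.finite_scale (hP : IsLocallyFiniteIn P (Metric.ball 0 1)) {r : ℝ}
    (hr : 0 < r) (hr1 : 1 < r) :
    {v | ‖((P v).scale r hr).center‖ + ((P v).scale r hr).radius < 1}.Finite := by
  refine (hP.2 (Metric.closedBall 0 (1 / r)) (Metric.closedBall_subset_ball
    ((div_lt_one hr).2 hr1)) (isCompact_closedBall _ _)).subset fun u hu => ?_
  refine ⟨(P u).center, Metric.mem_closedBall_self (P u).radius_pos.le, ?_⟩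
  rw [mem_ofPred_eq, ClosedDisk.norm_center_scale_add_radius, mul_add] at hu
  rw [mem_closedBall_zero_iff, le_div_iff₀' hr]
  linarith [mul_pos hr (P u).radius_pos]

namespace ClosedDisk

theorem curv_scale (r : ℝ) (hr : 0 < r) (D : ClosedDisk) : (D.scale r hr).curv =
    (1 + r ^ 2 * (D.radius ^ 2 - Complex.normSq D.center)) / (2 * r * D.radius) := by
  rw [curv, scale, Complex.real_smul, map_mul, Complex.normSq_ofReal]
  ring

theorem curv_le_of_curv_scale_le {D : ClosedDisk} (hD : ‖D.center‖ + D.radius < 1) {k : ℝ}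
    (h : ∀ r hr, 1 < r → ‖(D.scale r hr).center‖ + (D.scale r hr).radius < 1 →
      (D.scale r hr).curv ≤ k) : D.curv ≤ k := by
  have hd := D.radius_pos
  have tendsto_curv : Filter.Tendsto (fun r : ℝ =>
      (1 + r ^ 2 * (D.radius ^ 2 - Complex.normSq D.center)) / (2 * r * D.radius))
      (nhdsWithin 1 (Ioi 1)) (nhds D.curv) := by
    have hcont : ContinuousAt (fun r : ℝ =>
        (1 + r ^ 2 * (D.radius ^ 2 - Complex.normSq D.center)) / (2 * r * D.radius)) 1 :=
      ContinuousAt.div (by fun_prop) (by fun_prop) (by positivity)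
    convert hcont.tendsto.mono_left (nhdsWithin_le_nhds (s := Ioi 1)) using 2
    rw [curv]
    ring
  have eventually_lt : ∀ᶠ r : ℝ in nhds 1, r * (‖D.center‖ + D.radius) < 1 :=
    (continuous_id.mul continuous_const).continuousAt.eventually_lt continuousAt_const
      (by simpa using hD)
  refine le_of_tendsto tendsto_curv ?_
  filter_upwards [self_mem_nhdsWithin, nhdsWithin_le_nhds eventually_lt] with r hr1 hrD
  have hr : 0 < r := zero_lt_one.trans hr1
  rw [← curv_scale r hr]
  exact h r hr hr1 (by rwa [norm_center_scale_add_radius])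

end ClosedDisk

/-- Enlarging `P` by a factor `r > 1` leaves only finitely many of its disks in the unit disk, so
that `IsPacking.curv_le` applies; then `r` tends to `1`. -/
theorem IsPacking.curv_le_of_locallyFinite (hF : IsTriangulation G F) (hP : IsPacking G F P)
    (hP' : IsPacking G F P')
    (hinv : ∀ u v, G.Adj u v → invProd (P u) (P v) = invProd (P' u) (P' v))
    (hfin : IsLocallyFiniteIn P (Metric.ball 0 1))
    (hin : ∀ v, ‖(P' v).center‖ + (P' v).radius < 1) (v : V) : (P v).curv ≤ (P' v).curv :=
  ClosedDisk.curv_le_of_curv_scale_le (ClosedDisk.norm_add_radius_lt_one (hfin.1 v))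
    fun r hr hr1 hv => (hP.scale hr).curv_le hF hP'
      (fun u w h => (ClosedDisk.invProd_scale r hr _ _).trans (hinv u w h)) hin
      (hfin.finite_scale hr hr1) hv

end Comparison

/-! ### Isometries of Minkowski space -/

theorem eq_zero_of_mink_of_vol {X Y N : Fin 3 → ℝ}
    (h : mink X X * mink Y Y - mink X Y ^ 2 ≠ 0) (hX : mink X N = 0) (hY : mink Y N = 0)
    (hv : vol X Y N = 0) : N = 0 := by
  have hmul : ∀ i, (mink X X * mink Y Y - mink X Y ^ 2) * N i = 0 := by
    simp only [mink_apply, vol_apply] at *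
    intro i
    fin_cases i
    · simp only [Fin.zero_eta]
      linear_combination (-Y 1 * (X 0 * Y 1 - X 1 * Y 0) - Y 2 * (X 2 * Y 0 - X 0 * Y 2)) * hX -
        (-X 1 * (X 0 * Y 1 - X 1 * Y 0) - X 2 * (X 2 * Y 0 - X 0 * Y 2)) * hY -
        (X 1 * Y 2 - X 2 * Y 1) * hv
    · simp only [Fin.mk_one]
      linear_combination (Y 2 * (X 1 * Y 2 - X 2 * Y 1) + Y 0 * (X 0 * Y 1 - X 1 * Y 0)) * hX -
        (X 2 * (X 1 * Y 2 - X 2 * Y 1) + X 0 * (X 0 * Y 1 - X 1 * Y 0)) * hY -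
        (X 2 * Y 0 - X 0 * Y 2) * hv
    · simp only [Fin.reduceFinMk]
      linear_combination (Y 1 * (X 1 * Y 2 - X 2 * Y 1) - Y 0 * (X 2 * Y 0 - X 0 * Y 2)) * hX -
        (X 1 * (X 1 * Y 2 - X 2 * Y 1) - X 0 * (X 2 * Y 0 - X 0 * Y 2)) * hY +
        (X 0 * Y 1 - X 1 * Y 0) * hv
  ext i
  exact (mul_eq_zero.1 (hmul i)).resolve_left h

theorem eq_of_mink_of_vol {X Y Z U : Fin 3 → ℝ} (h : mink X X * mink Y Y - mink X Y ^ 2 ≠ 0)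
    (hX : mink X U = mink X Z) (hY : mink Y U = mink Y Z) (hZ : mink U U = mink Z Z)
    (hv : 0 < vol X Y U * vol X Y Z) : U = Z := by
  have hsq : vol X Y U ^ 2 = vol X Y Z ^ 2 := by rw [vol_sq, vol_sq, hX, hY, hZ]
  have hvol : vol X Y U = vol X Y Z := by
    rcases sq_eq_sq_iff_eq_or_eq_neg.1 hsq with e | e
    · exact e
    · rw [e] at hv
      nlinarith [sq_nonneg (vol X Y Z)]
  refine sub_eq_zero.1 (eq_zero_of_mink_of_vol h (by rw [map_sub, hX, sub_self])
    (by rw [map_sub, hY, sub_self]) ?_)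
  simp only [vol_apply, Pi.sub_apply] at hvol ⊢
  linear_combination hvol

theorem exists_basis_of_vol_ne_zero {X : Fin 3 → Fin 3 → ℝ} (hX : vol (X 0) (X 1) (X 2) ≠ 0) :
    ∃ b : Module.Basis (Fin 3) ℝ (Fin 3 → ℝ), ∀ i, b i = X i := by
  have eta : ![X 0, X 1, X 2] = X := by ext i; fin_cases i <;> rfl
  rw [vol, eta] at hX
  obtain ⟨hli, hspan⟩ := (Module.Basis.is_basis_iff_det (Pi.basisFun ℝ (Fin 3))).2
    (isUnit_iff_ne_zero.2 hX)
  exact ⟨Module.Basis.mk hli hspan.ge, fun i => Module.Basis.mk_apply hli hspan.ge i⟩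

theorem exists_linearEquiv_of_mink_eq {X Y : Fin 3 → Fin 3 → ℝ} (hX : vol (X 0) (X 1) (X 2) ≠ 0)
    (hY : vol (Y 0) (Y 1) (Y 2) ≠ 0) (h : ∀ i j, mink (X i) (X j) = mink (Y i) (Y j)) :
    ∃ L : (Fin 3 → ℝ) ≃ₗ[ℝ] Fin 3 → ℝ, (∀ i, L (X i) = Y i) ∧
      ∀ u v, mink (L u) (L v) = mink u v := by
  obtain ⟨b, hb⟩ := exists_basis_of_vol_ne_zero hX
  obtain ⟨b', hb'⟩ := exists_basis_of_vol_ne_zero hY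
  let L := b.equiv b' (Equiv.refl _)
  have hL : ∀ i, L (b i) = b' i := fun i => by simp [L]
  have comp_eq : LinearMap.BilinForm.comp mink L.toLinearMap L.toLinearMap = mink := by
    refine LinearMap.BilinForm.ext_basis b fun i j => ?_
    rw [LinearMap.BilinForm.comp_apply, LinearEquiv.coe_coe, hL, hL, hb', hb', hb, hb, h]
  exact ⟨L, fun i => by rw [← hb, ← hb', hL], fun u v => LinearMap.congr_fun₂ comp_eq u v⟩

/-! ### The hyperboloid model -/

/-- The point of the hyperboloid that corresponds to a point of the unit disk. -/
noncomputable def lift (z : ℂ) : Fin 3 → ℝ :=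
  ![2 * z.re / (1 - Complex.normSq z), 2 * z.im / (1 - Complex.normSq z),
    (1 + Complex.normSq z) / (1 - Complex.normSq z)]

/-- The stereographic projection of the hyperboloid to the unit disk. -/
noncomputable def proj (X : Fin 3 → ℝ) : ℂ := ⟨X 0 / (1 + X 2), X 1 / (1 + X 2)⟩

theorem one_sub_normSq_pos {z : ℂ} (hz : z ∈ Metric.ball (0 : ℂ) 1) :
    0 < 1 - Complex.normSq z := by
  rw [mem_ball_zero_iff] at hz
  rw [Complex.normSq_eq_norm_sq]
  nlinarith [norm_nonneg z]

theorem proj_lift {z : ℂ} (hz : z ∈ Metric.ball (0 : ℂ) 1) : proj (lift z) = z := by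
  have h := (one_sub_normSq_pos hz).ne'
  have hden : 1 + (1 + Complex.normSq z) / (1 - Complex.normSq z) =
      2 / (1 - Complex.normSq z) := by
    field_simp
    ring
  apply Complex.ext
  · simp only [proj, lift, Matrix.cons_val, hden]
    field_simp
  · simp only [proj, lift, Matrix.cons_val, hden]
    field_simp

theorem mink_lift_self {z : ℂ} (hz : z ∈ Metric.ball (0 : ℂ) 1) : mink (lift z) (lift z) = 1 := by
  have h := (one_sub_normSq_pos hz).ne'
  have hn := Complex.normSq_apply z
  simp only [mink_apply, lift, Matrix.cons_val]
  generalize Complex.normSq z = n at *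
  field_simp
  linear_combination 4 * hn

theorem lift_time_pos {z : ℂ} (hz : z ∈ Metric.ball (0 : ℂ) 1) : 0 < lift z 2 := by
  have h := one_sub_normSq_pos hz
  have := Complex.normSq_nonneg z
  simp only [lift, Matrix.cons_val]
  positivity

theorem one_sub_normSq_proj {X : Fin 3 → ℝ} (h : mink X X = 1) (hX : 0 < X 2) :
    1 - Complex.normSq (proj X) = 2 / (1 + X 2) := by
  have hden : 1 + X 2 ≠ 0 := by positivity
  rw [mink_apply] at h
  simp only [proj, Complex.normSq_apply]
  field_simp
  linear_combination h

theorem proj_mem_ball {X : Fin 3 → ℝ} (h : mink X X = 1) (hX : 0 < X 2) :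
    proj X ∈ Metric.ball (0 : ℂ) 1 := by
  have hpos : 0 < 1 - Complex.normSq (proj X) := by
    rw [one_sub_normSq_proj h hX]
    positivity
  rwa [mem_ball_zero_iff, ← sq_lt_one_iff₀ (norm_nonneg _), ← Complex.normSq_eq_norm_sq, ← sub_pos]

theorem lift_proj {X : Fin 3 → ℝ} (h : mink X X = 1) (hX : 0 < X 2) : lift (proj X) = X := by
  have hden : 1 + X 2 ≠ 0 := by positivity
  have hsub := one_sub_normSq_proj h hX
  have hadd : 1 + Complex.normSq (proj X) = 2 - 2 / (1 + X 2) := by rw [← hsub]; ring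
  ext i
  fin_cases i
  · simp only [lift, Fin.zero_eta, Matrix.cons_val, hsub]
    simp only [proj]
    field_simp
  · simp only [lift, Fin.mk_one, Matrix.cons_val, hsub]
    simp only [proj]
    field_simp
  · simp only [lift, Fin.reduceFinMk, Matrix.cons_val, hsub, hadd]
    field_simp
    ring

theorem hypDist_eq {z w : ℂ} (hz : z ∈ Metric.ball (0 : ℂ) 1) (hw : w ∈ Metric.ball (0 : ℂ) 1) :
    hypDist z w = 2 * Real.arsinh √((mink (lift z) (lift w) - 1) / 2) := by
  have hz_pos := one_sub_normSq_pos hz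
  have hw_pos := one_sub_normSq_pos hw
  have hratio : (mink (lift z) (lift w) - 1) / 2 =
      ‖z - w‖ ^ 2 / ((1 - ‖z‖ ^ 2) * (1 - ‖w‖ ^ 2)) := by
    rw [← Complex.normSq_eq_norm_sq, ← Complex.normSq_eq_norm_sq, ← Complex.normSq_eq_norm_sq]
    simp only [mink_apply, lift, Matrix.cons_val]
    have hz_pos := hz_pos.ne'
    have hw_pos := hw_pos.ne'
    have hn := Complex.normSq_apply z
    have hm := Complex.normSq_apply w
    rw [Complex.normSq_apply (z - w), Complex.sub_re, Complex.sub_im]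
    generalize Complex.normSq z = n at *
    generalize Complex.normSq w = m at *
    field_simp
    linear_combination 2 * hn + 2 * hm
  rw [hratio, Real.sqrt_div (sq_nonneg _), Real.sqrt_sq (norm_nonneg _), hypDist]

theorem mink_pos_of_time_pos {X Y : Fin 3 → ℝ} (hX : 0 < mink X X) (hY : 0 < mink Y Y)
    (hX2 : 0 < X 2) (hY2 : 0 < Y 2) : 0 < mink X Y := by
  simp only [mink_apply] at *
  have cauchy_schwarz :
      (X 0 * Y 0 + X 1 * Y 1) ^ 2 ≤ (X 0 ^ 2 + X 1 ^ 2) * (Y 0 ^ 2 + Y 1 ^ 2) := by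
    linarith [sq_nonneg (X 0 * Y 1 - X 1 * Y 0)]
  have timelike : (X 0 ^ 2 + X 1 ^ 2) * (Y 0 ^ 2 + Y 1 ^ 2) < X 2 ^ 2 * Y 2 ^ 2 :=
    mul_lt_mul'' (by linarith) (by linarith) (by positivity) (by positivity)
  have hlt : X 0 * Y 0 + X 1 * Y 1 < X 2 * Y 2 := by
    refine lt_of_pow_lt_pow_left₀ 2 (by positivity) ?_
    rw [mul_pow]
    exact cauchy_schwarz.trans_lt timelike
  linarith

theorem time_pos_of_mink_pos {X Y : Fin 3 → ℝ} (hX : 0 < mink X X) (hY : 0 < mink Y Y)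
    (hY2 : 0 < Y 2) (h : 0 < mink X Y) : 0 < X 2 := by
  by_contra! hcon
  have hne : X 2 ≠ 0 := by
    intro h0
    rw [mink_apply, h0] at hX
    linarith [mul_self_nonneg (X 0), mul_self_nonneg (X 1)]
  have hneg := mink_pos_of_time_pos (X := -X) (by simpa using hX) hY
    (by simpa using lt_of_le_of_ne hcon hne) hY2
  rw [map_neg, LinearMap.neg_apply] at hneg
  linarith

/-- The isometries of Minkowski space that do not exchange past and future. It suffices to check
the latter on a single timelike vector. -/
structure IsLorentz (L : (Fin 3 → ℝ) ≃ₗ[ℝ] Fin 3 → ℝ) : Prop where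
  mink_map : ∀ X Y, mink (L X) (L Y) = mink X Y
  exists_time_pos : ∃ X, 0 < mink X X ∧ 0 < X 2 ∧ 0 < L X 2

/-- The action on the unit disk of an isometry of Minkowski space. -/
noncomputable def diskMap (L : (Fin 3 → ℝ) ≃ₗ[ℝ] Fin 3 → ℝ) (z : ℂ) : ℂ := proj (L (lift z))

namespace IsLorentz

variable {L : (Fin 3 → ℝ) ≃ₗ[ℝ] Fin 3 → ℝ} {z w : ℂ}

theorem symm (hL : IsLorentz L) : IsLorentz L.symm where
  mink_map X Y := by rw [← hL.mink_map, L.apply_symm_apply, L.apply_symm_apply]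
  exists_time_pos := by
    obtain ⟨X, hX, hX2, hLX⟩ := hL.exists_time_pos
    exact ⟨L X, by rwa [hL.mink_map], hLX, by rwa [L.symm_apply_apply]⟩

theorem mink_map_lift_self (hL : IsLorentz L) (hz : z ∈ Metric.ball (0 : ℂ) 1) :
    mink (L (lift z)) (L (lift z)) = 1 := by
  rw [hL.mink_map, mink_lift_self hz]

theorem map_lift_time_pos (hL : IsLorentz L) (hz : z ∈ Metric.ball (0 : ℂ) 1) :
    0 < L (lift z) 2 := by
  obtain ⟨X, hX, hX2, hLX⟩ := hL.exists_time_pos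
  refine time_pos_of_mink_pos (Y := L X) ?_ (by rwa [hL.mink_map]) hLX ?_
  · rw [hL.mink_map_lift_self hz]
    exact one_pos
  · rw [hL.mink_map]
    exact mink_pos_of_time_pos (by rw [mink_lift_self hz]; exact one_pos) hX (lift_time_pos hz) hX2

theorem diskMap_mem (hL : IsLorentz L) (hz : z ∈ Metric.ball (0 : ℂ) 1) :
    diskMap L z ∈ Metric.ball (0 : ℂ) 1 :=
  proj_mem_ball (hL.mink_map_lift_self hz) (hL.map_lift_time_pos hz)

theorem lift_diskMap (hL : IsLorentz L) (hz : z ∈ Metric.ball (0 : ℂ) 1) :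
    lift (diskMap L z) = L (lift z) :=
  lift_proj (hL.mink_map_lift_self hz) (hL.map_lift_time_pos hz)

theorem diskMap_symm_diskMap (hL : IsLorentz L) (hz : z ∈ Metric.ball (0 : ℂ) 1) :
    diskMap L.symm (diskMap L z) = z := by
  rw [diskMap, hL.lift_diskMap hz, L.symm_apply_apply, proj_lift hz]

theorem diskMap_diskMap_symm (hL : IsLorentz L) (hz : z ∈ Metric.ball (0 : ℂ) 1) :
    diskMap L (diskMap L.symm z) = z :=
  hL.symm.diskMap_symm_diskMap hz

theorem hypDist_diskMap (hL : IsLorentz L) (hz : z ∈ Metric.ball (0 : ℂ) 1)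
    (hw : w ∈ Metric.ball (0 : ℂ) 1) : hypDist (diskMap L z) (diskMap L w) = hypDist z w := by
  rw [hypDist_eq (hL.diskMap_mem hz) (hL.diskMap_mem hw), hL.lift_diskMap hz, hL.lift_diskMap hw,
    hL.mink_map, hypDist_eq hz hw]

theorem isHyperbolicIsometry (hL : IsLorentz L) : IsHyperbolicIsometry (diskMap L) :=
  ⟨InvOn.bijOn (f' := diskMap L.symm)
    ⟨fun _ hz => hL.diskMap_symm_diskMap hz, fun _ hz => hL.diskMap_diskMap_symm hz⟩
    (fun _ hz => hL.diskMap_mem hz) fun _ hz => hL.symm.diskMap_mem hz,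
    fun _ hz _ hw => hL.hypDist_diskMap hz hw⟩

end IsLorentz

namespace ClosedDisk

theorem vec_time_pos {D : ClosedDisk} (h : ‖D.center‖ + D.radius < 1) : 0 < D.vec 2 := by
  have hd := D.radius_pos
  have hnum : 0 < 1 + Complex.normSq D.center - D.radius ^ 2 := by
    nlinarith [Complex.normSq_nonneg D.center, norm_nonneg D.center]
  simp only [vec, Matrix.cons_val]
  positivity

theorem mink_vec_self_pos {D : ClosedDisk} (h : ‖D.center‖ + D.radius < 1) :
    0 < mink D.vec D.vec := by
  rw [mink_vec_self]
  exact sub_pos.2 (one_lt_pow₀ (one_lt_curv h) two_ne_zero)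

theorem mem_carrier_iff {D : ClosedDisk} {z : ℂ} (hz : z ∈ Metric.ball (0 : ℂ) 1) :
    z ∈ D.carrier ↔ mink (lift z) D.vec ≤ D.curv := by
  have hpos := one_sub_normSq_pos hz
  have hd := D.radius_pos
  have curv_sub_mink : D.curv - mink (lift z) D.vec =
      (D.radius ^ 2 - Complex.normSq (z - D.center)) / ((1 - Complex.normSq z) * D.radius) := by
    have hne := hpos.ne'
    have hn := Complex.normSq_apply z
    have hm := Complex.normSq_apply D.center
    simp only [mink_apply, lift, vec, Matrix.cons_val, curv]
    rw [Complex.normSq_apply (z - _), Complex.sub_re, Complex.sub_im]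
    generalize Complex.normSq z = n at *
    generalize Complex.normSq D.center = m at *
    field_simp
    linear_combination -2 * hn - 2 * hm
  rw [← sub_nonneg, curv_sub_mink, carrier, Metric.mem_closedBall, dist_eq_norm,
    le_div_iff₀ (by positivity), zero_mul, sub_nonneg, Complex.normSq_eq_norm_sq,
    sq_le_sq₀ (norm_nonneg _) hd.le]

theorem image_diskMap_carrier {L : (Fin 3 → ℝ) ≃ₗ[ℝ] Fin 3 → ℝ} (hL : IsLorentz L)
    {D E : ClosedDisk} (hD : D.carrier ⊆ Metric.ball 0 1) (hE : E.carrier ⊆ Metric.ball 0 1)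
    (hcurv : D.curv = E.curv) (hLD : L D.vec = E.vec) : diskMap L '' D.carrier = E.carrier := by
  have mem_iff : ∀ z ∈ Metric.ball (0 : ℂ) 1, diskMap L z ∈ E.carrier ↔ z ∈ D.carrier :=
    fun z hz => by
      rw [mem_carrier_iff hz, mem_carrier_iff (hL.diskMap_mem hz), hL.lift_diskMap hz, ← hLD,
        hL.mink_map, hcurv]
  refine Subset.antisymm (image_subset_iff.2 fun z hz => (mem_iff z (hD hz)).2 hz) fun w hw => ?_
  refine ⟨diskMap L.symm w, (mem_iff _ (hL.symm.diskMap_mem (hE hw))).1 ?_,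
    hL.diskMap_diskMap_symm (hE hw)⟩
  rwa [hL.diskMap_diskMap_symm (hE hw)]

end ClosedDisk

/-! ### Rigidity -/

theorem ClosedDisk.gram_ne_zero {D A : ClosedDisk} (hD : 1 < D.curv) (hA : 1 < A.curv)
    (h : 0 ≤ invProd D A) :
    mink D.vec D.vec * mink A.vec A.vec - mink D.vec A.vec ^ 2 ≠ 0 := by
  rw [mink_vec_self, mink_vec_self, mink_vec]
  have hmul : 0 ≤ invProd D A * (D.curv * A.curv) :=
    mul_nonneg h (mul_pos (zero_lt_one.trans hD) (zero_lt_one.trans hA)).le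
  have hD2 := one_lt_pow₀ hD two_ne_zero
  have hA2 := one_lt_pow₀ hA two_ne_zero
  refine ne_of_lt ?_
  linarith [sq_nonneg (invProd D A)]

section Flower

variable {V : Type*} [DecidableEq V] {G : SimpleGraph V} {F : Set (Finset V)}
  {P P' : V → ClosedDisk} {v : V} {σ σ' : Equiv.Perm (Nbr G v)}
  {L : (Fin 3 → ℝ) ≃ₗ[ℝ] Fin 3 → ℝ}

theorem IsFlower.vol_mul_neg (hF : IsTriangulation G F)
    (hP' : IsPacking G F P') (hin' : ∀ v, ‖(P' v).center‖ + (P' v).radius < 1)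
    (hσ : IsFlower F (fun v => (P v).center) v σ) (hσ' : IsFlower F (fun v => (P' v).center) v σ')
    (a : Nbr G v) : vol (P' v).vec (P' (σ a)).vec (P' a).vec *
      vol (P' v).vec (P' (σ a)).vec (P' (σ (σ a))).vec < 0 := by
  have pos : ∀ a : Nbr G v, 0 < vol (P' v).vec (P' a).vec (P' (σ' a)).vec :=
    hP'.vol_pos hF hin' hσ'
  have ne : ∀ a : Nbr G v, a ≠ σ a := fun a e => (hσ.adj hF a).ne (congrArg Subtype.val e)
  have hne := hσ.apply_apply_ne a
  rcases hσ'.eq_or_eq a (σ a) (ne a) (hσ.face a) with h | h <;>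
    rcases hσ'.eq_or_eq (σ a) (σ (σ a)) (ne _) (hσ.face _) with h' | h'
  · rw [vol_swap, neg_mul, neg_lt_zero]
    have hpos := mul_pos (pos a) (pos (σ a))
    rwa [← h, ← h'] at hpos
  · exact absurd (σ'.injective (h'.symm.trans h)) hne
  · exact absurd (h'.trans h.symm) hne
  · rw [vol_swap _ (P' (σ (σ a))).vec, mul_neg, neg_lt_zero]
    have hpos := mul_pos (pos (σ a)) (pos (σ (σ a)))
    rwa [← h, ← h'] at hpos

theorem IsFlower.map_vec_next (hF : IsTriangulation G F)
    (hP : IsPacking G F P) (hP' : IsPacking G F P')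
    (hmink : ∀ u w, u = w ∨ G.Adj u w → mink (P u).vec (P w).vec = mink (P' u).vec (P' w).vec)
    (hin : ∀ v, ‖(P v).center‖ + (P v).radius < 1)
    (hin' : ∀ v, ‖(P' v).center‖ + (P' v).radius < 1)
    (hσ : IsFlower F (fun v => (P v).center) v σ) (hL : ∀ X Y, mink (L X) (L Y) = mink X Y)
    (hv : L (P v).vec = (P' v).vec) {a : Nbr G v} (ha : L (P a).vec = (P' a).vec)
    (hσa : L (P (σ a)).vec = (P' (σ a)).vec) : L (P (σ (σ a))).vec = (P' (σ (σ a))).vec := by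
  obtain ⟨σ', hσ'⟩ := hP'.drawing.exists_isFlower hF v
  have vol_map_equiv : ∀ X Y Z, vol (L X) (L Y) (L Z) = LinearMap.det L.toLinearMap * vol X Y Z :=
    vol_map L.toLinearMap
  refine eq_of_mink_of_vol (X := (P' v).vec) (Y := (P' (σ a)).vec)
    (ClosedDisk.gram_ne_zero (ClosedDisk.one_lt_curv (hin' v)) (ClosedDisk.one_lt_curv (hin' _))
      (hP'.invProd_mem (σ a).2).1) ?_ ?_ ?_ ?_
  · rw [← hv, hL, hmink _ _ (.inr (σ (σ a)).2), hv]
  · rw [← hσa, hL, hmink _ _ (.inr (hσ.adj hF (σ a))), hσa]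
  · rw [hL, hmink _ _ (.inl rfl)]
  · have hneg := hσ.vol_mul_neg hF hP' hin' hσ' a
    have hpos := hP.vol_pos hF hin hσ a
    have hpos_next := hP.vol_pos hF hin hσ (σ a)
    rw [← hv, ← ha, ← hσa, vol_map_equiv, vol_swap, mul_neg, neg_mul, neg_lt_zero] at hneg
    rw [← hv, ← hσa, vol_map_equiv]
    generalize vol (L (P v).vec) (L (P (σ a)).vec) (P' (σ (σ a))).vec = d' at *
    generalize vol (P v).vec (P (σ a)).vec (P (σ (σ a))).vec = d at *
    generalize vol (P v).vec (P a).vec (P (σ a)).vec = e at *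
    generalize LinearMap.det L.toLinearMap = δ at *
    have hmul : 0 < e * (δ * d') := by linarith
    have := mul_pos hpos_next ((pos_iff_pos_of_mul_pos hmul).1 hpos)
    linarith

theorem IsFlower.map_vec (hF : IsTriangulation G F)
    (hP : IsPacking G F P) (hP' : IsPacking G F P')
    (hmink : ∀ u w, u = w ∨ G.Adj u w → mink (P u).vec (P w).vec = mink (P' u).vec (P' w).vec)
    (hin : ∀ v, ‖(P v).center‖ + (P v).radius < 1)
    (hin' : ∀ v, ‖(P' v).center‖ + (P' v).radius < 1)
    (hσ : IsFlower F (fun v => (P v).center) v σ) (hL : ∀ X Y, mink (L X) (L Y) = mink X Y)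
    (hv : L (P v).vec = (P' v).vec) {a : Nbr G v} (ha : L (P a).vec = (P' a).vec)
    (hσa : L (P (σ a)).vec = (P' (σ a)).vec) (b : Nbr G v) : L (P b).vec = (P' b).vec := by
  have : Finite (Nbr G v) := hF.finite_nbrs v
  exact (hσ.induction hP.drawing
    (p := fun c => L (P c).vec = (P' c).vec ∧ L (P (σ c)).vec = (P' (σ c)).vec)
    (fun c hc => ⟨hc.2, hσ.map_vec_next hF hP hP' hmink hin hin' hL hv hc.1 hc.2⟩)
    ⟨ha, hσa⟩ b).1

theorem IsFlower.exists_map_vec_eq (hF : IsTriangulation G F)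
    (hP : IsPacking G F P) (hP' : IsPacking G F P')
    (hmink : ∀ u w, u = w ∨ G.Adj u w → mink (P u).vec (P w).vec = mink (P' u).vec (P' w).vec)
    (hin : ∀ v, ‖(P v).center‖ + (P v).radius < 1)
    (hin' : ∀ v, ‖(P' v).center‖ + (P' v).radius < 1)
    (hσ : IsFlower F (fun v => (P v).center) v σ) :
    ∃ L : (Fin 3 → ℝ) ≃ₗ[ℝ] Fin 3 → ℝ, (∀ X Y, mink (L X) (L Y) = mink X Y) ∧
      L (P v).vec = (P' v).vec ∧ ∀ b : Nbr G v, L (P b).vec = (P' b).vec := by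
  obtain ⟨σ', hσ'⟩ := hP'.drawing.exists_isFlower hF v
  obtain ⟨a⟩ := hF.nonempty_nbr v
  let T : Fin 3 → V := ![v, a, σ a]
  have hvol' : vol (P' v).vec (P' a).vec (P' (σ a)).vec ≠ 0 := by
    rw [← neg_ne_zero, ← vol_swap]
    exact left_ne_zero_of_mul (hσ.vol_mul_neg hF hP' hin' hσ' a).ne
  have hgram : ∀ i j, mink (P (T i)).vec (P (T j)).vec = mink (P' (T i)).vec (P' (T j)).vec := by
    have hva := a.2
    have hvb := (σ a).2
    have hab := hσ.adj hF a
    intro i j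
    refine hmink _ _ ?_
    fin_cases i <;> fin_cases j <;> simp [T, hva, hvb, hab, hva.symm, hvb.symm, hab.symm]
  obtain ⟨L, hLT, hL⟩ := exists_linearEquiv_of_mink_eq (X := fun i => (P (T i)).vec)
    (Y := fun i => (P' (T i)).vec) (hP.vol_pos hF hin hσ a).ne' hvol' hgram
  exact ⟨L, hL, hLT 0, hσ.map_vec hF hP hP' hmink hin hin' hL (hLT 0) (hLT 1) (hLT 2)⟩

end Flower

section Rigidity

variable {V : Type*} {G : SimpleGraph V} {F : Set (Finset V)} {P P' : V → ClosedDisk}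

theorem IsPacking.map_vec_of_walk {L : (Fin 3 → ℝ) ≃ₗ[ℝ] Fin 3 → ℝ} (hF : IsTriangulation G F)
    (hP : IsPacking G F P) (hP' : IsPacking G F P')
    (hmink : ∀ u w, u = w ∨ G.Adj u w → mink (P u).vec (P w).vec = mink (P' u).vec (P' w).vec)
    (hin : ∀ v, ‖(P v).center‖ + (P v).radius < 1)
    (hin' : ∀ v, ‖(P' v).center‖ + (P' v).radius < 1)
    (hL : ∀ X Y, mink (L X) (L Y) = mink X Y) {x y : V} (p : G.Walk x y)
    (hx : L (P x).vec = (P' x).vec) (hnbr : ∀ b : Nbr G x, L (P b).vec = (P' b).vec) :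
    L (P y).vec = (P' y).vec := by
  classical
  induction p with
  | nil => exact hx
  | @cons x u y hxu _ ih =>
    obtain ⟨σ, hσ⟩ := hP.drawing.exists_isFlower hF u
    refine ih (hnbr ⟨u, hxu⟩) (hσ.map_vec hF hP hP' hmink hin hin' hL (hnbr ⟨u, hxu⟩)
      (a := ⟨x, hxu.symm⟩) hx ?_)
    exact hnbr ⟨(σ ⟨x, hxu.symm⟩).1, hσ.adj hF ⟨x, hxu.symm⟩⟩

theorem IsPacking.exists_isLorentz (hF : IsTriangulation G F)
    (hP : IsPacking G F P) (hP' : IsPacking G F P')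
    (hinv : ∀ u v, G.Adj u v → invProd (P u) (P v) = invProd (P' u) (P' v))
    (hcurv : ∀ v, (P v).curv = (P' v).curv) (hin : ∀ v, ‖(P v).center‖ + (P v).radius < 1)
    (hin' : ∀ v, ‖(P' v).center‖ + (P' v).radius < 1) :
    ∃ L : (Fin 3 → ℝ) ≃ₗ[ℝ] Fin 3 → ℝ, IsLorentz L ∧ ∀ v, L (P v).vec = (P' v).vec := by
  classical
  have hmink : ∀ u w, u = w ∨ G.Adj u w →
      mink (P u).vec (P w).vec = mink (P' u).vec (P' w).vec := by
    rintro u w (rfl | h)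
    · rw [ClosedDisk.mink_vec_self, ClosedDisk.mink_vec_self, hcurv]
    · rw [ClosedDisk.mink_vec, ClosedDisk.mink_vec, hinv u w h, hcurv, hcurv]
  have := hF.infinite
  have v : V := Classical.arbitrary V
  obtain ⟨σ, hσ⟩ := hP.drawing.exists_isFlower hF v
  obtain ⟨L, hL, hv, hnbr⟩ := hσ.exists_map_vec_eq hF hP hP' hmink hin hin'
  refine ⟨L, ⟨hL, (P v).vec, ClosedDisk.mink_vec_self_pos (hin v),
    ClosedDisk.vec_time_pos (hin v), ?_⟩, fun w => ?_⟩
  · rw [hv]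
    exact ClosedDisk.vec_time_pos (hin' v)
  · obtain ⟨p⟩ := hF.connected v w
    exact hP.map_vec_of_walk hF hP' hmink hin hin' hL p hv hnbr

end Rigidity

end DiskPatterns

theorem mainTheorem2 {V : Type*} (G : SimpleGraph V) (Θ : Sym2 V → ℝ)
    (hG : DiskPatterns.IsDiskTriangulationGraph G)
    (hΘ : ∀ e ∈ G.edgeSet, Θ e ∈ Set.Icc 0 (Real.pi / 2))
    (hsep : DiskPatterns.SeparatingTriangleCondition G Θ)
    (P Pstar : V → DiskPatterns.ClosedDisk)
    (hP : DiskPatterns.Realizes P G Θ)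
    (hPstar : DiskPatterns.Realizes Pstar G Θ)
    (hPfin : DiskPatterns.IsLocallyFiniteIn P (Metric.ball 0 1))
    (hPstarfin : DiskPatterns.IsLocallyFiniteIn Pstar (Metric.ball 0 1)) :
    ∃ f : ℂ → ℂ, DiskPatterns.IsHyperbolicIsometry f ∧
      ∀ v : V, (Pstar v).carrier = f '' (P v).carrier := by
  classical
  obtain ⟨F, hF, hpack⟩ := DiskPatterns.exists_isTriangulation hG hΘ hsep
  have h := hpack P hP hPfin
  have hstar := hpack Pstar hPstar hPstarfin
  have hin := fun v => DiskPatterns.ClosedDisk.norm_add_radius_lt_one (hPfin.1 v)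
  have hinstar := fun v => DiskPatterns.ClosedDisk.norm_add_radius_lt_one (hPstarfin.1 v)
  have hinv : ∀ u v, G.Adj u v → DiskPatterns.invProd (P u) (P v) =
      DiskPatterns.invProd (Pstar u) (Pstar v) := fun u v huv => by
    rw [hP.invProd_eq huv, hPstar.invProd_eq huv]
  have hcurv : ∀ v, (P v).curv = (Pstar v).curv := fun v =>
    le_antisymm (h.curv_le_of_locallyFinite hF hstar hinv hPfin hinstar v)
      (hstar.curv_le_of_locallyFinite hF h (fun u v huv => (hinv u v huv).symm) hPstarfin hin v)
  obtain ⟨L, hL, hLP⟩ := h.exists_isLorentz hF hstar hinv hcurv hin hinstar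
  exact ⟨DiskPatterns.diskMap L, hL.isHyperbolicIsometry, fun v =>
    (DiskPatterns.ClosedDisk.image_diskMap_carrier hL (hPfin.1 v) (hPstarfin.1 v) (hcurv v)
      (hLP v)).symm⟩
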